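/- Work over a field $k$; unadorned $\otimes$ is over $k$, and sums are suppressed in Sweedler-type notation. **Setting.** A *quasi-bialgebra* is an algebra $H$ with algebra maps $\Delta:H\to H\otimes H$, $\Delta(h)=h_1\otimes h_2$, $\varepsilon:H\to k$ and an invertible $\Phi=X^1\otimes X^2\otimes X^3\in H^{\otimes 3}$ with inverse $\Phi^{-1}=x^1\otimes x^2\otimes x^3$, such that $(id\otimes\Delta)\Delta(h)=\Phi\,(\Delta\otimes id)\Delta(h)\,\Phi^{-1}$, $(id\otimes\varepsilon)\Delta=(\varepsilon\otimes id)\Delta=id$, $(1\otimes\Phi)(id\otimes\Delta\otimes id)(\Phi)(\Phi\otimes1)=(id\otimes id\otimes\Delta)(\Phi)(\Delta\otimes id\otimes id)(\Phi)$ and $(id\otimes\varepsilon\otimes id)(\Phi)=1\otimes1$. It is a *quasi-Hopf algebra* if it is equipped with an algebra anti-automorphism $S$ and $\alpha,\beta\in H$ with $S(h_1)\alpha h_2=\varepsilon(h)\alpha$, $h_1\beta S(h_2)=\varepsilon(h)\beta$, $X^1\beta S(X^2)\alpha X^3=1$, $S(x^1)\alpha x^2\beta S(x^3)=1$. The inverse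 $f^{-1}=g^1\otimes g^2$ of its Drinfeld twist is $$f^{-1}=\Delta(S(x^1)\alpha x^2)\,\delta\,(S\otimes S)(\Delta^{\rm cop}(x^3)),\qquad \delta=B^1\beta S(B^4)\otimes B^2\beta S(B^3),$$ where $B^1\otimes B^2\otimes B^3\otimes B^4=(\Delta\otimes id\otimes id)(\Phi)(\Phi^{-1}\otimes1)$. An *$H$-bicomodule algebra* is an algebra $\mathbb A$ with algebra maps $\lambda:\mathbb A\to H\otimes\mathbb A$, $\lambda(u)=u_{[-1]}\otimes u_{[0]}$, and $\rho:\mathbb A\to\mathbb A\otimes H$, $\rho(u)=u_{\langle0\rangle}\otimes u_{\langle1\rangle}$, and invertible elements $\Phi_\lambda=\tilde X^1_\lambda\otimes\tilde X^2_\lambda\otimes\tilde X^3_\lambda\in H\otimes H\otimes\mathbb A$, $\Phi_\rho\in\mathbb A\otimes H\otimes H$, $\Phi_{\lambda,\rho}\in H\otimes\mathbb A\otimes H$, with inverses $\tilde x^1_\lambda\otimes\tilde x^2_\lambda\otimes\tilde x^3_\lambda$, $\tilde x^1_\rho\otimes\tilde x^2_\rho\otimes\tilde x^3_\rho$, $\theta^1\otimes\theta^2\otimes\theta^3$,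 such that for all $u$: - $(id\otimes\lambda)(\lambda(u))\Phi_\lambda=\Phi_\lambda(\Delta\otimes id)(\lambda(u))$, $(1\otimes\Phi_\lambda)(id\otimes\Delta\otimes id)(\Phi_\lambda)(\Phi\otimes1)=(id\otimes id\otimes\lambda)(\Phi_\lambda)(\Delta\otimes id\otimes id)(\Phi_\lambda)$, $(\varepsilon\otimes id)\lambda=id$, $(id\otimes\varepsilon\otimes id)(\Phi_\lambda)=(\varepsilon\otimes id\otimes id)(\Phi_\lambda)=1$; - $\Phi_\rho(\rho\otimes id)(\rho(u))=(id\otimes\Delta)(\rho(u))\Phi_\rho$, $(1\otimes\Phi)(id\otimes\Delta\otimes id)(\Phi_\rho)(\Phi_\rho\otimes1)=(id\otimes id\otimes\Delta)(\Phi_\rho)(\rho\otimes id\otimes id)(\Phi_\rho)$, $(id\otimes\varepsilon)\rho=id$, $(id\otimes\varepsilon\otimes id)(\Phi_\rho)=(id\otimes id\otimes\varepsilon)(\Phi_\rho)=1$; - $\Phi_{\lambda,\rho}(\lambda\otimes id)(\rho(u))=(id\otimes\rho)(\lambda(u))\Phi_{\lambda,\rho}$, $(1\otimes\Phi_{\lambda,\rho})(id\otimes\lambda\otimes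 id)(\Phi_{\lambda,\rho})(\Phi_\lambda\otimes1)=(id\otimes id\otimes\rho)(\Phi_\lambda)(\Delta\otimes id\otimes id)(\Phi_{\lambda,\rho})$, $(1\otimes\Phi_\rho)(id\otimes\rho\otimes id)(\Phi_{\lambda,\rho})(\Phi_{\lambda,\rho}\otimes1)=(id\otimes id\otimes\Delta)(\Phi_{\lambda,\rho})(\lambda\otimes id\otimes id)(\Phi_\rho)$. Put $\tilde q_\lambda=\tilde q^1_\lambda\otimes\tilde q^2_\lambda=S(\tilde x^1_\lambda)\alpha\tilde x^2_\lambda\otimes\tilde x^3_\lambda\in H\otimes\mathbb A$. An *$H$-bimodule coalgebra* is an $(H,H)$-bimodule $C$ with linear maps $\underline\Delta:C\to C\otimes C$, $\underline\Delta(c)=c_{\underline1}\otimes c_{\underline2}$, and $\underline\varepsilon:C\to k$ such that $\Phi\cdot(\underline\Delta\otimes id)\underline\Delta(c)\cdot\Phi^{-1}=(id\otimes\underline\Delta)\underline\Delta(c)$, $\underline\Delta(h\cdot c)=\Delta(h)\cdot\underline\Delta(c)$, $\underline\Delta(c\cdot h)=\underline\Delta(c)\cdot\Delta(h)$, $(\underline\varepsilon\otimes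 id)\underline\Delta=(id\otimes\underline\varepsilon)\underline\Delta=id$, $\underline\varepsilon(h\cdot c)=\varepsilon(h)\underline\varepsilon(c)$ and $\underline\varepsilon(c\cdot h)=\underline\varepsilon(c)\varepsilon(h)$. A *left-right $(H,\mathbb A,C)$-Yetter-Drinfeld module* is a left $\mathbb A$-module $M$ with a $k$-linear map $\rho_M:M\to M\otimes C$, $\rho_M(m)=m_{(0)}\otimes m_{(1)}$, such that for all $m\in M$, $u\in\mathbb A$: $\underline\varepsilon(m_{(1)})m_{(0)}=m$, $$(\theta^2\cdot m_{(0)})_{(0)}\otimes(\theta^2\cdot m_{(0)})_{(1)}\cdot\theta^1\otimes\theta^3\cdot m_{(1)}=\tilde x^1_\rho\cdot(\tilde x^3_\lambda\cdot m)_{(0)}\otimes\tilde x^2_\rho\cdot(\tilde x^3_\lambda\cdot m)_{(1)_{\underline1}}\cdot\tilde x^1_\lambda\otimes\tilde x^3_\rho\cdot(\tilde x^3_\lambda\cdot m)_{(1)_{\underline2}}\cdot\tilde x^2_\lambda,$$ $$u_{\langle0\rangle}\cdot m_{(0)}\otimes u_{\langle1\rangle}\cdot m_{(1)}=(u_{[0]}\cdot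 m)_{(0)}\otimes(u_{[0]}\cdot m)_{(1)}\cdot u_{[-1]}.$$ With the $\mathbb A$-linear and $C$-colinear maps as morphisms, these form the category ${}_{\mathbb A}\mathcal{YD}(H)^C$. Let ${}_{\mathbb A}\mathcal M$ be the category of left $\mathbb A$-modules. **Theorem.** Let $H$ be a quasi-Hopf algebra, $\mathbb A$ an $H$-bicomodule algebra and $C$ an $H$-bimodule coalgebra. For every left $\mathbb A$-module $M$, the space $M\otimes C$ with the structure maps $$u\cdot(m\otimes c)=u_{[0]_{\langle0\rangle}}\cdot m\otimes u_{[0]_{\langle1\rangle}}\cdot c\cdot S^{-1}(u_{[-1]}),$$ $$\begin{aligned}\rho_{M\otimes C}(m\otimes c)={}&\theta^2_{\langle0\rangle}\tilde x^1_\rho\big((\tilde q^2_\lambda)_{[0]}\tilde X^3_\lambda\big)_{\langle0\rangle}\cdot m\\ &\otimes\theta^2_{\langle1\rangle}\tilde x^2_\rho\big((\tilde q^2_\lambda)_{[0]}\tilde X^3_\lambda\big)_{\langle1\rangle_1}\cdot c_{\underline1}\cdot S^{-1}\big(\theta^1(\tilde q^2_\lambda)_{[-1]}\tilde X^2_\lambda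 g^2\big)\\ &\otimes\theta^3\tilde x^3_\rho\big((\tilde q^2_\lambda)_{[0]}\tilde X^3_\lambda\big)_{\langle1\rangle_2}\cdot c_{\underline2}\cdot S^{-1}\big(\tilde q^1_\lambda\tilde X^1_\lambda g^1\big)\end{aligned}$$ is a left-right $(H,\mathbb A,C)$-Yetter-Drinfeld module; in particular so is $\mathbb A\otimes C$. Hence $M\mapsto M\otimes C$, $\upsilon\mapsto\upsilon\otimes id_C$ is a functor $\mathfrak F=\bullet\otimes C:{}_{\mathbb A}\mathcal M\to{}_{\mathbb A}\mathcal{YD}(H)^C$. Moreover: 1. $\mathfrak F$ is right adjoint to the forgetful functor ${}_{\mathbb A}\mathcal{YD}(H)^C\to{}_{\mathbb A}\mathcal M$. 2. $\mathfrak F$ is left adjoint to the functor ${\rm Hom}^C_{\mathbb A}(\mathbb A\otimes C,\bullet):{}_{\mathbb A}\mathcal{YD}(H)^C\to{}_{\mathbb A}\mathcal M$ that sends $N$ to the set of Yetter-Drinfeld morphisms $\mathbb A\otimes C\to N$, viewed as a left $\mathbb A$-module via $(u\cdot\eta)(u'\otimes c)=\eta(u'u\otimes c)$, and sends a morphism $\kappa$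 to $\eta\mapsto\kappa\circ\eta$. -/

import Mathlib

open CategoryTheory TensorProduct
open scoped ModuleCat

universe u

noncomputable section

namespace QuasiYD

/-! ### Maps out of tensor products, given by a formula on pure tensors

`bi f t`, `tri f t`, `quad f t` stand for the Sweedler sums `∑ f t¹ t²`, `∑ f t¹ t² t³`,
`∑ f t¹ t² t³ t⁴`. Iterated tensor products are bracketed to the right throughout. -/

section Sweedler

variable {k P Q R S X : Type*} [CommRing k] [AddCommGroup P] [Module k P] [AddCommGroup Q]
  [Module k Q] [AddCommGroup R] [Module k R] [AddCommGroup S] [Module k S]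
  [AddCommGroup X] [Module k X]

/-- The linear map `p ⊗ q ↦ f p q` for a bilinear `f`. -/
def bi (f : P → Q → X) (h₁ : ∀ q, IsLinearMap k fun p => f p q)
    (h₂ : ∀ p, IsLinearMap k fun q => f p q) : P ⊗[k] Q →ₗ[k] X :=
  TensorProduct.lift <| LinearMap.mk₂ k f (fun p p' q => (h₁ q).map_add p p')
    (fun c p q => (h₁ q).map_smul c p) (fun p q q' => (h₂ p).map_add q q')
    (fun c p q => (h₂ p).map_smul c q)

@[simp] lemma bi_tmul (f : P → Q → X) (h₁ : ∀ q, IsLinearMap k fun p => f p q)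
    (h₂ : ∀ p, IsLinearMap k fun q => f p q) (p : P) (q : Q) :
    bi f h₁ h₂ (p ⊗ₜ[k] q) = f p q := by
  simp [bi]

/-- The linear map `p ⊗ (q ⊗ r) ↦ f p q r` for a trilinear `f`. -/
def tri (f : P → Q → R → X) (h₁ : ∀ q r, IsLinearMap k fun p => f p q r)
    (h₂ : ∀ p r, IsLinearMap k fun q => f p q r)
    (h₃ : ∀ p q, IsLinearMap k fun r => f p q r) : P ⊗[k] (Q ⊗[k] R) →ₗ[k] X :=
  bi (fun p t => bi (f p) (h₂ p) (h₃ p) t)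
    (fun t => by
      induction t using TensorProduct.induction_on with
      | zero => constructor <;> simp
      | tmul q r => simpa using h₁ q r
      | add s t hs ht =>
        refine ⟨fun p p' => ?_, fun c p => ?_⟩
        · simp only [map_add, hs.map_add, ht.map_add]; abel
        · simp only [map_add, hs.map_smul, ht.map_smul, smul_add])
    (fun p => (bi (f p) (h₂ p) (h₃ p)).isLinear)

@[simp] lemma tri_tmul (f : P → Q → R → X) (h₁ : ∀ q r, IsLinearMap k fun p => f p q r)
    (h₂ : ∀ p r, IsLinearMap k fun q => f p q r) (h₃ : ∀ p q, IsLinearMap k fun r => f p q r)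
    (p : P) (q : Q) (r : R) : tri f h₁ h₂ h₃ (p ⊗ₜ[k] (q ⊗ₜ[k] r)) = f p q r := by
  simp [tri]

/-- The linear map `p ⊗ (q ⊗ (r ⊗ s)) ↦ f p q r s` for a quadrilinear `f`. -/
def quad (f : P → Q → R → S → X) (h₁ : ∀ q r s, IsLinearMap k fun p => f p q r s)
    (h₂ : ∀ p r s, IsLinearMap k fun q => f p q r s)
    (h₃ : ∀ p q s, IsLinearMap k fun r => f p q r s)
    (h₄ : ∀ p q r, IsLinearMap k fun s => f p q r s) :
    P ⊗[k] (Q ⊗[k] (R ⊗[k] S)) →ₗ[k] X :=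
  tri (fun p q t => bi (f p q) (h₃ p q) (h₄ p q) t)
    (fun q t => by
      induction t using TensorProduct.induction_on with
      | zero => constructor <;> simp
      | tmul r s => simpa using h₁ q r s
      | add s t hs ht =>
        refine ⟨fun p p' => ?_, fun c p => ?_⟩
        · simp only [map_add, hs.map_add, ht.map_add]; abel
        · simp only [map_add, hs.map_smul, ht.map_smul, smul_add])
    (fun p t => by
      induction t using TensorProduct.induction_on with
      | zero => constructor <;> simp
      | tmul r s => simpa using h₂ p r s
      | add s t hs ht =>
        refine ⟨fun p p' => ?_, fun c p => ?_⟩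
        · simp only [map_add, hs.map_add, ht.map_add]; abel
        · simp only [map_add, hs.map_smul, ht.map_smul, smul_add])
    (fun p q => (bi (f p q) (h₃ p q) (h₄ p q)).isLinear)

@[simp] lemma quad_tmul (f : P → Q → R → S → X)
    (h₁ : ∀ q r s, IsLinearMap k fun p => f p q r s)
    (h₂ : ∀ p r s, IsLinearMap k fun q => f p q r s)
    (h₃ : ∀ p q s, IsLinearMap k fun r => f p q r s)
    (h₄ : ∀ p q r, IsLinearMap k fun s => f p q r s) (p : P) (q : Q) (r : R) (s : S) :
    quad f h₁ h₂ h₃ h₄ (p ⊗ₜ[k] (q ⊗ₜ[k] (r ⊗ₜ[k] s))) = f p q r s := by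
  simp [quad]

end Sweedler

/-! ### Algebra maps between iterated tensor products -/

section AlgebraMaps

variable {k P Q R : Type*} [CommRing k] [Ring P] [Algebra k P] [Ring Q] [Algebra k Q]
  [Ring R] [Algebra k R]

/-- `id_S ⊗ f`. -/
abbrev idT (S : Type*) [Ring S] [Algebra k S] (f : P →ₐ[k] Q) : S ⊗[k] P →ₐ[k] S ⊗[k] Q :=
  Algebra.TensorProduct.map (AlgHom.id k S) f

/-- `f ⊗ id_S` for `f : P → Q ⊗ R`, rebracketed: `P ⊗ S → Q ⊗ (R ⊗ S)`. -/
abbrev tId (f : P →ₐ[k] Q ⊗[k] R) (S : Type*) [Ring S] [Algebra k S] :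
    P ⊗[k] S →ₐ[k] Q ⊗[k] (R ⊗[k] S) :=
  (Algebra.TensorProduct.assoc k k k Q R S).toAlgHom.comp
    (Algebra.TensorProduct.map f (AlgHom.id k S))

/-- `e ⊗ id_S` for `e : P → k`, as a map `P ⊗ S → S`. -/
abbrev evalL (e : P →ₐ[k] k) (S : Type*) [Ring S] [Algebra k S] : P ⊗[k] S →ₐ[k] S :=
  (Algebra.TensorProduct.lid k S).toAlgHom.comp
    (Algebra.TensorProduct.map e (AlgHom.id k S))

/-- `id_S ⊗ e` for `e : P → k`, as a map `S ⊗ P → S`. -/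
abbrev evalR (S : Type*) [Ring S] [Algebra k S] (e : P →ₐ[k] k) : S ⊗[k] P →ₐ[k] S :=
  (Algebra.TensorProduct.rid k k S).toAlgHom.comp
    (Algebra.TensorProduct.map (AlgHom.id k S) e)

/-- `x ↦ x ⊗ 1`. -/
abbrev tOne (S : Type*) [Ring S] [Algebra k S] : P →ₐ[k] P ⊗[k] S :=
  Algebra.TensorProduct.includeLeft

end AlgebraMaps

/-! ### Quasi-Hopf algebras -/

section Algebras

/-- A quasi-bialgebra over the field `k`, with reassociator `Φ`. -/
structure QuasiBialgebra (k H : Type*) [Field k] [Ring H] [Algebra k H] where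
  Δ : H →ₐ[k] H ⊗[k] H
  ε : H →ₐ[k] k
  Φ : (H ⊗[k] (H ⊗[k] H))ˣ
  quasi_coassoc : ∀ h, idT H Δ (Δ h) = Φ * tId Δ H (Δ h) * (↑Φ⁻¹ : H ⊗[k] (H ⊗[k] H))
  counit_right : ∀ h, evalR H ε (Δ h) = h
  counit_left : ∀ h, evalL ε H (Δ h) = h
  /-- `(1 ⊗ Φ) (id ⊗ Δ ⊗ id)(Φ) (Φ ⊗ 1) = (id ⊗ id ⊗ Δ)(Φ) (Δ ⊗ id ⊗ id)(Φ)` -/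
  cocycle : (1 ⊗ₜ Φ.val) * idT H (tId Δ H) Φ * idT H (idT H (tOne H)) Φ
    = idT H (idT H Δ) Φ * tId Δ (H ⊗[k] H) Φ
  cocycle_counit : idT H (evalL ε H) Φ = 1

/-- A quasi-Hopf algebra: `S` is an anti-automorphism of the algebra `H`. -/
structure QuasiHopfAlgebra (k H : Type*) [Field k] [Ring H] [Algebra k H]
    extends QuasiBialgebra k H where
  S : H ≃ₗ[k] H
  S_mul : ∀ h h', S (h * h') = S h' * S h
  α : H
  β : H
  S_α : ∀ h, bi (fun h₁ h₂ => S h₁ * α * h₂)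
    (fun _ => by constructor <;> intros <;> simp [add_mul])
    (fun _ => by constructor <;> intros <;> simp [mul_add]) (Δ h) = ε h • α
  β_S : ∀ h, bi (fun h₁ h₂ => h₁ * β * S h₂)
    (fun _ => by constructor <;> intros <;> simp [add_mul])
    (fun _ => by constructor <;> intros <;> simp [mul_add]) (Δ h) = ε h • β
  Φ_β_α : tri (fun X₁ X₂ X₃ => X₁ * β * S X₂ * α * X₃)
    (fun _ _ => by constructor <;> intros <;> simp [add_mul])
    (fun _ _ => by constructor <;> intros <;> simp [mul_add, add_mul])
    (fun _ _ => by constructor <;> intros <;> simp [mul_add])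
    (Φ : H ⊗[k] (H ⊗[k] H)) = 1
  Φ_α_β : tri (fun x₁ x₂ x₃ => S x₁ * α * x₂ * β * S x₃)
    (fun _ _ => by constructor <;> intros <;> simp [add_mul])
    (fun _ _ => by constructor <;> intros <;> simp [mul_add, add_mul])
    (fun _ _ => by constructor <;> intros <;> simp [mul_add])
    (↑Φ⁻¹ : H ⊗[k] (H ⊗[k] H)) = 1

variable {k H : Type*} [Field k] [Ring H] [Algebra k H]

namespace QuasiHopfAlgebra

variable (Q : QuasiHopfAlgebra k H)

/-- The inverse `S⁻¹` of the antipode. -/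
abbrev Sinv : H ≃ₗ[k] H := Q.S.symm

lemma Sinv_mul (h h' : H) : Q.Sinv (h * h') = Q.Sinv h' * Q.Sinv h := by
  apply Q.S.injective
  simp [Q.S_mul]

lemma Sinv_one : Q.Sinv 1 = 1 := by
  have h : Q.Sinv (1 * Q.S 1) = Q.Sinv (Q.S 1) * Q.Sinv 1 := Q.Sinv_mul _ _
  simpa using h.symm

/-- `(S ⊗ S) ∘ Δᶜᵒᵖ`. -/
def SSΔcop : H →ₗ[k] H ⊗[k] H :=
  TensorProduct.map Q.S.toLinearMap Q.S.toLinearMap ∘ₗ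
    (TensorProduct.comm k H H).toLinearMap ∘ₗ Q.Δ.toLinearMap

/-- `δ = B¹ β S(B⁴) ⊗ B² β S(B³)` with
`B¹ ⊗ B² ⊗ B³ ⊗ B⁴ = (Δ ⊗ id ⊗ id)(Φ) (Φ⁻¹ ⊗ 1)`. -/
def δ : H ⊗[k] H :=
  quad (fun B₁ B₂ B₃ B₄ => (B₁ * Q.β * Q.S B₄) ⊗ₜ[k] (B₂ * Q.β * Q.S B₃))
    (fun _ _ _ => by constructor <;> intros <;> simp [add_mul, add_tmul, smul_tmul'])
    (fun _ _ _ => by constructor <;> intros <;> simp [add_mul, tmul_add])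
    (fun _ _ _ => by constructor <;> intros <;> simp [mul_add, tmul_add])
    (fun _ _ _ => by constructor <;> intros <;> simp [mul_add, add_tmul, smul_tmul'])
    (tId Q.Δ (H ⊗[k] H) Q.Φ * idT H (idT H (tOne H)) (↑Q.Φ⁻¹ : H ⊗[k] (H ⊗[k] H)))

/-- The inverse `g¹ ⊗ g² = f⁻¹` of the Drinfeld twist:
`f⁻¹ = Δ(S(x¹) α x²) δ (S ⊗ S)(Δᶜᵒᵖ(x³))` with `x¹ ⊗ x² ⊗ x³ = Φ⁻¹`. -/
def twistInv : H ⊗[k] H :=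
  tri (fun x₁ x₂ x₃ => Q.Δ (Q.S x₁ * Q.α * x₂) * Q.δ * Q.SSΔcop x₃)
    (fun _ _ => by constructor <;> intros <;> simp [add_mul])
    (fun _ _ => by constructor <;> intros <;> simp [mul_add, add_mul])
    (fun _ _ => by constructor <;> intros <;> simp [mul_add])
    (↑Q.Φ⁻¹ : H ⊗[k] (H ⊗[k] H))

end QuasiHopfAlgebra

/-- An `H`-bicomodule algebra: a left coaction `lam`, a right coaction `rho`, and invertible
elements `Φl = Φ_λ`, `Φr = Φ_ρ`, `Φlr = Φ_{λ,ρ}`. -/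
structure BicomoduleAlgebra (Q : QuasiBialgebra k H) (A : Type*) [Ring A] [Algebra k A] where
  lam : A →ₐ[k] H ⊗[k] A
  rho : A →ₐ[k] A ⊗[k] H
  Φl : (H ⊗[k] (H ⊗[k] A))ˣ
  Φr : (A ⊗[k] (H ⊗[k] H))ˣ
  Φlr : (H ⊗[k] (A ⊗[k] H))ˣ
  -- `(A, lam, Φl)` is a left `H`-comodule algebra
  lam_coassoc : ∀ b, idT H lam (lam b) * Φl = Φl * tId Q.Δ A (lam b)
  lam_cocycle : (1 ⊗ₜ Φl.val) * idT H (tId Q.Δ A) Φl *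
      idT H (idT H (tOne A)) (Q.Φ : H ⊗[k] (H ⊗[k] H))
    = idT H (idT H lam) Φl * tId Q.Δ (H ⊗[k] A) Φl
  lam_counit : ∀ b, evalL Q.ε A (lam b) = b
  Φl_counit_mid : idT H (evalL Q.ε A) Φl = 1
  Φl_counit_left : evalL Q.ε (H ⊗[k] A) Φl = 1
  -- `(A, rho, Φr)` is a right `H`-comodule algebra
  rho_coassoc : ∀ a, Φr * tId rho H (rho a) = idT A Q.Δ (rho a) * Φr
  rho_cocycle : (1 ⊗ₜ Q.Φ.val) * idT A (tId Q.Δ H) Φr *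
      idT A (idT H (tOne H)) Φr
    = idT A (idT H Q.Δ) Φr * tId rho (H ⊗[k] H) Φr
  rho_counit : ∀ a, evalR A Q.ε (rho a) = a
  Φr_counit_mid : idT A (evalL Q.ε H) Φr = 1
  Φr_counit_right : idT A (evalR H Q.ε) Φr = 1
  -- the two coactions quasi-commute
  lr_comm : ∀ u, Φlr * tId lam H (rho u) = idT H rho (lam u) * Φlr
  lr_left : (1 ⊗ₜ Φlr.val) * idT H (tId lam H) Φlr * idT H (idT H (tOne H)) Φl
    = idT H (idT H rho) Φl * tId Q.Δ (A ⊗[k] H) Φlr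
  lr_right : (1 ⊗ₜ Φr.val) * idT H (tId rho H) Φlr * idT H (idT A (tOne H)) Φlr
    = idT H (idT A Q.Δ) Φlr * tId lam (H ⊗[k] H) Φr

end Algebras

/-! ### Operators on tensor products of modules -/

section Operators

variable {k : Type*} [Field k]

/-- Left multiplication `a ↦ (m ↦ a · m)`. -/
abbrev lop {A : Type*} [Ring A] [Algebra k A] (M : Type*) [AddCommGroup M] [Module k M]
    [Module A M] [IsScalarTower k A M] : A →ₗ[k] Module.End k M :=
  (Algebra.lsmul k k M).toLinearMap

/-- Right multiplication `h ↦ (c ↦ c · h)`; a right `H`-action is a left `Hᵐᵒᵖ`-action. -/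
abbrev rop {H : Type*} [Ring H] [Algebra k H] (C : Type*) [AddCommGroup C] [Module k C]
    [Module Hᵐᵒᵖ C] [IsScalarTower k Hᵐᵒᵖ C] : H →ₗ[k] Module.End k C :=
  (Algebra.lsmul k k C).toLinearMap ∘ₗ (MulOpposite.opLinearEquiv k : H ≃ₗ[k] Hᵐᵒᵖ).toLinearMap

/-- Componentwise operators: `p ⊗ q ↦ (m ⊗ n ↦ a p m ⊗ b q n)`. -/
abbrev opT {P Q M N : Type*} [AddCommGroup P] [Module k P] [AddCommGroup Q] [Module k Q]
    [AddCommGroup M] [Module k M] [AddCommGroup N] [Module k N]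
    (a : P →ₗ[k] Module.End k M) (b : Q →ₗ[k] Module.End k N) :
    P ⊗[k] Q →ₗ[k] Module.End k (M ⊗[k] N) :=
  TensorProduct.homTensorHomMap (RingHom.id k) M N M N ∘ₗ TensorProduct.map a b

end Operators

/-! ### Bimodule coalgebras and Yetter-Drinfeld modules -/

section YetterDrinfeld

variable {k H : Type*} [Field k] [Ring H] [Algebra k H]

/-- An `H`-bimodule coalgebra: a coalgebra in the monoidal category of `(H, H)`-bimodules. -/
structure BimoduleCoalgebra (Q : QuasiBialgebra k H) (C : Type*) [AddCommGroup C] [Module k C]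
    [Module H C] [IsScalarTower k H C] [Module Hᵐᵒᵖ C] [IsScalarTower k Hᵐᵒᵖ C]
    [SMulCommClass H Hᵐᵒᵖ C] where
  Δ : C →ₗ[k] C ⊗[k] C
  ε : C →ₗ[k] k
  /-- `Φ · (Δ ⊗ id)(Δ c) · Φ⁻¹ = (id ⊗ Δ)(Δ c)` -/
  coassoc : ∀ c,
    opT (lop C) (opT (lop C) (lop C)) (Q.Φ : H ⊗[k] (H ⊗[k] H))
      (opT (rop C) (opT (rop C) (rop C)) (↑Q.Φ⁻¹ : H ⊗[k] (H ⊗[k] H))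
        (TensorProduct.assoc k C C C (Δ.rTensor C (Δ c))))
      = Δ.lTensor C (Δ c)
  Δ_left : ∀ (h : H) c, Δ (h • c) = opT (lop C) (lop C) (Q.Δ h) (Δ c)
  Δ_right : ∀ (h : H) c, Δ (MulOpposite.op h • c) = opT (rop C) (rop C) (Q.Δ h) (Δ c)
  counit_left : ∀ c, TensorProduct.lid k C (ε.rTensor C (Δ c)) = c
  counit_right : ∀ c, TensorProduct.rid k C (ε.lTensor C (Δ c)) = c
  ε_left : ∀ (h : H) c, ε (h • c) = Q.ε h * ε c
  ε_right : ∀ (h : H) c, ε (MulOpposite.op h • c) = ε c * Q.ε h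

variable {Q : QuasiBialgebra k H} {A C : Type u} [Ring A] [Algebra k A]
  [AddCommGroup C] [Module k C] [Module H C] [IsScalarTower k H C] [Module Hᵐᵒᵖ C]
  [IsScalarTower k Hᵐᵒᵖ C] [SMulCommClass H Hᵐᵒᵖ C]

/-- The axioms of a left-right `(H, A, C)`-Yetter-Drinfeld module, for a left `A`-module `M`
and a linear map `r : M → M ⊗ C`, `m ↦ m₀ ⊗ m₁`. -/
structure IsYetterDrinfeld (B : BicomoduleAlgebra Q A) (D : BimoduleCoalgebra Q C)
    {M : Type*} [AddCommGroup M] [Module k M] [Module A M] [IsScalarTower k A M]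
    (r : M →ₗ[k] M ⊗[k] C) : Prop where
  counit : ∀ m, TensorProduct.rid k M (D.ε.lTensor M (r m)) = m
  /-- With `θ = Φ_{λ,ρ}⁻¹`, `y = Φ_ρ⁻¹` and `x = Φ_λ⁻¹`, the identity
  `(θ² · m₀)₀ ⊗ (θ² · m₀)₁ · θ¹ ⊗ θ³ · m₁
    = y¹ · (x³ · m)₀ ⊗ y² · (x³ · m)₁₁ · x¹ ⊗ y³ · (x³ · m)₁₂ · x²`. -/
  coassoc : ∀ m,
    tri (fun θ₁ θ₂ θ₃ => TensorProduct.assoc k M C C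
        (TensorProduct.map ((rop C θ₁).lTensor M ∘ₗ r ∘ₗ lop M θ₂) (lop C θ₃) (r m)))
      (fun _ _ => by
        constructor <;> intros <;> simp [LinearMap.add_comp, LinearMap.smul_comp,
          LinearMap.lTensor_add, LinearMap.lTensor_smul, TensorProduct.map_add_left,
          TensorProduct.map_smul_left])
      (fun _ _ => by
        constructor <;> intros <;> simp [LinearMap.comp_add, LinearMap.comp_smul,
          TensorProduct.map_add_left, TensorProduct.map_smul_left])
      (fun _ _ => by
        constructor <;> intros <;> simp [TensorProduct.map_add_right,
          TensorProduct.map_smul_right])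
      (↑B.Φlr⁻¹ : H ⊗[k] (A ⊗[k] H))
    = opT (lop M) (opT (lop C) (lop C)) (↑B.Φr⁻¹ : A ⊗[k] (H ⊗[k] H))
      (tri (fun x₁ x₂ x₃ => (TensorProduct.map (rop C x₁) (rop C x₂)).lTensor M
          (D.Δ.lTensor M (r (x₃ • m))))
        (fun _ _ => by
          constructor <;> intros <;> simp [LinearMap.lTensor_add, LinearMap.lTensor_smul,
            TensorProduct.map_add_left, TensorProduct.map_smul_left])
        (fun _ _ => by
          constructor <;> intros <;> simp [LinearMap.lTensor_add, LinearMap.lTensor_smul,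
            TensorProduct.map_add_right, TensorProduct.map_smul_right])
        (fun _ _ => by constructor <;> intros <;> simp [add_smul])
        (↑B.Φl⁻¹ : H ⊗[k] (H ⊗[k] A)))
  /-- `u₀ · m₀ ⊗ u₁ · m₁ = (u₀ · m)₀ ⊗ (u₀ · m)₁ · u₋₁`, with `rho u` on the left and `lam u`
  on the right. -/
  compat : ∀ (u : A) m,
    opT (lop M) (lop C) (B.rho u) (r m)
    = bi (fun h a => (rop C h).lTensor M (r (a • m)))
      (fun _ => by
        constructor <;> intros <;> simp [LinearMap.lTensor_add, LinearMap.lTensor_smul])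
      (fun _ => by constructor <;> intros <;> simp [add_smul]) (B.lam u)

/-- A left-right `(H, A, C)`-Yetter-Drinfeld module. -/
structure YDModule (B : BicomoduleAlgebra Q A) (D : BimoduleCoalgebra Q C) where
  carrier : Type u
  [addCommGroup : AddCommGroup carrier]
  [module : Module k carrier]
  [moduleA : Module A carrier]
  [tower : IsScalarTower k A carrier]
  coact : carrier →ₗ[k] carrier ⊗[k] C
  isYD : IsYetterDrinfeld B D coact

namespace YDModule

variable {B : BicomoduleAlgebra Q A} {D : BimoduleCoalgebra Q C}

instance : CoeSort (YDModule B D) (Type u) := ⟨carrier⟩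

attribute [instance] addCommGroup module moduleA tower

/-- The Yetter-Drinfeld morphisms `M → N`: the `A`-linear, `C`-colinear maps. They form a
subgroup of the group of `A`-linear maps. -/
def homs (M N : YDModule B D) : AddSubgroup (M →ₗ[A] N) where
  carrier := {f | ∀ m, (f.restrictScalars k).rTensor C (M.coact m) = N.coact (f m)}
  zero_mem' m := by
    have h : ((0 : M →ₗ[A] N).restrictScalars k) = 0 := rfl
    simp [h]
  add_mem' {f g} hf hg m := by
    have h : (f + g).restrictScalars k = f.restrictScalars k + g.restrictScalars k := rfl
    simp only [Set.mem_ofPred_eq] at hf hg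
    simp [h, LinearMap.rTensor_add, hf m, hg m]
  neg_mem' {f} hf m := by
    have h : (-f).restrictScalars k = -f.restrictScalars k := rfl
    simp only [Set.mem_ofPred_eq] at hf
    simp [h, LinearMap.rTensor_neg, hf m]

lemma id_mem (M : YDModule B D) : LinearMap.id ∈ homs M M := fun m => by
  have h : (LinearMap.id : M →ₗ[A] M).restrictScalars k = LinearMap.id := rfl
  simp [h]

lemma comp_mem {M N P : YDModule B D} {f : M →ₗ[A] N} {g : N →ₗ[A] P} (hf : f ∈ homs M N)
    (hg : g ∈ homs N P) : g ∘ₗ f ∈ homs M P := fun m => by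
  have h : (g ∘ₗ f).restrictScalars k = g.restrictScalars k ∘ₗ f.restrictScalars k := rfl
  rw [h, LinearMap.rTensor_comp, LinearMap.comp_apply, hf m, hg (f m), LinearMap.comp_apply]

/-- The category of left-right `(H, A, C)`-Yetter-Drinfeld modules. -/
instance : Category (YDModule B D) where
  Hom M N := homs M N
  id M := ⟨LinearMap.id, M.id_mem⟩
  comp f g := ⟨g.1 ∘ₗ f.1, comp_mem f.2 g.2⟩

/-- The forgetful functor to left `A`-modules. -/
def forgetful (B : BicomoduleAlgebra Q A) (D : BimoduleCoalgebra Q C) :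
    YDModule B D ⥤ ModuleCat.{u} A where
  obj M := ModuleCat.of A M
  map f := ModuleCat.ofHom f.1

end YDModule

end YetterDrinfeld

/-! ### The module `M ⊗ C`, its action and its coaction -/

section Induction

variable {k H : Type*} [Field k] [Ring H] [Algebra k H] {Q : QuasiHopfAlgebra k H}
  {A C : Type u} [Ring A] [Algebra k A]
  [AddCommGroup C] [Module k C] [Module H C] [IsScalarTower k H C] [Module Hᵐᵒᵖ C]
  [IsScalarTower k Hᵐᵒᵖ C] [SMulCommClass H Hᵐᵒᵖ C]
  (B : BicomoduleAlgebra Q.toQuasiBialgebra A) (D : BimoduleCoalgebra Q.toQuasiBialgebra C)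
  (M : Type u) [AddCommGroup M] [Module k M] [Module A M] [IsScalarTower k A M]

/-- The operator `m ⊗ c ↦ a · m ⊗ h' · c · S⁻¹(h)` of `h ⊗ a ⊗ h'`. -/
def twistedOp (Q : QuasiHopfAlgebra k H) (C M : Type u)
    [AddCommGroup C] [Module k C] [Module H C] [IsScalarTower k H C] [Module Hᵐᵒᵖ C]
    [IsScalarTower k Hᵐᵒᵖ C]
    [AddCommGroup M] [Module k M] [Module A M] [IsScalarTower k A M] :
    H ⊗[k] (A ⊗[k] H) →ₗ[k] Module.End k (M ⊗[k] C) :=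
  tri (fun h a h' => TensorProduct.map (lop M a) (lop C h' ∘ₗ rop C (Q.Sinv h)))
    (fun _ _ => by
      constructor <;> intros <;> simp [LinearMap.comp_add, LinearMap.comp_smul,
        TensorProduct.map_add_right, TensorProduct.map_smul_right])
    (fun _ _ => by
      constructor <;> intros <;> simp [TensorProduct.map_add_left,
        TensorProduct.map_smul_left])
    (fun _ _ => by
      constructor <;> intros <;> simp [LinearMap.add_comp, LinearMap.smul_comp,
        TensorProduct.map_add_right, TensorProduct.map_smul_right])

lemma twistedOp_one : twistedOp (A := A) Q C M 1 = 1 := by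
  have h : (1 : H ⊗[k] (A ⊗[k] H)) = 1 ⊗ₜ (1 ⊗ₜ 1) := rfl
  rw [h, twistedOp, tri_tmul, Q.Sinv_one]
  ext m c
  simp

lemma twistedOp_mul (s t : H ⊗[k] (A ⊗[k] H)) :
    twistedOp Q C M (s * t) = twistedOp Q C M s * twistedOp Q C M t := by
  induction s using TensorProduct.induction_on with
  | zero => simp
  | add s s' hs hs' => simp only [add_mul, map_add, hs, hs']
  | tmul h s =>
  induction s using TensorProduct.induction_on with
  | zero => simp
  | add s s' hs hs' => simp only [tmul_add, add_mul, map_add, hs, hs']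
  | tmul a h' =>
  induction t using TensorProduct.induction_on with
  | zero => simp
  | add s s' hs hs' => simp only [mul_add, map_add, hs, hs']
  | tmul g t =>
  induction t using TensorProduct.induction_on with
  | zero => simp
  | add s s' hs hs' => simp only [tmul_add, mul_add, map_add, hs, hs']
  | tmul b g' =>
  simp only [Algebra.TensorProduct.tmul_mul_tmul, twistedOp, tri_tmul, Q.Sinv_mul]
  ext m c
  simp [smul_comm]

/-- The action `u · (m ⊗ c) = (u_{[0]})_{⟨0⟩} · m ⊗ (u_{[0]})_{⟨1⟩} · c · S⁻¹(u_{[-1]})` of `A` on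
`M ⊗ C`, where `lam u = u_{[-1]} ⊗ u_{[0]}` and `rho u = u_{⟨0⟩} ⊗ u_{⟨1⟩}`. -/
def inducedAction : A →ₐ[k] Module.End k (M ⊗[k] C) :=
  AlgHom.ofLinearMap
    (twistedOp Q C M ∘ₗ (idT H B.rho).toLinearMap ∘ₗ B.lam.toLinearMap)
    (by
      change twistedOp Q C M (idT H B.rho (B.lam 1)) = 1
      rw [map_one, map_one, twistedOp_one])
    (fun u v => by
      change twistedOp Q C M (idT H B.rho (B.lam (u * v))) =
        twistedOp Q C M (idT H B.rho (B.lam u)) * twistedOp Q C M (idT H B.rho (B.lam v))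
      rw [map_mul, map_mul, twistedOp_mul])

/-- The vector space `M ⊗ C`, regarded as a left `A`-module through `inducedAction` (and not
through the action of `A` on the first factor). -/
@[nolint unusedArguments]
def Induced (_ : BicomoduleAlgebra Q.toQuasiBialgebra A)
    (_ : BimoduleCoalgebra Q.toQuasiBialgebra C) (M : Type u) [AddCommGroup M] [Module k M]
    [Module A M] [IsScalarTower k A M] : Type u :=
  M ⊗[k] C

instance : AddCommGroup (Induced B D M) := inferInstanceAs (AddCommGroup (M ⊗[k] C))

instance : Module k (Induced B D M) := inferInstanceAs (Module k (M ⊗[k] C))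

instance : Module A (Induced B D M) :=
  Module.compHom (M ⊗[k] C) (inducedAction (C := C) B M).toRingHom

instance : IsScalarTower k A (Induced B D M) where
  smul_assoc c a x := by
    change inducedAction (C := C) B M (c • a) x = c • inducedAction (C := C) B M a x
    rw [map_smul]; rfl

/-- The element `q̃ = S(x¹) α x² ⊗ x³` of `H ⊗ A`, where `x = Φ_λ⁻¹`. -/
def qElt : H ⊗[k] A :=
  tri (fun x₁ x₂ x₃ => (Q.S x₁ * Q.α * x₂) ⊗ₜ[k] x₃)
    (fun _ _ => by constructor <;> intros <;> simp [add_mul, add_tmul, smul_tmul'])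
    (fun _ _ => by constructor <;> intros <;> simp [mul_add, add_tmul, smul_tmul'])
    (fun _ _ => by constructor <;> intros <;> simp [tmul_add])
    (↑B.Φl⁻¹ : H ⊗[k] (H ⊗[k] A))

/-- The element `z¹ ⊗ z² ⊗ z³` of `H ⊗ H ⊗ A` given by
`q̃¹ X¹ g¹ ⊗ (q̃²)_{[-1]} X² g² ⊗ (q̃²)_{[0]} X³`, where `X = Φ_λ` and `g = f⁻¹`. -/
def zElt : H ⊗[k] (H ⊗[k] A) :=
  idT H B.lam (qElt B) * B.Φl * idT H (tOne A) Q.twistInv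

/-- The element of `H ⊗ H ⊗ A ⊗ H ⊗ H` given by
`z¹ ⊗ θ¹ z² ⊗ (θ²)_{⟨0⟩} y¹ (z³)_{⟨0⟩} ⊗ (θ²)_{⟨1⟩} y² (z³)_{⟨1⟩₁} ⊗ θ³ y³ (z³)_{⟨1⟩₂}`,
where `θ = Φ_{λ,ρ}⁻¹`, `y = Φ_ρ⁻¹` and `z = zElt`. -/
def wElt : H ⊗[k] (H ⊗[k] (A ⊗[k] (H ⊗[k] H))) :=
  (1 ⊗ₜ idT H (tId B.rho H) (↑B.Φlr⁻¹ : H ⊗[k] (A ⊗[k] H))) *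
    (1 ⊗ₜ (1 ⊗ₜ (↑B.Φr⁻¹ : A ⊗[k] (H ⊗[k] H)))) *
    idT H (idT H ((idT A Q.Δ).comp B.rho)) (zElt B)

/-- The operator `m ⊗ c ⊗ d ↦ w³ · m ⊗ w⁴ · c · S⁻¹(w²) ⊗ w⁵ · d · S⁻¹(w¹)` of
`w¹ ⊗ w² ⊗ w³ ⊗ w⁴ ⊗ w⁵`. -/
def coactOp (Q : QuasiHopfAlgebra k H) (C M : Type u)
    [AddCommGroup C] [Module k C] [Module H C] [IsScalarTower k H C] [Module Hᵐᵒᵖ C]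
    [IsScalarTower k Hᵐᵒᵖ C]
    [AddCommGroup M] [Module k M] [Module A M] [IsScalarTower k A M] :
    H ⊗[k] (H ⊗[k] (A ⊗[k] (H ⊗[k] H))) →ₗ[k] Module.End k (M ⊗[k] (C ⊗[k] C)) :=
  tri (fun w₁ w₂ t => opT (lop M) (opT (lop C) (lop C)) t ∘ₗ
      (TensorProduct.map (rop C (Q.Sinv w₂)) (rop C (Q.Sinv w₁))).lTensor M)
    (fun _ _ => by
      constructor <;> intros <;> simp [LinearMap.comp_add, LinearMap.comp_smul,
        LinearMap.lTensor_add, LinearMap.lTensor_smul,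
        TensorProduct.map_add_right, TensorProduct.map_smul_right])
    (fun _ _ => by
      constructor <;> intros <;> simp [LinearMap.comp_add, LinearMap.comp_smul,
        LinearMap.lTensor_add, LinearMap.lTensor_smul,
        TensorProduct.map_add_left, TensorProduct.map_smul_left])
    (fun _ _ => by
      constructor <;> intros <;> simp [LinearMap.add_comp, LinearMap.smul_comp])

/-- The coaction on `M ⊗ C`:
`m ⊗ c ↦ w³ · m ⊗ w⁴ · c₁ · S⁻¹(w²) ⊗ w⁵ · c₂ · S⁻¹(w¹)` with `w = wElt`, that is,
```
m ⊗ c ↦ (θ²)_{⟨0⟩} y¹ ((q̃²)_{[0]} X³)_{⟨0⟩} · m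
  ⊗ (θ²)_{⟨1⟩} y² ((q̃²)_{[0]} X³)_{⟨1⟩₁} · c₁ · S⁻¹(θ¹ (q̃²)_{[-1]} X² g²)
  ⊗ θ³ y³ ((q̃²)_{[0]} X³)_{⟨1⟩₂} · c₂ · S⁻¹(q̃¹ X¹ g¹).
``` -/
def inducedCoaction : Induced B D M →ₗ[k] Induced B D M ⊗[k] C :=
  show M ⊗[k] C →ₗ[k] (M ⊗[k] C) ⊗[k] C from
  (TensorProduct.assoc k M C C).symm.toLinearMap ∘ₗ coactOp Q C M (wElt B) ∘ₗ D.Δ.lTensor M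

section Maps

variable {M} {N : Type u} [AddCommGroup N] [Module k N] [Module A N] [IsScalarTower k A N]

lemma twistedOp_natural (υ : M →ₗ[A] N) (t : H ⊗[k] (A ⊗[k] H)) (x : M ⊗[k] C) :
    (υ.restrictScalars k).rTensor C (twistedOp Q C M t x)
      = twistedOp Q C N t ((υ.restrictScalars k).rTensor C x) := by
  induction x using TensorProduct.induction_on with
  | zero => simp
  | add x y hx hy => simp only [map_add, hx, hy]
  | tmul m c =>
  induction t using TensorProduct.induction_on with
  | zero => simp
  | add s s' hs hs' => simp only [map_add, LinearMap.add_apply, hs, hs']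
  | tmul h t =>
  induction t using TensorProduct.induction_on with
  | zero => simp
  | add s s' hs hs' => simp only [tmul_add, map_add, LinearMap.add_apply, hs, hs']
  | tmul a h' => simp [twistedOp]

lemma opT_natural {P X : Type*} [AddCommGroup P] [Module k P] [AddCommGroup X] [Module k X]
    (b : P →ₗ[k] Module.End k X) (υ : M →ₗ[A] N) (t : A ⊗[k] P) (x : M ⊗[k] X) :
    (υ.restrictScalars k).rTensor X (opT (lop M) b t x)
      = opT (lop N) b t ((υ.restrictScalars k).rTensor X x) := by
  induction x using TensorProduct.induction_on with
  | zero => simp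
  | add x y hx hy => simp only [map_add, hx, hy]
  | tmul m c =>
  induction t using TensorProduct.induction_on with
  | zero => simp
  | add s s' hs hs' => simp only [map_add, LinearMap.add_apply, hs, hs']
  | tmul a p => simp

/-- `υ ⊗ id_C`, for an `A`-linear map `υ`. -/
def inducedMap (υ : M →ₗ[A] N) : Induced B D M →ₗ[A] Induced B D N where
  toFun := (υ.restrictScalars k).rTensor C
  map_add' := map_add ((υ.restrictScalars k).rTensor C)
  map_smul' u x := twistedOp_natural υ (idT H B.rho (B.lam u)) x

lemma coactOp_natural (υ : M →ₗ[A] N) (w : H ⊗[k] (H ⊗[k] (A ⊗[k] (H ⊗[k] H))))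
    (x : M ⊗[k] (C ⊗[k] C)) :
    (υ.restrictScalars k).rTensor (C ⊗[k] C) (coactOp Q C M w x)
      = coactOp Q C N w ((υ.restrictScalars k).rTensor (C ⊗[k] C) x) := by
  induction w using TensorProduct.induction_on with
  | zero => simp
  | add s s' hs hs' => simp only [map_add, LinearMap.add_apply, hs, hs']
  | tmul h t =>
  induction t using TensorProduct.induction_on with
  | zero => simp
  | add s s' hs hs' => simp only [tmul_add, map_add, LinearMap.add_apply, hs, hs']
  | tmul a t =>
  rw [coactOp, tri_tmul, coactOp, tri_tmul]
  obtain ⟨e, he⟩ : ∃ e : Module.End k (C ⊗[k] C),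
    e = TensorProduct.map (rop C (Q.Sinv a)) (rop C (Q.Sinv h)) := ⟨_, rfl⟩
  rw [← he, LinearMap.comp_apply, LinearMap.comp_apply]
  have h₁ : e.lTensor N ((υ.restrictScalars k).rTensor (C ⊗[k] C) x)
      = (υ.restrictScalars k).rTensor (C ⊗[k] C) (e.lTensor M x) := by
    change (e.lTensor N ∘ₗ (υ.restrictScalars k).rTensor (C ⊗[k] C)) x
      = ((υ.restrictScalars k).rTensor (C ⊗[k] C) ∘ₗ e.lTensor M) x
    rw [LinearMap.lTensor_comp_rTensor, LinearMap.rTensor_comp_lTensor]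
  exact (opT_natural _ υ t _).trans (congrArg _ h₁.symm)

lemma inducedMap_colinear (υ : M →ₗ[A] N) (x : Induced B D M) :
    ((inducedMap B D υ).restrictScalars k).rTensor C (inducedCoaction B D M x)
      = inducedCoaction B D N (inducedMap B D υ x) := by
  change ((υ.restrictScalars k).rTensor C).rTensor C ((TensorProduct.assoc k M C C).symm
      (coactOp Q C M (wElt B) (D.Δ.lTensor M x)))
    = (TensorProduct.assoc k N C C).symm
      (coactOp Q C N (wElt B) (D.Δ.lTensor N ((υ.restrictScalars k).rTensor C x)))
  have h₁ : D.Δ.lTensor N ((υ.restrictScalars k).rTensor C x)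
      = (υ.restrictScalars k).rTensor (C ⊗[k] C) (D.Δ.lTensor M x) := by
    change (D.Δ.lTensor N ∘ₗ (υ.restrictScalars k).rTensor C) x
      = ((υ.restrictScalars k).rTensor (C ⊗[k] C) ∘ₗ D.Δ.lTensor M) x
    rw [LinearMap.lTensor_comp_rTensor, LinearMap.rTensor_comp_lTensor]
  rw [h₁, ← coactOp_natural]
  generalize coactOp Q C M (wElt B) (D.Δ.lTensor M x) = z
  change ((υ.restrictScalars k).rTensor C).rTensor C _ = _
  induction z using TensorProduct.induction_on with
  | zero => simp
  | add x y hx hy => simp only [map_add, hx, hy]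
  | tmul m t =>
  induction t using TensorProduct.induction_on with
  | zero => simp
  | add x y hx hy => simp only [tmul_add, map_add, hx, hy]
  | tmul c d => simp

end Maps

/-! ### The functors `• ⊗ C` and `Hom(A ⊗ C, •)`

Both functors take as input a proof that the modules `M ⊗ C` satisfy the Yetter-Drinfeld
axioms. A left `A`-module carries the vector space structure that
comes from `k → A`. -/

/-- The functor `• ⊗ C` from left `A`-modules to Yetter-Drinfeld modules. -/
def inductionFunctor
    (h : ∀ M : ModuleCat.{u} A, IsYetterDrinfeld B D (inducedCoaction B D M)) :
    ModuleCat.{u} A ⥤ YDModule B D where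
  obj M :=
    { carrier := Induced B D M
      coact := inducedCoaction B D M
      isYD := h M }
  map υ := ⟨inducedMap B D υ.hom, inducedMap_colinear B D υ.hom⟩
  map_id _ := Subtype.ext <| LinearMap.ext fun x =>
    LinearMap.congr_fun (LinearMap.rTensor_id C _) x
  map_comp f g := Subtype.ext <| LinearMap.ext fun x =>
    LinearMap.congr_fun (LinearMap.rTensor_comp C (g.hom.restrictScalars k)
      (f.hom.restrictScalars k)) x

variable {B D}

/-- The additive group of Yetter-Drinfeld morphisms `A ⊗ C → N`. -/
abbrev HomAC (h : ∀ M : ModuleCat.{u} A, IsYetterDrinfeld B D (inducedCoaction B D M))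
    (N : YDModule B D) : Type u :=
  YDModule.homs ((inductionFunctor B D h).obj (ModuleCat.of A A)) N

/-- The element `m ⊗ c` of `M ⊗ C`. -/
def pureTensor (h : ∀ M : ModuleCat.{u} A, IsYetterDrinfeld B D (inducedCoaction B D M))
    (M : ModuleCat.{u} A) (m : M) (c : C) : (inductionFunctor B D h).obj M :=
  show M ⊗[k] C from m ⊗ₜ[k] c

lemma pureTensor_add (h : ∀ M : ModuleCat.{u} A, IsYetterDrinfeld B D (inducedCoaction B D M))
    (M : ModuleCat.{u} A) (m m' : M) (c : C) :
    pureTensor h M (m + m') c = pureTensor h M m c + pureTensor h M m' c :=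
  TensorProduct.add_tmul m m' c

lemma pureTensor_zero (h : ∀ M : ModuleCat.{u} A, IsYetterDrinfeld B D (inducedCoaction B D M))
    (M : ModuleCat.{u} A) (c : C) : pureTensor h M 0 c = 0 :=
  TensorProduct.zero_tmul M c

lemma hom_ext_pureTensor
    {h : ∀ M : ModuleCat.{u} A, IsYetterDrinfeld B D (inducedCoaction B D M)}
    {M : ModuleCat.{u} A} {N : YDModule B D}
    {η η' : YDModule.homs ((inductionFunctor B D h).obj M) N}
    (e : ∀ m c, η.1 (pureTensor h M m c) = η'.1 (pureTensor h M m c)) : η = η' := by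
  refine Subtype.ext (LinearMap.ext fun x => ?_)
  induction (show M ⊗[k] C from x) using TensorProduct.induction_on with
  | zero => exact (map_zero η.1).trans (map_zero η'.1).symm
  | add x y hx hy =>
    exact (map_add η.1 x y).trans ((congrArg₂ (· + ·) hx hy).trans (map_add η'.1 x y).symm)
  | tmul m c => exact e m c

/-- Right multiplication `u' ↦ u' u` on `A`. -/
abbrev rightMul (u : A) : ModuleCat.of A A ⟶ ModuleCat.of A A :=
  ModuleCat.ofHom (LinearMap.toSpanSingleton A A u)

/-- The action of `A` on the Yetter-Drinfeld morphisms `A ⊗ C → N`, given by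
`(u · η)(u' ⊗ c) = η(u' u ⊗ c)`. -/
instance (h : ∀ M : ModuleCat.{u} A, IsYetterDrinfeld B D (inducedCoaction B D M))
    (N : YDModule B D) : SMul A (HomAC h N) where
  smul u η := (inductionFunctor B D h).map (rightMul u) ≫ η

lemma HomAC.smul_apply
    {h : ∀ M : ModuleCat.{u} A, IsYetterDrinfeld B D (inducedCoaction B D M)}
    {N : YDModule B D} (u : A) (η : HomAC h N) (u' : A) (c : C) :
    (u • η).1 (pureTensor h (ModuleCat.of A A) u' c)
      = η.1 (pureTensor h (ModuleCat.of A A) (u' * u : A) c) := rfl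

instance (h : ∀ M : ModuleCat.{u} A, IsYetterDrinfeld B D (inducedCoaction B D M))
    (N : YDModule B D) : Module A (HomAC h N) where
  one_smul η := hom_ext_pureTensor fun u' c => by
    rw [HomAC.smul_apply, mul_one]
  mul_smul u v η := hom_ext_pureTensor fun u' c => by
    rw [HomAC.smul_apply, HomAC.smul_apply, HomAC.smul_apply, mul_assoc]
  smul_zero _ := rfl
  smul_add _ _ _ := rfl
  add_smul u v η := hom_ext_pureTensor fun u' c => by
    change _ = (u • η).1 _ + (v • η).1 _
    rw [HomAC.smul_apply, HomAC.smul_apply, HomAC.smul_apply, mul_add, ← map_add]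
    exact congrArg η.1 (pureTensor_add h (ModuleCat.of A A) _ _ c)
  zero_smul η := hom_ext_pureTensor fun u' c => by
    rw [HomAC.smul_apply, mul_zero]
    exact (congrArg η.1 (pureTensor_zero h (ModuleCat.of A A) c)).trans (map_zero η.1)

variable (B D) in
/-- The functor `N ↦ Hom(A ⊗ C, N)` from Yetter-Drinfeld modules to left `A`-modules, sending
`κ` to `η ↦ κ ∘ η`. -/
def homFunctor (h : ∀ M : ModuleCat.{u} A, IsYetterDrinfeld B D (inducedCoaction B D M)) :
    YDModule B D ⥤ ModuleCat.{u} A where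
  obj N := ModuleCat.of A (HomAC h N)
  map {N P} κ := ModuleCat.ofHom
    { toFun := fun η : HomAC h N =>
        (((show (inductionFunctor B D h).obj (ModuleCat.of A A) ⟶ N from η) ≫ κ :) : HomAC h P)
      map_add' := fun η η' => hom_ext_pureTensor fun u c => map_add κ.1 _ _
      map_smul' := fun _ _ => rfl }

end Induction

end QuasiYD

end

noncomputable section

namespace QuasiYD

/-! ### Algebra maps with commuting ranges

Words in `Φ`, `Φ_λ`, `Φ_ρ` and `Φ_{λ,ρ}` are evaluated in an arbitrary algebra `R` along algebra maps
with pairwise commuting ranges. -/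

section Calculus

variable {k : Type*} [CommRing k]
  {P Q S T R X : Type*} [Ring P] [Algebra k P] [Ring Q] [Algebra k Q] [Ring S] [Algebra k S]
  [Ring T] [Algebra k T] [Ring R] [Algebra k R] [AddCommGroup X] [Module k X]

/-! Let P carry a left A-action and a commuting right H-action. Call a linear map r from an A-module
N to P compatible if u·r(n) = r(u_[0]·n)·u_[-1]; for a coaction this is the third Yetter-Drinfeld
axiom. The element q̃ has a partner p̃ = X²S⁻¹(X¹β) ⊗ X³ with X = Φ_λ, and the two are mutually
inverse in a twisted sense (`coadj_pElt_qElt`, `adj_qElt_pElt`). Hence `hat`, r ↦ (n ↦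
r(p̃²·n)·p̃¹), is a bijection from compatible maps N → P onto A-linear maps N → P', where P' is P
with the action u·p = u_[0]·p·S⁻¹(u_[-1]). Its inverse is composition with the compatible operator e
= `qOp`, p ↦ q̃²·p·S⁻¹(q̃¹). For P = M ⊗ C, P' is the induced module. An A-linear f : N → M on a
Yetter-Drinfeld module N gives the compatible map (f ⊗ id)ρ_N, whose hat is the transpose N → M ⊗ C
of the first adjunction.

Coassociativity of the coaction t on P' is not verified by direct expansion. Write the two sides of
that axiom as `extend t ∘ t` and `double t`. What is computed is the mixed law `extend e ∘ t =
double e` (`extend_comp_freeCoact`). The rest is cancellation: a compatible map with injective hat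
may be cancelled from the left between maps that transform alike under A (`eq_of_comp_eq`); the hat
of e is the identity; and the hat of `extend r` is hat(r) ⊗ id followed by an invertible operator
(`Compat.hat_extend`). After applying `extend (extend e)`, coassociativity of t reduces to the
pentagon identities and the coassociativity of C (`double_double_eq`, `Compat.extend_comp_self`).
The counit axiom is compared after e, and colinearity of transposes after `extend e`.

The mixed law is in turn an identity in H ⊗ H ⊗ A, `tmul_qElt_mul_zElt`. Comultiplying c·S⁻¹(h)
produces (S ⊗ S)Δᶜᵒᵖ(S⁻¹h) where one would like Δ(h), and the Drinfeld twist compares the two. Two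
facts are needed: Δ(S h)f⁻¹ = f⁻¹(S ⊗ S)(Δᶜᵒᵖ h), and γf⁻¹ = (S ⊗ S)(Δᶜᵒᵖ(S⁻¹α)). The second rests
on ff⁻¹ = 1, whose core is `nested_zigzag`: the nested evaluation γ and coevaluation δ of a tensor
square satisfy the same zigzag identity as α and β.

Every computation follows one pattern. The reassociators are evaluated along commuting algebra maps,
the "legs"; a pentagon is solved for one factor; then a contraction such as x ⊗ y ↦ S(x)αy, which
cannot tell Δ(h) on its two legs from ε(h), makes other factors trivial (`LeftEq`, `RightEq`).

The second adjunction is formal: every m ⊗ c is the image of 1 ⊗ c under the morphism induced by A →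
M, u ↦ u·m, so a morphism out of M ⊗ C is the same as an A-linear family of morphisms out of A ⊗ C.
-/

instance : LeftDistribClass (P ⊗[k] Q) := Distrib.leftDistribClass _

instance : RightDistribClass (P ⊗[k] Q) := Distrib.rightDistribClass _

/-- The ranges of `u` and `v` commute elementwise. -/
class Comm (u : P →ₐ[k] R) (v : Q →ₐ[k] R) : Prop where
  comm : ∀ x y, Commute (u x) (v y)

lemma comm_eq (u : P →ₐ[k] R) (v : Q →ₐ[k] R) [Comm u v] (x : P) (y : Q) :
    v y * u x = u x * v y := (Comm.comm x y).eq.symm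

/-- The algebra map `x ⊗ y ↦ u x * v y`. -/
def lift2 (u : P →ₐ[k] R) (v : Q →ₐ[k] R) [Comm u v] : P ⊗[k] Q →ₐ[k] R :=
  Algebra.TensorProduct.lift u v Comm.comm

@[simp] lemma lift2_tmul (u : P →ₐ[k] R) (v : Q →ₐ[k] R) [Comm u v] (x : P) (y : Q) :
    lift2 u v (x ⊗ₜ y) = u x * v y := by
  simp [lift2]

lemma commute_lift2 {r : R} (u : P →ₐ[k] R) (v : Q →ₐ[k] R) [Comm u v]
    (hu : ∀ x, Commute r (u x)) (hv : ∀ y, Commute r (v y)) (t : P ⊗[k] Q) :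
    Commute r (lift2 u v t) := by
  induction t using TensorProduct.induction_on with
  | zero => simp
  | add s t hs ht => simpa using hs.add_right ht
  | tmul x y => simpa using (hu x).mul_right (hv y)

instance (u : P →ₐ[k] R) (v : Q →ₐ[k] R) (w : S →ₐ[k] R) [Comm u v] [Comm u w] [Comm v w] :
    Comm u (lift2 v w) :=
  ⟨fun x t => commute_lift2 v w (Comm.comm x) (Comm.comm x) t⟩

instance (u : P →ₐ[k] R) (v : Q →ₐ[k] R) (w : S →ₐ[k] R) [Comm u v] [Comm u w] [Comm v w] :
    Comm (lift2 u v) w :=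
  ⟨fun t x => (commute_lift2 u v (fun y => (Comm.comm y x).symm)
    (fun y => (Comm.comm y x).symm) t).symm⟩

/-- The algebra map `x ⊗ (y ⊗ z) ↦ u x * (v y * w z)`. -/
abbrev lift3 (u : P →ₐ[k] R) (v : Q →ₐ[k] R) (w : S →ₐ[k] R) [Comm u v] [Comm u w] [Comm v w] :
    P ⊗[k] (Q ⊗[k] S) →ₐ[k] R :=
  lift2 u (lift2 v w)

/-- The convolution of `u` and `v` along a comultiplication or coaction `δ`. -/
def conv (δ : T →ₐ[k] P ⊗[k] Q) (u : P →ₐ[k] R) (v : Q →ₐ[k] R) [Comm u v] : T →ₐ[k] R :=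
  (lift2 u v).comp δ

lemma conv_apply (δ : T →ₐ[k] P ⊗[k] Q) (u : P →ₐ[k] R) (v : Q →ₐ[k] R) [Comm u v] (x : T) :
    conv δ u v x = lift2 u v (δ x) := rfl

instance (δ : T →ₐ[k] P ⊗[k] Q) (u : P →ₐ[k] R) (v : Q →ₐ[k] R) (w : S →ₐ[k] R)
    [Comm u v] [Comm u w] [Comm v w] : Comm (conv δ u v) w :=
  ⟨fun x y => Comm.comm (u := lift2 u v) (δ x) y⟩

instance (δ : T →ₐ[k] P ⊗[k] Q) (u : P →ₐ[k] R) (v : Q →ₐ[k] R) (w : S →ₐ[k] R)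
    [Comm w u] [Comm w v] [Comm u v] : Comm w (conv δ u v) :=
  ⟨fun x y => Comm.comm (v := lift2 u v) x (δ y)⟩

/-- This rule and `lift2_tId` turn the tensor axioms into relations between words: applying a
coaction to a tensor factor amounts to replacing its leg by a convolution. -/
lemma lift2_idT_conv (u : P →ₐ[k] R) (v : Q →ₐ[k] R) (w : S →ₐ[k] R) (δ : T →ₐ[k] Q ⊗[k] S)
    [Comm u v] [Comm u w] [Comm v w] (t : P ⊗[k] T) :
    lift2 u (lift2 v w) (idT P δ t) = lift2 u (conv δ v w) t := by
  induction t using TensorProduct.induction_on with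
  | zero => simp
  | add s t hs ht => simp only [map_add, hs, ht]
  | tmul x y => simp [conv]

lemma lift2_assoc (u : P →ₐ[k] R) (v : Q →ₐ[k] R) (w : S →ₐ[k] R) [Comm u v] [Comm u w] [Comm v w]
    (t : P ⊗[k] Q) (z : S) :
    lift2 u (lift2 v w) (Algebra.TensorProduct.assoc k k k P Q S (t ⊗ₜ z)) = lift2 u v t * w z := by
  induction t using TensorProduct.induction_on with
  | zero => simp
  | add s t hs ht => simp only [map_add, add_tmul, hs, ht, add_mul]
  | tmul x y => simp [mul_assoc]

lemma lift2_tId (u : P →ₐ[k] R) (v : Q →ₐ[k] R) (w : S →ₐ[k] R) (δ : T →ₐ[k] P ⊗[k] Q)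
    [Comm u v] [Comm u w] [Comm v w] (t : T ⊗[k] S) :
    lift2 u (lift2 v w) (tId δ S t) = lift2 (conv δ u v) w t := by
  induction t using TensorProduct.induction_on with
  | zero => simp
  | add s t hs ht => simp only [map_add, hs, ht]
  | tmul x y =>
    rw [lift2_tmul, conv_apply, ← lift2_assoc]
    simp

section Four

variable {Y Z W : Type*} [Ring Y] [Algebra k Y] [Ring Z] [Algebra k Z] [Ring W] [Algebra k W]
  (u : P →ₐ[k] R) (v : Q →ₐ[k] R) (w : S →ₐ[k] R) (x : Y →ₐ[k] R)
  [Comm u v] [Comm u w] [Comm u x] [Comm v w] [Comm v x] [Comm w x]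

lemma lift4_tOne (t : P ⊗[k] (Q ⊗[k] S)) :
    lift2 u (lift3 v w x) (idT P (idT Q (tOne Y)) t) = lift3 u v w t := by
  induction t using TensorProduct.induction_on with
  | zero => simp
  | add s t hs ht => simp only [map_add, hs, ht]
  | tmul a t =>
  induction t using TensorProduct.induction_on with
  | zero => simp
  | add s t hs ht => simp only [map_add, tmul_add, hs, ht]
  | tmul b c => simp

lemma lift4_idT_tId (δ : T →ₐ[k] Q ⊗[k] S) (t : P ⊗[k] (T ⊗[k] Y)) :
    lift2 u (lift3 v w x) (idT P (tId δ Y) t) = lift3 u (conv δ v w) x t := by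
  induction t using TensorProduct.induction_on with
  | zero => simp
  | add s t hs ht => simp only [map_add, hs, ht]
  | tmul a t =>
    have := lift2_tId v w x δ t
    simp only [Algebra.TensorProduct.map_tmul, lift2_tmul, this, AlgHom.id_apply]

lemma lift4_idT_idT (δ : T →ₐ[k] S ⊗[k] Y) (t : P ⊗[k] (Q ⊗[k] T)) :
    lift2 u (lift3 v w x) (idT P (idT Q δ) t) = lift3 u v (conv δ w x) t := by
  induction t using TensorProduct.induction_on with
  | zero => simp
  | add s t hs ht => simp only [map_add, hs, ht]
  | tmul a t =>
    have := lift2_idT_conv v w x δ t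
    simp only [Algebra.TensorProduct.map_tmul, lift2_tmul, this, AlgHom.id_apply]

lemma lift4_tId (δ : T →ₐ[k] P ⊗[k] Q) (t : T ⊗[k] (S ⊗[k] Y)) :
    lift2 u (lift3 v w x) (tId δ (S ⊗[k] Y) t) = lift3 (conv δ u v) w x t :=
  lift2_tId u v (lift2 w x) δ t

end Four

/-- An element that intertwines every letter slides past the whole word. It is used with r the value
of a reassociator, which rebrackets the convolved legs of the word it passes. -/
lemma lift3_intertwine {u u' : P →ₐ[k] R} {v v' : Q →ₐ[k] R}
    {w w' : S →ₐ[k] R} [Comm u v] [Comm u w] [Comm v w] [Comm u' v'] [Comm u' w'] [Comm v' w']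
    {r : R} (hu : ∀ x, r * u x = u' x * r) (hv : ∀ x, r * v x = v' x * r)
    (hw : ∀ x, r * w x = w' x * r) (t : P ⊗[k] (Q ⊗[k] S)) :
    r * lift3 u v w t = lift3 u' v' w' t * r := by
  induction t using TensorProduct.induction_on with
  | zero => simp
  | add s t hs ht => simp only [map_add, mul_add, add_mul, hs, ht]
  | tmul a t =>
  induction t using TensorProduct.induction_on with
  | zero => simp
  | add s t hs ht => simp only [map_add, tmul_add, mul_add, add_mul, hs, ht]
  | tmul b c =>
    simp only [lift2_tmul, ← mul_assoc, hu]
    rw [mul_assoc _ r, hv, mul_assoc, mul_assoc, hw]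
    simp only [mul_assoc]

lemma lift2_intertwine {u u' : P →ₐ[k] R} {v v' : Q →ₐ[k] R} [Comm u v] [Comm u' v']
    {r : R} (hu : ∀ x, r * u x = u' x * r) (hv : ∀ x, r * v x = v' x * r) (t : P ⊗[k] Q) :
    r * lift2 u v t = lift2 u' v' t * r := by
  induction t using TensorProduct.induction_on with
  | zero => simp
  | add s t hs ht => simp only [map_add, mul_add, add_mul, hs, ht]
  | tmul a b =>
    simp only [lift2_tmul, ← mul_assoc, hu]
    rw [mul_assoc _ r, hv]
    simp only [mul_assoc]

lemma lift3_mul_inv (u : P →ₐ[k] R) (v : Q →ₐ[k] R) (w : S →ₐ[k] R) [Comm u v] [Comm u w] [Comm v w]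
    (t : (P ⊗[k] (Q ⊗[k] S))ˣ) :
    lift3 u v w (t : P ⊗[k] (Q ⊗[k] S)) * lift3 u v w (↑t⁻¹ : P ⊗[k] (Q ⊗[k] S)) = 1 := by
  rw [← map_mul, Units.mul_inv, map_one]

lemma lift3_inv_mul (u : P →ₐ[k] R) (v : Q →ₐ[k] R) (w : S →ₐ[k] R) [Comm u v] [Comm u w] [Comm v w]
    (t : (P ⊗[k] (Q ⊗[k] S))ˣ) :
    lift3 u v w (↑t⁻¹ : P ⊗[k] (Q ⊗[k] S)) * lift3 u v w (t : P ⊗[k] (Q ⊗[k] S)) = 1 := by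
  rw [← map_mul, Units.inv_mul, map_one]

section Collapse

variable (N : R →ₗ[k] X) (u u' : P →ₐ[k] R) (v v' : Q →ₐ[k] R) (w w' : S →ₐ[k] R)

/-- A linear map that does not distinguish left multiplication by `u` and by `u'`. -/
def LeftEq : Prop := ∀ x r, N (u x * r) = N (u' x * r)

/-- A linear map that does not distinguish right multiplication by `u` and by `u'`. -/
def RightEq : Prop := ∀ x r, N (r * u x) = N (r * u' x)

variable {N u u' v v' w w'}

/-- Because the legs commute, any one of them can be brought to the outer end of a word; so a
substitution allowed for outermost letters is allowed in each slot of an outermost word. The next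
lemmas are the other slots and the right-hand versions. -/
lemma LeftEq.fst [Comm u v] [Comm u w] [Comm v w] [Comm u' v] [Comm u' w] (h : LeftEq N u u')
    (t : P ⊗[k] (Q ⊗[k] S)) (r : R) : N (lift3 u v w t * r) = N (lift3 u' v w t * r) := by
  induction t using TensorProduct.induction_on with
  | zero => simp
  | add s t hs ht => simp only [map_add, add_mul, hs, ht]
  | tmul a t => simpa only [lift2_tmul, mul_assoc] using h _ _

lemma LeftEq.fst₂ [Comm u v] [Comm u' v] (h : LeftEq N u u')
    (t : P ⊗[k] Q) (r : R) : N (lift2 u v t * r) = N (lift2 u' v t * r) := by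
  induction t using TensorProduct.induction_on with
  | zero => simp
  | add s t hs ht => simp only [map_add, add_mul, hs, ht]
  | tmul a t => simpa only [lift2_tmul, mul_assoc] using h _ _

lemma LeftEq.snd₂ [Comm u v] [Comm u v'] (h : LeftEq N v v')
    (t : P ⊗[k] Q) (r : R) : N (lift2 u v t * r) = N (lift2 u v' t * r) := by
  induction t using TensorProduct.induction_on with
  | zero => simp
  | add s t hs ht => simp only [map_add, add_mul, hs, ht]
  | tmul a b =>
    simpa only [lift2_tmul, ← comm_eq u v, ← comm_eq u v', mul_assoc] using h _ _

lemma LeftEq.snd [Comm u v] [Comm u w] [Comm v w] [Comm u v'] [Comm v' w] (h : LeftEq N v v')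
    (t : P ⊗[k] (Q ⊗[k] S)) (r : R) : N (lift3 u v w t * r) = N (lift3 u v' w t * r) := by
  induction t using TensorProduct.induction_on with
  | zero => simp
  | add s t hs ht => simp only [map_add, add_mul, hs, ht]
  | tmul a t =>
  induction t using TensorProduct.induction_on with
  | zero => simp
  | add s t hs ht => simp only [map_add, tmul_add, add_mul, hs, ht]
  | tmul b c =>
    have e := h b (u a * w c * r)
    simp only [← mul_assoc, comm_eq u v, comm_eq u v'] at e
    simpa only [lift2_tmul, ← mul_assoc] using e

lemma LeftEq.trd [Comm u v] [Comm u w] [Comm v w] [Comm u w'] [Comm v w'] (h : LeftEq N w w')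
    (t : P ⊗[k] (Q ⊗[k] S)) (r : R) : N (lift3 u v w t * r) = N (lift3 u v w' t * r) := by
  induction t using TensorProduct.induction_on with
  | zero => simp
  | add s t hs ht => simp only [map_add, add_mul, hs, ht]
  | tmul a t =>
  induction t using TensorProduct.induction_on with
  | zero => simp
  | add s t hs ht => simp only [map_add, tmul_add, add_mul, hs, ht]
  | tmul b c =>
    have e := h c (u a * v b * r)
    have e₁ : w c * (u a * v b) = u a * (v b * w c) := by
      rw [← mul_assoc, comm_eq u w, mul_assoc, comm_eq v w]
    have e₂ : w' c * (u a * v b) = u a * (v b * w' c) := by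
      rw [← mul_assoc, comm_eq u w', mul_assoc, comm_eq v w']
    simpa only [lift2_tmul, ← e₁, ← e₂, mul_assoc] using e

lemma RightEq.trd [Comm u v] [Comm u w] [Comm v w] [Comm u w'] [Comm v w'] (h : RightEq N w w')
    (t : P ⊗[k] (Q ⊗[k] S)) (r : R) : N (r * lift3 u v w t) = N (r * lift3 u v w' t) := by
  induction t using TensorProduct.induction_on with
  | zero => simp
  | add s t hs ht => simp only [map_add, mul_add, hs, ht]
  | tmul a t =>
  induction t using TensorProduct.induction_on with
  | zero => simp
  | add s t hs ht => simp only [map_add, tmul_add, mul_add, hs, ht]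
  | tmul b c => simpa only [lift2_tmul, ← mul_assoc] using h _ _

lemma RightEq.snd [Comm u v] [Comm u w] [Comm v w] [Comm u v'] [Comm v' w] (h : RightEq N v v')
    (t : P ⊗[k] (Q ⊗[k] S)) (r : R) : N (r * lift3 u v w t) = N (r * lift3 u v' w t) := by
  induction t using TensorProduct.induction_on with
  | zero => simp
  | add s t hs ht => simp only [map_add, mul_add, hs, ht]
  | tmul a t =>
  induction t using TensorProduct.induction_on with
  | zero => simp
  | add s t hs ht => simp only [map_add, tmul_add, mul_add, hs, ht]
  | tmul b c =>
    simpa only [lift2_tmul, ← comm_eq v w, ← comm_eq v' w, ← mul_assoc] using h b (r * u a * w c)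

lemma RightEq.fst [Comm u v] [Comm u w] [Comm v w] [Comm u' v] [Comm u' w] (h : RightEq N u u')
    (t : P ⊗[k] (Q ⊗[k] S)) (r : R) : N (r * lift3 u v w t) = N (r * lift3 u' v w t) := by
  induction t using TensorProduct.induction_on with
  | zero => simp
  | add s t hs ht => simp only [map_add, mul_add, hs, ht]
  | tmul a t =>
    have e := h a (r * lift2 v w t)
    simpa only [lift2_tmul, ← comm_eq u (lift2 v w), ← comm_eq u' (lift2 v w), ← mul_assoc] using e

lemma RightEq.fst₂ [Comm u v] [Comm u' v] (h : RightEq N u u')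
    (t : P ⊗[k] Q) (r : R) : N (r * lift2 u v t) = N (r * lift2 u' v t) := by
  induction t using TensorProduct.induction_on with
  | zero => simp
  | add s t hs ht => simp only [map_add, mul_add, hs, ht]
  | tmul a b =>
    simpa only [lift2_tmul, ← comm_eq u v, ← comm_eq u' v, ← mul_assoc] using h a (r * v b)

lemma RightEq.snd₂ [Comm u v] [Comm u v'] (h : RightEq N v v')
    (t : P ⊗[k] Q) (r : R) : N (r * lift2 u v t) = N (r * lift2 u v' t) := by
  induction t using TensorProduct.induction_on with
  | zero => simp
  | add s t hs ht => simp only [map_add, mul_add, hs, ht]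
  | tmul a b => simpa only [lift2_tmul, ← mul_assoc] using h _ _

end Collapse

end Calculus

/-! ### The axioms as relations between words -/

section Axioms

variable {k H : Type*} [Field k] [Ring H] [Algebra k H]
  {A R : Type*} [Ring A] [Algebra k A] [Ring R] [Algebra k R]

/-- The image of an invertible element under `lift3 u v w`. -/
def lift3U {P Q S : Type*} [Ring P] [Algebra k P] [Ring Q] [Algebra k Q] [Ring S] [Algebra k S]
    (u : P →ₐ[k] R) (v : Q →ₐ[k] R) (w : S →ₐ[k] R) [Comm u v] [Comm u w] [Comm v w]
    (t : (P ⊗[k] (Q ⊗[k] S))ˣ) : Rˣ :=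
  Units.map (lift3 u v w : P ⊗[k] (Q ⊗[k] S) →* R) t

section Pentagon

variable {G : Type*} [Group G] {a b c d e : G}

lemma pentagon_inv_left (h : a * b * c = d * e) : d⁻¹ * a = e * c⁻¹ * b⁻¹ := by
  rw [inv_mul_eq_iff_eq_mul, ← mul_assoc, ← mul_assoc, ← h]; group

lemma pentagon_inv_right (h : a * b * c = d * e) : a⁻¹ * d = b * c * e⁻¹ := by
  rw [inv_mul_eq_iff_eq_mul, ← mul_assoc, ← mul_assoc, h]; group

lemma pentagon_inv_inv (h : a * b * c = d * e) : b⁻¹ * a⁻¹ = c * e⁻¹ * d⁻¹ := by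
  rw [mul_assoc, ← mul_inv_rev, ← mul_inv_rev, ← h]; group

lemma pentagon_inv (h : a * b * c = d * e) : c⁻¹ * b⁻¹ * a⁻¹ = e⁻¹ * d⁻¹ := by
  rw [mul_assoc, ← mul_inv_rev, ← mul_inv_rev, ← mul_inv_rev, ← h, mul_assoc]

lemma pentagon_mul_inv (h : a * b * c = d * e) : c * e⁻¹ = b⁻¹ * a⁻¹ * d := by
  rw [mul_inv_eq_iff_eq_mul, mul_assoc, ← h]; group

lemma pentagon_solve (h : a * b * c = d * e) : c⁻¹ = e⁻¹ * d⁻¹ * a * b := by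
  rw [← mul_inv_rev, ← h]; group

end Pentagon

lemma lift3_inv_eq_one {P S T : Type*} [Ring P] [Algebra k P] [Ring S] [Algebra k S] [Ring T]
    [Algebra k T] (u : P →ₐ[k] R) (v : S →ₐ[k] R) (w : T →ₐ[k] R) [Comm u v] [Comm u w] [Comm v w]
    {t : (P ⊗[k] (S ⊗[k] T))ˣ} (h : lift3 u v w t.val = 1) : lift3 u v w t⁻¹.val = 1 := by
  rw [← mul_one (lift3 u v w t⁻¹.val), ← h, lift3_inv_mul, h]

namespace QuasiBialgebra

variable (Q : QuasiBialgebra k H)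

/-- The counit of `H` as a map to `R`. -/
def counit (R : Type*) [Ring R] [Algebra k R] : H →ₐ[k] R := (Algebra.ofId k R).comp Q.ε

lemma counit_mul (h : H) (r : R) : Q.counit R h * r = Q.ε h • r := by
  simp [counit, Algebra.ofId_apply, Algebra.smul_def]

lemma mul_counit (h : H) (r : R) : r * Q.counit R h = Q.ε h • r := by
  simp [counit, Algebra.ofId_apply, ← Algebra.commutes, Algebra.smul_def]

lemma commute_counit (r : R) (h : H) : Commute r (Q.counit R h) := by
  rw [Commute, SemiconjBy, Q.mul_counit, Q.counit_mul]

instance {P : Type*} [Ring P] [Algebra k P] (u : P →ₐ[k] R) : Comm (Q.counit R) u :=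
  ⟨fun x y => Algebra.commutes (Q.ε x) (u y)⟩

instance {P : Type*} [Ring P] [Algebra k P] (u : P →ₐ[k] R) : Comm u (Q.counit R) :=
  ⟨fun x y => (Algebra.commutes (Q.ε y) (u x)).symm⟩

lemma lift2_counit_left {P : Type*} [Ring P] [Algebra k P] (u : P →ₐ[k] R) (t : H ⊗[k] P) :
    lift2 (Q.counit R) u t = u (evalL Q.ε P t) := by
  induction t using TensorProduct.induction_on with
  | zero => simp
  | add s t hs ht => simp only [map_add, hs, ht]
  | tmul x y => simp [counit_mul]

lemma lift2_counit_right {P : Type*} [Ring P] [Algebra k P] (u : P →ₐ[k] R) (t : P ⊗[k] H) :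
    lift2 u (Q.counit R) t = u (evalR P Q.ε t) := by
  induction t using TensorProduct.induction_on with
  | zero => simp
  | add s t hs ht => simp only [map_add, hs, ht]
  | tmul x y => simp [mul_counit]

@[simp] lemma conv_counit_left (u : H →ₐ[k] R) : conv Q.Δ (Q.counit R) u = u :=
  AlgHom.ext fun h => by rw [conv_apply, lift2_counit_left, Q.counit_left]

@[simp] lemma conv_counit_right (u : H →ₐ[k] R) : conv Q.Δ u (Q.counit R) = u :=
  AlgHom.ext fun h => by rw [conv_apply, lift2_counit_right, Q.counit_right]

lemma lift3_counit_mid {P S : Type*} [Ring P] [Algebra k P] [Ring S] [Algebra k S]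
    (u : P →ₐ[k] R) (w : S →ₐ[k] R) [Comm u w] (t : P ⊗[k] (H ⊗[k] S)) :
    lift3 u (Q.counit R) w t = lift2 u w (idT P (evalL Q.ε S) t) := by
  induction t using TensorProduct.induction_on with
  | zero => simp
  | add s t hs ht => simp only [map_add, hs, ht]
  | tmul x y => rw [lift2_tmul, lift2_counit_left]; simp

lemma lift3_counit_right {P S : Type*} [Ring P] [Algebra k P] [Ring S] [Algebra k S]
    (u : P →ₐ[k] R) (w : S →ₐ[k] R) [Comm u w] (t : P ⊗[k] (S ⊗[k] H)) :
    lift3 u w (Q.counit R) t = lift2 u w (idT P (evalR S Q.ε) t) := by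
  induction t using TensorProduct.induction_on with
  | zero => simp
  | add s t hs ht => simp only [map_add, hs, ht]
  | tmul x y => rw [lift2_tmul, lift2_counit_right]; simp

section Words

variable (u v w x : H →ₐ[k] R) [Comm u v] [Comm u w] [Comm u x] [Comm v w] [Comm v x] [Comm w x]

lemma Φ_intertwine (h : H) :
    conv Q.Δ u (conv Q.Δ v w) h * lift3 u v w Q.Φ.val
      = lift3 u v w Q.Φ.val * conv Q.Δ (conv Q.Δ u v) w h := by
  have e := congrArg (lift3 u v w) (Q.quasi_coassoc h)
  rw [map_mul, map_mul, lift2_idT_conv, lift2_tId] at e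
  rw [conv_apply, e, mul_assoc, lift3_inv_mul, mul_one]
  rfl

lemma Φ_intertwine_inv (h : H) :
    conv Q.Δ (conv Q.Δ u v) w h * lift3 u v w Q.Φ⁻¹.val
      = lift3 u v w Q.Φ⁻¹.val * conv Q.Δ u (conv Q.Δ v w) h := by
  have e := congrArg (fun r => lift3 u v w Q.Φ⁻¹.val * r * lift3 u v w Q.Φ⁻¹.val)
    (Q.Φ_intertwine u v w h)
  simp only [mul_assoc, lift3_mul_inv, mul_one] at e
  rw [e, ← mul_assoc, lift3_inv_mul, one_mul]

/-- Stated in the group of units so that it can be solved for any factor by pure group theory. -/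
lemma Φ_pentagon :
    lift3U v w x Q.Φ * lift3U u (conv Q.Δ v w) x Q.Φ * lift3U u v w Q.Φ
      = lift3U u v (conv Q.Δ w x) Q.Φ * lift3U (conv Q.Δ u v) w x Q.Φ := by
  have e := congrArg (lift2 u (lift3 v w x)) Q.cocycle
  rw [map_mul, map_mul, map_mul, lift4_tOne, lift4_idT_tId, lift4_idT_idT, lift4_tId] at e
  refine Units.ext (Eq.trans ?_ e)
  rw [lift2_tmul, map_one, one_mul]
  rfl

lemma Φ_counit_mid : lift3 u (Q.counit R) w Q.Φ.val = 1 := by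
  rw [lift3_counit_mid, Q.cocycle_counit, map_one]

/-- Only the middle counit normalisation is an axiom. With the first two legs trivial, the pentagon
makes this value an idempotent of a group, hence 1. -/
lemma Φ_counit_left : lift3 (Q.counit R) u v Q.Φ.val = 1 := by
  have e := Q.Φ_pentagon (Q.counit R) (Q.counit R) u v
  simp only [conv_counit_left] at e
  have e₁ : ∀ y : H →ₐ[k] R, lift3U (Q.counit R) (Q.counit R) y Q.Φ = 1 := fun y =>
    Units.ext (Q.Φ_counit_mid _ _)
  rw [e₁, e₁, mul_one, one_mul, mul_eq_right] at e
  exact congrArg Units.val e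

lemma Φ_counit_right : lift3 u v (Q.counit R) Q.Φ.val = 1 := by
  have e := Q.Φ_pentagon u v (Q.counit R) (Q.counit R)
  simp only [conv_counit_right] at e
  have e₁ : ∀ y : H →ₐ[k] R, lift3U y (Q.counit R) (Q.counit R) Q.Φ = 1 := fun y =>
    Units.ext (Q.Φ_counit_mid _ _)
  rw [e₁, e₁, mul_one, one_mul, mul_eq_right] at e
  exact congrArg Units.val e

end Words

end QuasiBialgebra

namespace BicomoduleAlgebra

variable {Q : QuasiBialgebra k H} (B : BicomoduleAlgebra Q A)

@[simp] lemma conv_lam_counit (m : A →ₐ[k] R) : conv B.lam (Q.counit R) m = m :=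
  AlgHom.ext fun a => by rw [conv_apply, Q.lift2_counit_left, B.lam_counit]

@[simp] lemma conv_rho_counit (m : A →ₐ[k] R) : conv B.rho m (Q.counit R) = m :=
  AlgHom.ext fun a => by rw [conv_apply, Q.lift2_counit_right, B.rho_counit]

section Left

variable (u v w : H →ₐ[k] R) (m : A →ₐ[k] R)
  [Comm u v] [Comm u w] [Comm u m] [Comm v w] [Comm v m] [Comm w m]

lemma Φl_intertwine (a : A) :
    conv B.lam u (conv B.lam v m) a * lift3 u v m B.Φl.val
      = lift3 u v m B.Φl.val * conv B.lam (conv Q.Δ u v) m a := by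
  have e := congrArg (lift3 u v m) (B.lam_coassoc a)
  rwa [map_mul, map_mul, lift2_idT_conv, lift2_tId] at e

lemma Φl_intertwine_inv (a : A) :
    conv B.lam (conv Q.Δ u v) m a * lift3 u v m B.Φl⁻¹.val
      = lift3 u v m B.Φl⁻¹.val * conv B.lam u (conv B.lam v m) a := by
  have e := congrArg (fun r => lift3 u v m B.Φl⁻¹.val * r * lift3 u v m B.Φl⁻¹.val)
    (B.Φl_intertwine u v m a)
  simp only [mul_assoc, lift3_mul_inv, mul_one] at e
  rw [e, ← mul_assoc, lift3_inv_mul, one_mul]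

lemma Φl_pentagon :
    lift3U v w m B.Φl * lift3U u (conv Q.Δ v w) m B.Φl * lift3U u v w Q.Φ
      = lift3U u v (conv B.lam w m) B.Φl * lift3U (conv Q.Δ u v) w m B.Φl := by
  have e := congrArg (lift2 u (lift3 v w m)) B.lam_cocycle
  rw [map_mul, map_mul, map_mul, lift4_tOne, lift4_idT_tId, lift4_idT_idT, lift4_tId] at e
  refine Units.ext (Eq.trans ?_ e)
  rw [lift2_tmul, map_one, one_mul]
  rfl

lemma Φl_counit_mid' : lift3 u (Q.counit R) m B.Φl.val = 1 := by
  rw [Q.lift3_counit_mid, B.Φl_counit_mid, map_one]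

lemma Φl_counit_left' : lift3 (Q.counit R) u m B.Φl.val = 1 := by
  rw [Q.lift2_counit_left, B.Φl_counit_left, map_one]

end Left

section Right

variable (m : A →ₐ[k] R) (u v w : H →ₐ[k] R)
  [Comm u v] [Comm u w] [Comm m u] [Comm v w] [Comm m v] [Comm m w]

lemma Φr_intertwine (a : A) :
    conv B.rho m (conv Q.Δ u v) a * lift3 m u v B.Φr.val
      = lift3 m u v B.Φr.val * conv B.rho (conv B.rho m u) v a := by
  have e := congrArg (lift3 m u v) (B.rho_coassoc a)
  rw [map_mul, map_mul, lift2_idT_conv, lift2_tId] at e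
  exact e.symm

lemma Φr_intertwine_inv (a : A) :
    conv B.rho (conv B.rho m u) v a * lift3 m u v B.Φr⁻¹.val
      = lift3 m u v B.Φr⁻¹.val * conv B.rho m (conv Q.Δ u v) a := by
  have e := congrArg (fun r => lift3 m u v B.Φr⁻¹.val * r * lift3 m u v B.Φr⁻¹.val)
    (B.Φr_intertwine m u v a)
  simp only [mul_assoc, lift3_mul_inv, mul_one] at e
  rw [e, ← mul_assoc, lift3_inv_mul, one_mul]

lemma Φr_pentagon :
    lift3U u v w Q.Φ * lift3U m (conv Q.Δ u v) w B.Φr * lift3U m u v B.Φr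
      = lift3U m u (conv Q.Δ v w) B.Φr * lift3U (conv B.rho m u) v w B.Φr := by
  have e := congrArg (lift2 m (lift3 u v w)) B.rho_cocycle
  rw [map_mul, map_mul, map_mul, lift4_tOne, lift4_idT_tId, lift4_idT_idT, lift4_tId] at e
  refine Units.ext (Eq.trans ?_ e)
  rw [lift2_tmul, map_one, one_mul]
  rfl

lemma Φr_counit_right' : lift3 m u (Q.counit R) B.Φr.val = 1 := by
  rw [Q.lift3_counit_right, B.Φr_counit_right, map_one]

lemma Φr_counit_mid' : lift3 m (Q.counit R) u B.Φr.val = 1 := by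
  rw [Q.lift3_counit_mid, B.Φr_counit_mid, map_one]

end Right

section LeftRight

lemma Φlr_intertwine (u : H →ₐ[k] R) (m : A →ₐ[k] R) (v : H →ₐ[k] R) [Comm u m] [Comm u v]
    [Comm m v] (a : A) :
    conv B.lam u (conv B.rho m v) a * lift3 u m v B.Φlr.val
      = lift3 u m v B.Φlr.val * conv B.rho (conv B.lam u m) v a := by
  have e := congrArg (lift3 u m v) (B.lr_comm a)
  rw [map_mul, map_mul, lift2_idT_conv, lift2_tId] at e
  exact e.symm

lemma Φlr_intertwine_inv (u : H →ₐ[k] R) (m : A →ₐ[k] R) (v : H →ₐ[k] R) [Comm u m] [Comm u v]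
    [Comm m v] (a : A) :
    conv B.rho (conv B.lam u m) v a * lift3 u m v B.Φlr⁻¹.val
      = lift3 u m v B.Φlr⁻¹.val * conv B.lam u (conv B.rho m v) a := by
  have e := congrArg (fun r => lift3 u m v B.Φlr⁻¹.val * r * lift3 u m v B.Φlr⁻¹.val)
    (B.Φlr_intertwine u m v a)
  simp only [mul_assoc, lift3_mul_inv, mul_one] at e
  rw [e, ← mul_assoc, lift3_inv_mul, one_mul]

lemma Φlr_pentagon_left (u v : H →ₐ[k] R) (m : A →ₐ[k] R) (w : H →ₐ[k] R) [Comm u v] [Comm u m]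
    [Comm u w] [Comm v m] [Comm v w] [Comm m w] :
    lift3U v m w B.Φlr * lift3U u (conv B.lam v m) w B.Φlr * lift3U u v m B.Φl
      = lift3U u v (conv B.rho m w) B.Φl * lift3U (conv Q.Δ u v) m w B.Φlr := by
  have e := congrArg (lift2 u (lift3 v m w)) B.lr_left
  rw [map_mul, map_mul, map_mul, lift4_tOne, lift4_idT_tId, lift4_idT_idT, lift4_tId] at e
  refine Units.ext (Eq.trans ?_ e)
  rw [lift2_tmul, map_one, one_mul]
  rfl

lemma Φlr_pentagon_right (u : H →ₐ[k] R) (m : A →ₐ[k] R) (v w : H →ₐ[k] R) [Comm u m] [Comm u v]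
    [Comm u w] [Comm m v] [Comm m w] [Comm v w] :
    lift3U m v w B.Φr * lift3U u (conv B.rho m v) w B.Φlr * lift3U u m v B.Φlr
      = lift3U u m (conv Q.Δ v w) B.Φlr * lift3U (conv B.lam u m) v w B.Φr := by
  have e := congrArg (lift2 u (lift3 m v w)) B.lr_right
  rw [map_mul, map_mul, map_mul, lift4_tOne, lift4_idT_tId, lift4_idT_idT, lift4_tId] at e
  refine Units.ext (Eq.trans ?_ e)
  rw [lift2_tmul, map_one, one_mul]
  rfl

/-- No normalisation of Φ_{λ,ρ} is assumed. Both outer ones follow from the mixed pentagons, again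
because an idempotent unit equals 1. -/
lemma Φlr_counit_left (m : A →ₐ[k] R) (v : H →ₐ[k] R) [Comm m v] :
    lift3 (Q.counit R) m v B.Φlr.val = 1 := by
  have e := B.Φlr_pentagon_left (Q.counit R) (Q.counit R) m v
  simp only [conv_lam_counit, QuasiBialgebra.conv_counit_left] at e
  have e₁ : ∀ y : A →ₐ[k] R, lift3U (Q.counit R) (Q.counit R) y B.Φl = 1 := fun y =>
    Units.ext (B.Φl_counit_mid' _ _)
  rw [e₁, e₁, mul_one, one_mul, mul_eq_right] at e
  exact congrArg Units.val e

lemma Φlr_counit_right (u : H →ₐ[k] R) (m : A →ₐ[k] R) [Comm u m] :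
    lift3 u m (Q.counit R) B.Φlr.val = 1 := by
  have e := B.Φlr_pentagon_right u m (Q.counit R) (Q.counit R)
  simp only [conv_rho_counit, QuasiBialgebra.conv_counit_left] at e
  have e₁ : ∀ y : A →ₐ[k] R, lift3U y (Q.counit R) (Q.counit R) B.Φr = 1 := fun y =>
    Units.ext (B.Φr_counit_right' _ _)
  rw [e₁, e₁, mul_one, one_mul, mul_eq_right] at e
  exact congrArg Units.val e

end LeftRight

end BicomoduleAlgebra
end Axioms

/-! ### Induction on pure tensors in iterated tensor products -/

section Induction

variable {k P Q S T U : Type*} [CommRing k] [AddCommGroup P] [Module k P] [AddCommGroup Q]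
  [Module k Q] [AddCommGroup S] [Module k S] [AddCommGroup T] [Module k T] [AddCommGroup U]
  [Module k U]

@[elab_as_elim]
lemma induction2 {motive : P ⊗[k] Q → Prop} (tmul : ∀ a b, motive (a ⊗ₜ b))
    (add : ∀ s t, motive s → motive t → motive (s + t)) (t : P ⊗[k] Q) : motive t := by
  induction t using TensorProduct.induction_on with
  | zero => simpa using tmul 0 0
  | add s t hs ht => exact add s t hs ht
  | tmul a b => exact tmul a b

@[elab_as_elim]
lemma induction3 {motive : P ⊗[k] (Q ⊗[k] S) → Prop} (tmul : ∀ a b c, motive (a ⊗ₜ (b ⊗ₜ c)))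
    (add : ∀ s t, motive s → motive t → motive (s + t)) (t : P ⊗[k] (Q ⊗[k] S)) : motive t :=
  induction2 (fun a => induction2 (tmul a) fun s t hs ht => by
    rw [tmul_add]; exact add _ _ hs ht) add t

@[elab_as_elim]
lemma induction4 {motive : P ⊗[k] (Q ⊗[k] (S ⊗[k] T)) → Prop}
    (tmul : ∀ a b c d, motive (a ⊗ₜ (b ⊗ₜ (c ⊗ₜ d))))
    (add : ∀ s t, motive s → motive t → motive (s + t)) (t : P ⊗[k] (Q ⊗[k] (S ⊗[k] T))) :
    motive t :=
  induction2 (fun a => induction3 (tmul a) fun s t hs ht => by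
    rw [tmul_add]; exact add _ _ hs ht) add t

@[elab_as_elim]
lemma induction5 {motive : P ⊗[k] (Q ⊗[k] (S ⊗[k] (T ⊗[k] U))) → Prop}
    (tmul : ∀ a b c d e, motive (a ⊗ₜ (b ⊗ₜ (c ⊗ₜ (d ⊗ₜ e)))))
    (add : ∀ s t, motive s → motive t → motive (s + t))
    (t : P ⊗[k] (Q ⊗[k] (S ⊗[k] (T ⊗[k] U)))) : motive t :=
  induction2 (fun a => induction4 (tmul a) fun s t hs ht => by
    rw [tmul_add]; exact add _ _ hs ht) add t

end Induction

/-! ### Coordinate embeddings as legs, and stability of collapses -/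

section Legs

variable {k P Q R S T : Type*} [CommRing k] [Ring P] [Algebra k P] [Ring Q] [Algebra k Q]
  [Ring R] [Algebra k R] [Ring S] [Algebra k S] [Ring T] [Algebra k T]

/-- The algebra map `x ↦ x ⊗ 1`. -/
abbrev inl : P →ₐ[k] P ⊗[k] Q := Algebra.TensorProduct.includeLeft

/-- The algebra map `x ↦ 1 ⊗ x`. -/
abbrev inr : Q →ₐ[k] P ⊗[k] Q := Algebra.TensorProduct.includeRight

instance : Comm (inl : P →ₐ[k] P ⊗[k] Q) (inr : Q →ₐ[k] P ⊗[k] Q) :=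
  ⟨fun x y => by simp [Commute, SemiconjBy]⟩

instance (v : S →ₐ[k] Q) : Comm (inl : P →ₐ[k] P ⊗[k] Q) (inr.comp v) :=
  ⟨fun x y => by simp [Commute, SemiconjBy]⟩

instance (u : S →ₐ[k] P) : Comm (inl.comp u : S →ₐ[k] P ⊗[k] Q) inr :=
  ⟨fun x y => by simp [Commute, SemiconjBy]⟩

instance (u : S →ₐ[k] P) (v : T →ₐ[k] Q) : Comm (inl.comp u : S →ₐ[k] P ⊗[k] Q) (inr.comp v) :=
  ⟨fun x y => by simp [Commute, SemiconjBy]⟩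

instance (u : S →ₐ[k] P) (v : T →ₐ[k] Q) : Comm (inr.comp v) (inl.comp u : S →ₐ[k] P ⊗[k] Q) :=
  ⟨fun x y => by simp [Commute, SemiconjBy]⟩

instance instCommComp (f : P →ₐ[k] R) (u : S →ₐ[k] P) (v : T →ₐ[k] P) [Comm u v] :
    Comm (f.comp u) (f.comp v) :=
  ⟨fun x y => (Comm.comm (u := u) (v := v) x y).map f⟩

lemma map_lift2 (f : P →ₐ[k] R) (u : S →ₐ[k] P) (v : T →ₐ[k] P) [Comm u v] (t : S ⊗[k] T) :
    f (lift2 u v t) = lift2 (f.comp u) (f.comp v) t :=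
  induction2 (fun a b => by simp) (fun s t hs ht => by simp only [map_add, hs, ht]) t

lemma comp_conv {U : Type*} [Ring U] [Algebra k U] (f : P →ₐ[k] R) (δ : U →ₐ[k] S ⊗[k] T)
    (u : S →ₐ[k] P) (v : T →ₐ[k] P) [Comm u v] :
    f.comp (conv δ u v) = conv δ (f.comp u) (f.comp v) :=
  AlgHom.ext fun x => map_lift2 f u v (δ x)

lemma conv_intertwine {r : R} {δ : T →ₐ[k] P ⊗[k] Q} {u u' : P →ₐ[k] R} {v v' : Q →ₐ[k] R}
    [Comm u v] [Comm u' v'] (hu : ∀ x, r * u x = u' x * r) (hv : ∀ x, r * v x = v' x * r) (h : T) :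
    r * conv δ u v h = conv δ u' v' h * r :=
  lift2_intertwine hu hv (δ h)

section Collapse

variable {X : Type*} [AddCommGroup X] [Module k X] {N : R →ₗ[k] X} {δ : T →ₐ[k] P ⊗[k] Q}
  {u u' : P →ₐ[k] R} {v v' : Q →ₐ[k] R} [Comm u v]

lemma RightEq.trans {w : P →ₐ[k] R} (h : RightEq N u u') (h' : RightEq N u' w) : RightEq N u w :=
  fun x r => (h x r).trans (h' x r)

lemma LeftEq.conv_left [Comm u' v] (h : LeftEq N u u') : LeftEq N (conv δ u v) (conv δ u' v) :=
  fun x r => h.fst₂ (δ x) r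

lemma LeftEq.conv_right [Comm u v'] (h : LeftEq N v v') : LeftEq N (conv δ u v) (conv δ u v') :=
  fun x r => h.snd₂ (δ x) r

lemma RightEq.conv_left [Comm u' v] (h : RightEq N u u') : RightEq N (conv δ u v) (conv δ u' v) :=
  fun x r => h.fst₂ (δ x) r

lemma RightEq.conv_right [Comm u v'] (h : RightEq N v v') :
    RightEq N (conv δ u v) (conv δ u v') :=
  fun x r => h.snd₂ (δ x) r

-- A collapse may take place behind a prefix, provided that the prefix commutes with both letters.
omit [Comm u v] in
lemma LeftEq.mul_left (h : LeftEq N u u') {s : R} (hs : ∀ x, Commute s (u x))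
    (hs' : ∀ x, Commute s (u' x)) : LeftEq (N ∘ₗ LinearMap.mulLeft k s) u u' := fun x r => by
  have e := h x (s * r)
  simpa only [LinearMap.comp_apply, LinearMap.mulLeft_apply, ← mul_assoc, (hs x).eq, (hs' x).eq]
    using e

omit [Comm u v] in
lemma RightEq.mul_right (h : RightEq N u u') {s : R} (hs : ∀ x, Commute s (u x))
    (hs' : ∀ x, Commute s (u' x)) : RightEq (N ∘ₗ LinearMap.mulRight k s) u u' := fun x r => by
  have e := h x (r * s)
  simpa only [LinearMap.comp_apply, LinearMap.mulRight_apply, mul_assoc, (hs x).eq, (hs' x).eq]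
    using e

end Collapse

end Legs

/-! ### From antipode identities to collapses of adjacent legs -/

section Collapse

variable {k H : Type*} [Field k] [Ring H] [Algebra k H] {R X Y : Type*} [Ring R] [Algebra k R]
  [AddCommGroup X] [Module k X] [AddCommGroup Y] [Module k Y] (Q : QuasiBialgebra k H)

variable {N : R →ₗ[k] X} {u v : H →ₐ[k] R} [Comm u v]

/-- For fixed r the value depends on the two legs only through a contraction c, and c sends Δ(h) to
ε(h) times its value at 1. The antipode identities for α and β, and later for γ and δ, all enter
through this criterion or its right-hand mirror. -/
lemma leftEq_counit (c : H ⊗[k] H →ₗ[k] Y) (y : Y) (hc : ∀ h, c (Q.Δ h) = Q.ε h • y)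
    (hN : ∀ r, ∃ g : Y → X, IsLinearMap k g ∧ ∀ a b, N (u a * v b * r) = g (c (a ⊗ₜ b))) :
    LeftEq N (conv Q.Δ u v) (Q.counit R) := fun h r => by
  obtain ⟨g, hg, e⟩ := hN r
  have e' : ∀ t, N (lift2 u v t * r) = hg.mk' g (c t) := fun t =>
    induction2 (fun a b => by simpa using e a b)
      (fun s t hs ht => by simp only [map_add, add_mul, hs, ht]) t
  -- Taking h = 1 identifies g y with N r, so nothing else about g has to be known.
  have e₁ := hc 1
  rw [map_one, map_one Q.ε, one_smul] at e₁
  have e₂ := e' 1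
  rw [map_one, one_mul, e₁] at e₂
  rw [conv_apply, e', hc, map_smul, Q.counit_mul, map_smul, e₂]

lemma rightEq_counit (c : H ⊗[k] H →ₗ[k] Y) (y : Y) (hc : ∀ h, c (Q.Δ h) = Q.ε h • y)
    (hN : ∀ r, ∃ g : Y → X, IsLinearMap k g ∧ ∀ a b, N (r * (u a * v b)) = g (c (a ⊗ₜ b))) :
    RightEq N (conv Q.Δ u v) (Q.counit R) := fun h r => by
  obtain ⟨g, hg, e⟩ := hN r
  have e' : ∀ t, N (r * lift2 u v t) = hg.mk' g (c t) := fun t =>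
    induction2 (fun a b => by simpa using e a b)
      (fun s t hs ht => by simp only [map_add, mul_add, hs, ht]) t
  have e₁ := hc 1
  rw [map_one, map_one Q.ε, one_smul] at e₁
  have e₂ := e' 1
  rw [map_one, mul_one, e₁] at e₂
  rw [conv_apply, e', hc, map_smul, Q.mul_counit, map_smul, e₂]

end Collapse

/-! ### The zigzag identity for nested evaluations and coevaluations -/

section Zigzag

variable {k H : Type*} [Field k] [Ring H] [Algebra k H] {R X : Type*} [Ring R] [Algebra k R]
  [AddCommGroup X] [Module k X] (Q : QuasiBialgebra k H)

local infixl:75 " ◇ " => conv (QuasiBialgebra.Δ Q)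
local notation "Φ(" u "," v "," w ")" => lift3 u v w (Units.val (QuasiBialgebra.Φ Q))
local notation "Φ⁻(" u "," v "," w ")" => lift3 u v w (Units.val (Inv.inv (QuasiBialgebra.Φ Q)))

/-- A nested zigzag reduces to two separate zigzags. -/
lemma nested_zigzag (a b c d e f : H →ₐ[k] R) [Comm a b] [Comm a c] [Comm a d] [Comm a e]
    [Comm a f] [Comm b c] [Comm b d] [Comm b e] [Comm b f] [Comm c d] [Comm c e] [Comm c f]
    [Comm d e] [Comm d f] [Comm e f] (N : R →ₗ[k] X)
    (hbc : LeftEq N (b ◇ c) (Q.counit R)) (had : LeftEq N (a ◇ d) (Q.counit R))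
    (hde : RightEq N (d ◇ e) (Q.counit R)) (hcf : RightEq N (c ◇ f) (Q.counit R)) :
    N (Φ⁻(b, c, d) * Φ(a, b, c ◇ d) * Φ⁻(a ◇ b, c ◇ d, e ◇ f) * (Φ(c ◇ d, e, f) * Φ⁻(c, d, e)))
      = N (Φ⁻(a, d, e) * Φ⁻(b, c, f)) := by
  have s₁ : Φ(a, b, c ◇ d) * Φ⁻(a ◇ b, c ◇ d, e ◇ f)
      = Φ⁻(a, b ◇ (c ◇ d), e ◇ f) * Φ⁻(b, c ◇ d, e ◇ f) * Φ(a, b, c ◇ d ◇ (e ◇ f)) :=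
    congrArg Units.val (pentagon_mul_inv (Q.Φ_pentagon a b (c ◇ d) (e ◇ f)))
  have s₂ : Φ(a, b, c ◇ d ◇ (e ◇ f)) * (Φ(c ◇ d, e, f) * Φ⁻(c, d, e))
      = Φ(c ◇ d, e, f) * Φ⁻(c, d, e) * Φ(a, b, c ◇ (d ◇ e) ◇ f) := by
    refine (lift3_intertwine (fun x => ?_) (fun x => ?_) (fun x => ?_) _).symm
    · exact ((Comm.comm (u := a) (v := lift3 (c ◇ d) e f) x _).mul_right
        (Comm.comm (u := a) (v := lift3 c d e) x _)).eq.symm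
    · exact ((Comm.comm (u := b) (v := lift3 (c ◇ d) e f) x _).mul_right
        (Comm.comm (u := b) (v := lift3 c d e) x _)).eq.symm
    · have h₁ := conv_intertwine (δ := Q.Δ) (u := c ◇ (d ◇ e)) (v := f) (u' := c ◇ d ◇ e) (v' := f)
        (r := Φ⁻(c, d, e)) (fun y => (Q.Φ_intertwine_inv c d e y).symm)
        (fun y => comm_eq (lift3 c d e) f _ y |>.symm) x
      rw [mul_assoc, h₁, ← mul_assoc, ← Q.Φ_intertwine, mul_assoc]
  have s₃ : Φ⁻(b, c, d) * Φ⁻(a, b ◇ (c ◇ d), e ◇ f) = Φ⁻(a, b ◇ c ◇ d, e ◇ f) * Φ⁻(b, c, d) :=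
    lift3_intertwine (fun x => comm_eq a (lift3 b c d) x _)
      (fun y => (Q.Φ_intertwine_inv b c d y).symm)
      (fun y => (comm_eq (lift3 b c d) (e ◇ f) _ y).symm) _
  have s₄ : Φ⁻(b, c ◇ d, e ◇ f) * Φ(c ◇ d, e, f)
      = Φ(b ◇ (c ◇ d), e, f) * Φ⁻(b, c ◇ d, e) * Φ⁻(b, c ◇ d ◇ e, f) :=
    congrArg Units.val (pentagon_inv_left (Q.Φ_pentagon b (c ◇ d) e f))
  have s₅ : Φ⁻(b, c, d) * Φ(b ◇ (c ◇ d), e, f) = Φ(b ◇ c ◇ d, e, f) * Φ⁻(b, c, d) :=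
    lift3_intertwine (fun y => (Q.Φ_intertwine_inv b c d y).symm)
      (fun y => (comm_eq (lift3 b c d) e _ y).symm) (fun y => (comm_eq (lift3 b c d) f _ y).symm) _
  have s₆ : Φ⁻(b, c ◇ d ◇ e, f) * Φ⁻(c, d, e) = Φ⁻(c, d, e) * Φ⁻(b, c ◇ (d ◇ e), f) :=
    (lift3_intertwine (fun x => comm_eq b (lift3 c d e) x _)
      (fun y => (Q.Φ_intertwine_inv c d e y).symm)
      (fun y => (comm_eq (lift3 c d e) f _ y).symm) _).symm
  have s₇ : Φ⁻(b, c, d) * Φ⁻(b, c ◇ d, e) * Φ⁻(c, d, e) = Φ⁻(b ◇ c, d, e) * Φ⁻(b, c, d ◇ e) :=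
    congrArg Units.val (pentagon_inv (Q.Φ_pentagon b c d e))
  have s₈ : Φ⁻(a, d, e ◇ f) * Φ(d, e, f) = Φ(a ◇ d, e, f) * Φ⁻(a, d, e) * Φ⁻(a, d ◇ e, f) :=
    congrArg Units.val (pentagon_inv_left (Q.Φ_pentagon a d e f))
  have hbcd : LeftEq N (b ◇ c ◇ d) d := by
    simpa using hbc.conv_left (δ := Q.Δ) (v := d)
  have hcde : RightEq N (c ◇ (d ◇ e)) c := by
    simpa using hde.conv_right (δ := Q.Δ) (u := c)
  have hcdef : RightEq N (c ◇ (d ◇ e) ◇ f) (Q.counit R) :=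
    hcde.conv_left.trans hcf
  -- These commutations allow b ◇ c to collapse behind a prefix in a, d, e, f, and d ◇ e to collapse
  -- in front of a suffix in b, c, f.
  have c₁ : ∀ x, Commute Φ⁻(a, d, e ◇ f) ((b ◇ c) x) := fun x =>
    (commute_lift2 a (lift2 d (e ◇ f)) (fun y => (Comm.comm y x).symm)
      (fun y => Comm.comm x y) _).symm
  have c₂ : ∀ x, Commute (Φ⁻(a, d, e ◇ f) * Φ(d, e, f)) ((b ◇ c) x) := fun x =>
    (c₁ x).mul_left (Comm.comm (v := lift3 d e f) x _).symm
  have c₃ : ∀ x, Commute Φ⁻(b, c, f) ((d ◇ e) x) := fun x =>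
    (commute_lift2 b (lift2 c f) (fun y => (Comm.comm y x).symm)
      (commute_lift2 c f (fun y => (Comm.comm y x).symm) (fun y => Comm.comm x y)) _).symm
  -- The pentagons break up the central factor. First a factor with third leg (c(de))f reaches the
  -- right end and becomes trivial, d ◇ e collapsing inside it and then c ◇ f. Next (bc)d shrinks to
  -- d from the left. The other factors containing b ◇ c, d ◇ e or a ◇ d disappear in the same way,
  -- until the two zigzags no longer interact.
  calc _ = N (Φ⁻(b, c, d) * Φ⁻(a, b ◇ (c ◇ d), e ◇ f) * Φ⁻(b, c ◇ d, e ◇ f)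
        * (Φ(c ◇ d, e, f) * Φ⁻(c, d, e)) * Φ(a, b, c ◇ (d ◇ e) ◇ f)) := by
        rw [mul_assoc Φ⁻(b, c, d), s₁]
        simp only [mul_assoc] at s₂ ⊢
        rw [s₂]
    _ = N (Φ⁻(b, c, d) * Φ⁻(a, b ◇ (c ◇ d), e ◇ f) * Φ⁻(b, c ◇ d, e ◇ f)
        * (Φ(c ◇ d, e, f) * Φ⁻(c, d, e))) := by
        rw [hcdef.trd, Q.Φ_counit_right, mul_one]
    _ = N (Φ⁻(a, b ◇ c ◇ d, e ◇ f) * (Φ⁻(b, c, d) * Φ(b ◇ (c ◇ d), e, f) * Φ⁻(b, c ◇ d, e)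
        * (Φ⁻(b, c ◇ d ◇ e, f) * Φ⁻(c, d, e)))) := by
        rw [s₃, mul_assoc, ← mul_assoc Φ⁻(b, c ◇ d, e ◇ f), s₄]
        simp only [mul_assoc]
    _ = N (Φ⁻(a, d, e ◇ f) * (Φ(b ◇ c ◇ d, e, f) * (Φ⁻(b, c, d) * Φ⁻(b, c ◇ d, e)
        * Φ⁻(c, d, e) * Φ⁻(b, c ◇ (d ◇ e), f)))) := by
        rw [hbcd.snd, s₅, s₆]
        simp only [mul_assoc]
    _ = N (Φ⁻(a, d, e ◇ f) * (Φ(d, e, f) * (Φ⁻(b ◇ c, d, e) * Φ⁻(b, c, d ◇ e)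
        * Φ⁻(b, c ◇ (d ◇ e), f)))) := by
        rw [s₇]
        have h := (hbc.mul_left c₁ fun x => Q.commute_counit _ x).conv_left (δ := Q.Δ) (v := d)
        rw [Q.conv_counit_left] at h
        exact h.fst _ _
    _ = N (Φ⁻(a, d, e ◇ f) * Φ(d, e, f) * (Φ⁻(b, c, d ◇ e) * Φ⁻(b, c, f))) := by
        rw [← mul_assoc, ← mul_assoc, hcde.snd, mul_assoc, mul_assoc Φ⁻(b ◇ c, d, e)]
        have h := (hbc.mul_left c₂ fun x => Q.commute_counit _ x).fst (v := d) (w := e) Q.Φ⁻¹.val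
          (Φ⁻(b, c, d ◇ e) * Φ⁻(b, c, f))
        rwa [lift3_inv_eq_one _ _ _ (Q.Φ_counit_left d e), one_mul] at h
    _ = N (Φ⁻(a, d, e ◇ f) * Φ(d, e, f) * Φ⁻(b, c, f)) := by
        have h := (hde.mul_right c₃ fun x => Q.commute_counit _ x).trd (u := b) (v := c) Q.Φ⁻¹.val
          (Φ⁻(a, d, e ◇ f) * Φ(d, e, f))
        rw [lift3_inv_eq_one _ _ _ (Q.Φ_counit_right b c), mul_one] at h
        rw [← mul_assoc]
        exact h
    _ = N (Φ⁻(a, d, e) * Φ⁻(a, d ◇ e, f) * Φ⁻(b, c, f)) := by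
        rw [s₈, mul_assoc, mul_assoc, had.fst, Q.Φ_counit_left, one_mul, ← mul_assoc]
    _ = _ := by
        have h := (hde.mul_right c₃ fun x => Q.commute_counit _ x).snd (u := a) (w := f) Q.Φ⁻¹.val
          Φ⁻(a, d, e)
        rw [lift3_inv_eq_one _ _ _ (Q.Φ_counit_mid a f), mul_one] at h
        exact h

end Zigzag

/-! ### The nested evaluation γ and coevaluation δ of a tensor square -/

section Twist

variable {k H : Type*} [Field k] [Ring H] [Algebra k H]

namespace QuasiHopfAlgebra

variable (Q : QuasiHopfAlgebra k H)

local infixl:75 " ◇ " => conv (QuasiBialgebra.Δ (QuasiHopfAlgebra.toQuasiBialgebra Q))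
local notation "Φ(" u "," v "," w ")" =>
  lift3 u v w (Units.val (QuasiBialgebra.Φ (QuasiHopfAlgebra.toQuasiBialgebra Q)))
local notation "Φ⁻(" u "," v "," w ")" =>
  lift3 u v w (Units.val (Inv.inv (QuasiBialgebra.Φ (QuasiHopfAlgebra.toQuasiBialgebra Q))))

lemma S_one : Q.S 1 = 1 := by
  have h : Q.S 1 = Q.S (Q.Sinv 1) := by rw [Q.Sinv_one]
  simpa using h

/-- `x ⊗ y ↦ S x * α * y`. -/
def evα : H ⊗[k] H →ₗ[k] H :=
  bi (fun h₁ h₂ => Q.S h₁ * Q.α * h₂)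
    (fun _ => by constructor <;> intros <;> simp [add_mul])
    (fun _ => by constructor <;> intros <;> simp [mul_add])

@[simp] lemma evα_tmul (x y : H) : Q.evα (x ⊗ₜ y) = Q.S x * Q.α * y := by simp [evα]

lemma evα_Δ (h : H) : Q.evα (Q.Δ h) = Q.ε h • Q.α := Q.S_α h

/-- `x ⊗ y ↦ x * β * S y`. -/
def coevβ : H ⊗[k] H →ₗ[k] H :=
  bi (fun h₁ h₂ => h₁ * Q.β * Q.S h₂)
    (fun _ => by constructor <;> intros <;> simp [add_mul])
    (fun _ => by constructor <;> intros <;> simp [mul_add])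

@[simp] lemma coevβ_tmul (x y : H) : Q.coevβ (x ⊗ₜ y) = x * Q.β * Q.S y := by simp [coevβ]

lemma coevβ_Δ (h : H) : Q.coevβ (Q.Δ h) = Q.ε h • Q.β := Q.β_S h

/-- `x ⊗ y ⊗ z ↦ S x * α * y * β * S z`. -/
def zigzag : H ⊗[k] (H ⊗[k] H) →ₗ[k] H :=
  tri (fun x₁ x₂ x₃ => Q.S x₁ * Q.α * x₂ * Q.β * Q.S x₃)
    (fun _ _ => by constructor <;> intros <;> simp [add_mul])
    (fun _ _ => by constructor <;> intros <;> simp [mul_add, add_mul])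
    (fun _ _ => by constructor <;> intros <;> simp [mul_add])

@[simp] lemma zigzag_tmul (x y z : H) :
    Q.zigzag (x ⊗ₜ (y ⊗ₜ z)) = Q.S x * Q.α * y * Q.β * Q.S z := by simp [zigzag]

lemma zigzag_Φ : Q.zigzag Q.Φ⁻¹.val = 1 := Q.Φ_α_β

lemma leftEq_zigzag : LeftEq Q.zigzag
    ((inl : H →ₐ[k] H ⊗[k] (H ⊗[k] H)) ◇ (inr.comp inl)) (Q.counit _) := by
  refine leftEq_counit _ Q.evα Q.α Q.evα_Δ fun r => ?_
  induction r using induction3 with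
  | tmul a b c =>
    refine ⟨fun z => Q.S a * z * b * Q.β * Q.S c, ?_, fun x y => ?_⟩
    · constructor <;> intros <;> simp [mul_add, add_mul]
    · simp [Q.S_mul, mul_assoc]
  | add s t hs ht =>
    obtain ⟨f, hf, hf'⟩ := hs
    obtain ⟨g, hg, hg'⟩ := ht
    exact ⟨fun z => f z + g z, (hf.mk' f + hg.mk' g).isLinear, fun x y => by
      simp only [mul_add, map_add, hf', hg']⟩

lemma rightEq_zigzag : RightEq Q.zigzag
    (inr.comp inl ◇ (inr.comp inr : H →ₐ[k] H ⊗[k] (H ⊗[k] H))) (Q.counit _) := by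
  refine rightEq_counit _ Q.coevβ Q.β Q.coevβ_Δ fun r => ?_
  induction r using induction3 with
  | tmul a b c =>
    refine ⟨fun z => Q.S a * Q.α * b * z * Q.S c, ?_, fun x y => ?_⟩
    · constructor <;> intros <;> simp [mul_add, add_mul]
    · simp [Q.S_mul, mul_assoc]
  | add s t hs ht =>
    obtain ⟨f, hf, hf'⟩ := hs
    obtain ⟨g, hg, hg'⟩ := ht
    exact ⟨fun z => f z + g z, (hf.mk' f + hg.mk' g).isLinear, fun x y => by
      simp only [add_mul, map_add, hf', hg']⟩

/-- `(S ⊗ S)` composed with the flip. -/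
def flipS : H ⊗[k] H →ₗ[k] H ⊗[k] H :=
  TensorProduct.map Q.S.toLinearMap Q.S.toLinearMap ∘ₗ (TensorProduct.comm k H H).toLinearMap

@[simp] lemma flipS_tmul (x y : H) : Q.flipS (x ⊗ₜ y) = Q.S y ⊗ₜ Q.S x := by simp [flipS]

lemma SSΔcop_apply (h : H) : Q.SSΔcop h = Q.flipS (Q.Δ h) := rfl

lemma flipS_mul (s t : H ⊗[k] H) : Q.flipS (s * t) = Q.flipS t * Q.flipS s := by
  induction s using induction2 with
  | tmul a b =>
    induction t using induction2 with
    | tmul c d => simp [Q.S_mul]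
    | add s t hs ht => simp only [mul_add, add_mul, map_add, hs, ht]
  | add s t hs ht => simp only [mul_add, add_mul, map_add, hs, ht]

lemma SSΔcop_mul (x y : H) : Q.SSΔcop (x * y) = Q.SSΔcop y * Q.SSΔcop x := by
  rw [SSΔcop_apply, map_mul, flipS_mul]; rfl

lemma SSΔcop_one : Q.SSΔcop 1 = 1 := by
  rw [SSΔcop_apply, map_one, Algebra.TensorProduct.one_def, flipS_tmul, Q.S_one]

/-- `a ⊗ b ⊗ c ⊗ d ↦ S b * α * c ⊗ S a * α * d`. -/
def nestα : H ⊗[k] (H ⊗[k] (H ⊗[k] H)) →ₗ[k] H ⊗[k] H :=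
  quad (fun a b c d => (Q.S b * Q.α * c) ⊗ₜ[k] (Q.S a * Q.α * d))
    (fun _ _ _ => by constructor <;> intros <;> simp [add_mul, tmul_add])
    (fun _ _ _ => by constructor <;> intros <;> simp [add_mul, add_tmul, smul_tmul'])
    (fun _ _ _ => by constructor <;> intros <;> simp [mul_add, add_tmul, smul_tmul'])
    (fun _ _ _ => by constructor <;> intros <;> simp [mul_add, tmul_add])

@[simp] lemma nestα_tmul (a b c d : H) : Q.nestα (a ⊗ₜ (b ⊗ₜ (c ⊗ₜ d)))
    = (Q.S b * Q.α * c) ⊗ₜ[k] (Q.S a * Q.α * d) := by simp [nestα]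

/-- `a ⊗ b ⊗ c ⊗ d ↦ a * β * S d ⊗ b * β * S c`. -/
def nestβ : H ⊗[k] (H ⊗[k] (H ⊗[k] H)) →ₗ[k] H ⊗[k] H :=
  quad (fun B₁ B₂ B₃ B₄ => (B₁ * Q.β * Q.S B₄) ⊗ₜ[k] (B₂ * Q.β * Q.S B₃))
    (fun _ _ _ => by constructor <;> intros <;> simp [add_mul, add_tmul, smul_tmul'])
    (fun _ _ _ => by constructor <;> intros <;> simp [add_mul, tmul_add])
    (fun _ _ _ => by constructor <;> intros <;> simp [mul_add, tmul_add])
    (fun _ _ _ => by constructor <;> intros <;> simp [mul_add, add_tmul, smul_tmul'])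

@[simp] lemma nestβ_tmul (a b c d : H) : Q.nestβ (a ⊗ₜ (b ⊗ₜ (c ⊗ₜ d)))
    = (a * Q.β * Q.S d) ⊗ₜ[k] (b * Q.β * Q.S c) := by simp [nestβ]

/-- `(1 ⊗ Φ⁻¹) (id ⊗ id ⊗ Δ)(Φ)`. -/
def wordα : H ⊗[k] (H ⊗[k] (H ⊗[k] H)) := (1 ⊗ₜ Q.Φ⁻¹.val) * idT H (idT H Q.Δ) Q.Φ

/-- `(Δ ⊗ id ⊗ id)(Φ) (Φ⁻¹ ⊗ 1)`. -/
def wordβ : H ⊗[k] (H ⊗[k] (H ⊗[k] H)) :=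
  tId Q.Δ (H ⊗[k] H) Q.Φ * idT H (idT H (tOne H)) (↑Q.Φ⁻¹ : H ⊗[k] (H ⊗[k] H))

/-- The element `γ` of `H ⊗ H`. -/
def γ : H ⊗[k] H := Q.nestα Q.wordα

lemma δ_eq : Q.δ = Q.nestβ Q.wordβ := rfl

section Words

variable {R : Type*} [Ring R] [Algebra k R] (a b c d : H →ₐ[k] R) [Comm a b] [Comm a c] [Comm a d]
  [Comm b c] [Comm b d] [Comm c d]

lemma lift4_wordα : lift2 a (lift3 b c d) Q.wordα = Φ⁻(b, c, d) * Φ(a, b, c ◇ d) := by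
  rw [wordα, map_mul, lift4_idT_idT, lift2_tmul, map_one, one_mul]

lemma lift4_wordβ : lift2 a (lift3 b c d) Q.wordβ = Φ(a ◇ b, c, d) * Φ⁻(a, b, c) := by
  rw [wordβ, map_mul, lift4_tId, lift4_tOne]

/-- The word rebrackets (ab)(cd) into a((bc)d), where the inner pair bc is adjacent, and the outer
pair ad becomes adjacent once bc has collapsed. `wordβ_intertwine` is the mirror image. -/
lemma wordα_intertwine (h : H) :
    (Φ⁻(b, c, d) * Φ(a, b, c ◇ d)) * (a ◇ b ◇ (c ◇ d)) h
      = (a ◇ (b ◇ c ◇ d)) h * (Φ⁻(b, c, d) * Φ(a, b, c ◇ d)) := by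
  rw [mul_assoc, ← Q.Φ_intertwine, ← mul_assoc, ← mul_assoc]
  congr 1
  exact conv_intertwine (fun x => comm_eq a (lift3 b c d) x _)
    (fun y => (Q.Φ_intertwine_inv b c d y).symm) h

lemma wordβ_intertwine (h : H) :
    (Φ(a ◇ b, c, d) * Φ⁻(a, b, c)) * (a ◇ (b ◇ c) ◇ d) h
      = (a ◇ b ◇ (c ◇ d)) h * (Φ(a ◇ b, c, d) * Φ⁻(a, b, c)) := by
  rw [← mul_assoc, Q.Φ_intertwine, mul_assoc, mul_assoc]
  congr 1
  exact conv_intertwine (fun y => (Q.Φ_intertwine_inv a b c y).symm)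
    (fun x => (comm_eq (lift3 a b c) d _ x).symm) h

end Words

section Legs4

local notation "ℓ₁" => (inl : H →ₐ[k] H ⊗[k] (H ⊗[k] (H ⊗[k] H)))
local notation "ℓ₂" => AlgHom.comp (inr : _ →ₐ[k] H ⊗[k] (H ⊗[k] (H ⊗[k] H))) inl
local notation "ℓ₃" => AlgHom.comp (inr : _ →ₐ[k] H ⊗[k] (H ⊗[k] (H ⊗[k] H))) (AlgHom.comp inr inl)
local notation "ℓ₄" => AlgHom.comp (inr : _ →ₐ[k] H ⊗[k] (H ⊗[k] (H ⊗[k] H))) (AlgHom.comp inr inr)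

lemma lift4_legs (t : H ⊗[k] (H ⊗[k] (H ⊗[k] H))) : lift2 ℓ₁ (lift3 ℓ₂ ℓ₃ ℓ₄) t = t := by
  induction t using induction4 with
  | tmul a b c d => simp
  | add s t hs ht => rw [map_add, hs, ht]

lemma wordα_eq : Q.wordα = Φ⁻(ℓ₂, ℓ₃, ℓ₄) * Φ(ℓ₁, ℓ₂, ℓ₃ ◇ ℓ₄) := by
  rw [← lift4_wordα, lift4_legs]

lemma wordβ_eq : Q.wordβ = Φ(ℓ₁ ◇ ℓ₂, ℓ₃, ℓ₄) * Φ⁻(ℓ₁, ℓ₂, ℓ₃) := by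
  rw [← lift4_wordβ, lift4_legs]

lemma leftEq_nestα_inner : LeftEq Q.nestα (ℓ₂ ◇ ℓ₃) (Q.counit _) := by
  refine leftEq_counit _ Q.evα Q.α Q.evα_Δ fun r => ?_
  induction r using induction4 with
  | tmul a b c d =>
    refine ⟨fun z => (Q.S b * z * c) ⊗ₜ[k] (Q.S a * Q.α * d), ?_, fun x y => ?_⟩
    · constructor <;> intros <;> simp [mul_add, add_mul, add_tmul, smul_tmul']
    · simp [Q.S_mul, mul_assoc]
  | add s t hs ht =>
    obtain ⟨f, hf, hf'⟩ := hs
    obtain ⟨g, hg, hg'⟩ := ht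
    exact ⟨fun z => f z + g z, (hf.mk' f + hg.mk' g).isLinear, fun x y => by
      simp only [mul_add, map_add, hf', hg']⟩

lemma leftEq_nestα_outer : LeftEq Q.nestα (ℓ₁ ◇ ℓ₄) (Q.counit _) := by
  refine leftEq_counit _ Q.evα Q.α Q.evα_Δ fun r => ?_
  induction r using induction4 with
  | tmul a b c d =>
    refine ⟨fun z => (Q.S b * Q.α * c) ⊗ₜ[k] (Q.S a * z * d), ?_, fun x y => ?_⟩
    · constructor <;> intros <;> simp [mul_add, add_mul, tmul_add]
    · simp [Q.S_mul, mul_assoc]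
  | add s t hs ht =>
    obtain ⟨f, hf, hf'⟩ := hs
    obtain ⟨g, hg, hg'⟩ := ht
    exact ⟨fun z => f z + g z, (hf.mk' f + hg.mk' g).isLinear, fun x y => by
      simp only [mul_add, map_add, hf', hg']⟩

lemma rightEq_nestβ_inner : RightEq Q.nestβ (ℓ₂ ◇ ℓ₃) (Q.counit _) := by
  refine rightEq_counit _ Q.coevβ Q.β Q.coevβ_Δ fun r => ?_
  induction r using induction4 with
  | tmul a b c d =>
    refine ⟨fun z => (a * Q.β * Q.S d) ⊗ₜ[k] (b * z * Q.S c), ?_, fun x y => ?_⟩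
    · constructor <;> intros <;> simp [mul_add, add_mul, tmul_add]
    · simp [Q.S_mul, mul_assoc]
  | add s t hs ht =>
    obtain ⟨f, hf, hf'⟩ := hs
    obtain ⟨g, hg, hg'⟩ := ht
    exact ⟨fun z => f z + g z, (hf.mk' f + hg.mk' g).isLinear, fun x y => by
      simp only [add_mul, map_add, hf', hg']⟩

lemma rightEq_nestβ_outer : RightEq Q.nestβ (ℓ₁ ◇ ℓ₄) (Q.counit _) := by
  refine rightEq_counit _ Q.coevβ Q.β Q.coevβ_Δ fun r => ?_
  induction r using induction4 with
  | tmul a b c d =>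
    refine ⟨fun z => (a * z * Q.S d) ⊗ₜ[k] (b * Q.β * Q.S c), ?_, fun x y => ?_⟩
    · constructor <;> intros <;> simp [mul_add, add_mul, add_tmul, smul_tmul']
    · simp [Q.S_mul, mul_assoc]
  | add s t hs ht =>
    obtain ⟨f, hf, hf'⟩ := hs
    obtain ⟨g, hg, hg'⟩ := ht
    exact ⟨fun z => f z + g z, (hf.mk' f + hg.mk' g).isLinear, fun x y => by
      simp only [add_mul, map_add, hf', hg']⟩

lemma nestα_mul (s t : H ⊗[k] H) (w : H ⊗[k] (H ⊗[k] (H ⊗[k] H))) :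
    Q.nestα (w * lift2 (lift2 ℓ₁ ℓ₂) (lift2 ℓ₃ ℓ₄) (s ⊗ₜ t))
      = Q.flipS s * Q.nestα w * t := by
  induction w using induction4 with
  | add w w' hw hw' => simp only [add_mul, mul_add, map_add, hw, hw']
  | tmul a b c d =>
  induction s using induction2 with
  | add s s' hs hs' => simp only [add_mul, mul_add, map_add, add_tmul, hs, hs']
  | tmul x y =>
  induction t using induction2 with
  | add s s' hs hs' => simp only [mul_add, map_add, tmul_add, hs, hs']
  | tmul z w => simp [Q.S_mul, mul_assoc]

lemma nestβ_mul (s t : H ⊗[k] H) (w : H ⊗[k] (H ⊗[k] (H ⊗[k] H))) :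
    Q.nestβ (lift2 (lift2 ℓ₁ ℓ₂) (lift2 ℓ₃ ℓ₄) (s ⊗ₜ t) * w)
      = s * Q.nestβ w * Q.flipS t := by
  induction w using induction4 with
  | add w w' hw hw' => simp only [add_mul, mul_add, map_add, hw, hw']
  | tmul a b c d =>
  induction s using induction2 with
  | add s s' hs hs' => simp only [add_mul, map_add, add_tmul, hs, hs']
  | tmul x y =>
  induction t using induction2 with
  | add s s' hs hs' => simp only [add_mul, mul_add, map_add, tmul_add, hs, hs']
  | tmul z w => simp [Q.S_mul, mul_assoc]

/-- `x ⊗ y ↦ (S ⊗ S)(Δᶜᵒᵖ x) * γ * Δ y`. -/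
def evγ : H ⊗[k] H →ₗ[k] H ⊗[k] H :=
  bi (fun x y => Q.SSΔcop x * Q.γ * Q.Δ y)
    (fun _ => by constructor <;> intros <;> simp [add_mul])
    (fun _ => by constructor <;> intros <;> simp [mul_add])

@[simp] lemma evγ_tmul (x y : H) : Q.evγ (x ⊗ₜ y) = Q.SSΔcop x * Q.γ * Q.Δ y := by simp [evγ]

/-- `x ⊗ y ↦ Δ x * δ * (S ⊗ S)(Δᶜᵒᵖ y)`. -/
def coevδ : H ⊗[k] H →ₗ[k] H ⊗[k] H :=
  bi (fun x y => Q.Δ x * Q.δ * Q.SSΔcop y)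
    (fun _ => by constructor <;> intros <;> simp [add_mul])
    (fun _ => by constructor <;> intros <;> simp [mul_add])

@[simp] lemma coevδ_tmul (x y : H) : Q.coevδ (x ⊗ₜ y) = Q.Δ x * Q.δ * Q.SSΔcop y := by
  simp [coevδ]

/-- The nested pairs collapse from the inside out. Thus γ plays for (S ⊗ S)Δᶜᵒᵖ and Δ the part that
α plays for S and the identity; `coevδ_Δ` says the same of δ and β. -/
lemma evγ_Δ (h : H) : Q.evγ (Q.Δ h) = Q.ε h • Q.γ := by
  have e : ∀ t, Q.evγ t = Q.nestα (Q.wordα * lift2 (ℓ₁ ◇ ℓ₂) (ℓ₃ ◇ ℓ₄) t) := fun t => by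
    induction t using induction2 with
    | add s t hs ht => rw [map_add, hs, ht, map_add, mul_add, map_add]
    | tmul x y =>
      have := Q.nestα_mul (Q.Δ x) (Q.Δ y) Q.wordα
      rw [lift2_tmul] at this ⊢
      exact (evγ_tmul Q x y).trans this.symm
  have h₁ := Q.wordα_intertwine ℓ₁ ℓ₂ ℓ₃ ℓ₄ h
  have h₃ := Q.leftEq_nestα_inner.conv_left (δ := Q.Δ) (v := ℓ₄)
  rw [Q.conv_counit_left] at h₃
  have h₂ := h₃.conv_right (δ := Q.Δ) (u := ℓ₁)
  rw [e, ← conv_apply, wordα_eq, h₁, h₂, Q.leftEq_nestα_outer, Q.counit_mul, map_smul, γ, wordα_eq]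

lemma coevδ_Δ (h : H) : Q.coevδ (Q.Δ h) = Q.ε h • Q.δ := by
  have e : ∀ t, Q.coevδ t = Q.nestβ (lift2 (ℓ₁ ◇ ℓ₂) (ℓ₃ ◇ ℓ₄) t * Q.wordβ) := fun t => by
    induction t using induction2 with
    | add s t hs ht => rw [map_add, hs, ht, map_add, add_mul, map_add]
    | tmul x y =>
      have := Q.nestβ_mul (Q.Δ x) (Q.Δ y) Q.wordβ
      rw [lift2_tmul] at this ⊢
      exact (coevδ_tmul Q x y).trans this.symm
  have h₁ := Q.wordβ_intertwine ℓ₁ ℓ₂ ℓ₃ ℓ₄ h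
  have h₃ := Q.rightEq_nestβ_inner.conv_right (δ := Q.Δ) (u := ℓ₁)
  rw [Q.conv_counit_right] at h₃
  have h₂ := h₃.conv_left (δ := Q.Δ) (v := ℓ₄)
  rw [e, ← conv_apply, wordβ_eq, ← h₁, h₂, Q.rightEq_nestβ_outer, Q.mul_counit, map_smul, δ_eq,
    wordβ_eq]

end Legs4

end QuasiHopfAlgebra
end Twist

/-! ### The Drinfeld twist and its inverse -/

section Twist

variable {k H : Type*} [Field k] [Ring H] [Algebra k H]

namespace QuasiHopfAlgebra

variable (Q : QuasiHopfAlgebra k H)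

local infixl:75 " ◇ " => conv (QuasiBialgebra.Δ (QuasiHopfAlgebra.toQuasiBialgebra Q))
local notation "Φ(" u "," v "," w ")" =>
  lift3 u v w (Units.val (QuasiBialgebra.Φ (QuasiHopfAlgebra.toQuasiBialgebra Q)))
local notation "Φ⁻(" u "," v "," w ")" =>
  lift3 u v w (Units.val (Inv.inv (QuasiBialgebra.Φ (QuasiHopfAlgebra.toQuasiBialgebra Q))))

section MapLegs

variable {R R' X X' : Type*} [Ring R] [Algebra k R] [Ring R'] [Algebra k R']
  [AddCommGroup X] [Module k X] [AddCommGroup X'] [Module k X']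
  {N : R →ₗ[k] X} {N' : R' →ₗ[k] X'} {u v : H →ₐ[k] R} {u' v' : H →ₐ[k] R'} [Comm u v] [Comm u' v']

lemma LeftEq.inl_map (h : LeftEq N (u ◇ v) (Q.counit R)) :
    LeftEq (TensorProduct.map N N') (inl.comp u ◇ inl.comp v) (Q.counit (R ⊗[k] R')) := by
  intro x r
  rw [← comp_conv]
  induction r using induction2 with
  | tmul a b => simpa [Q.counit_mul, smul_tmul'] using congrArg (· ⊗ₜ[k] N' b) (h x a)
  | add s t hs ht => rw [mul_add, mul_add, map_add, map_add, hs, ht]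

lemma LeftEq.inr_map (h : LeftEq N' (u' ◇ v') (Q.counit R')) :
    LeftEq (TensorProduct.map N N') (inr.comp u' ◇ inr.comp v') (Q.counit (R ⊗[k] R')) := by
  intro x r
  rw [← comp_conv]
  induction r using induction2 with
  | tmul a b => simpa [Q.counit_mul] using congrArg (N a ⊗ₜ[k] ·) (h x b)
  | add s t hs ht => rw [mul_add, mul_add, map_add, map_add, hs, ht]

lemma RightEq.inl_map (h : RightEq N (u ◇ v) (Q.counit R)) :
    RightEq (TensorProduct.map N N') (inl.comp u ◇ inl.comp v) (Q.counit (R ⊗[k] R')) := by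
  intro x r
  rw [← comp_conv]
  induction r using induction2 with
  | tmul a b => simpa [Q.mul_counit, smul_tmul'] using congrArg (· ⊗ₜ[k] N' b) (h x a)
  | add s t hs ht => rw [add_mul, add_mul, map_add, map_add, hs, ht]

lemma RightEq.inr_map (h : RightEq N' (u' ◇ v') (Q.counit R')) :
    RightEq (TensorProduct.map N N') (inr.comp u' ◇ inr.comp v') (Q.counit (R ⊗[k] R')) := by
  intro x r
  rw [← comp_conv]
  induction r using induction2 with
  | tmul a b => simpa [Q.mul_counit] using congrArg (N a ⊗ₜ[k] ·) (h x b)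
  | add s t hs ht => rw [add_mul, add_mul, map_add, map_add, hs, ht]

end MapLegs

section Legs6

local notation "ι₁" => (inl : H →ₐ[k] H ⊗[k] (H ⊗[k] H))
local notation "ι₂" => AlgHom.comp (inr : _ →ₐ[k] H ⊗[k] (H ⊗[k] H)) inl
local notation "ι₃" => AlgHom.comp (inr : _ →ₐ[k] H ⊗[k] (H ⊗[k] H)) inr
local notation "jl" =>
  (inl : H ⊗[k] (H ⊗[k] H) →ₐ[k] (H ⊗[k] (H ⊗[k] H)) ⊗[k] (H ⊗[k] (H ⊗[k] H)))
local notation "jr" =>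
  (inr : H ⊗[k] (H ⊗[k] H) →ₐ[k] (H ⊗[k] (H ⊗[k] H)) ⊗[k] (H ⊗[k] (H ⊗[k] H)))
local notation "la" => AlgHom.comp jr ι₁
local notation "lb" => AlgHom.comp jl ι₁
local notation "lc" => AlgHom.comp jl ι₂
local notation "ld" => AlgHom.comp jr ι₂
local notation "le" => AlgHom.comp jr ι₃
local notation "lf" => AlgHom.comp jl ι₃

lemma lift3_legs (t : H ⊗[k] (H ⊗[k] H)) : lift3 ι₁ ι₂ ι₃ t = t := by
  induction t using induction3 with
  | tmul a b c => simp
  | add s t hs ht => rw [map_add, hs, ht]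

lemma zigzag_map_words (x y z : H ⊗[k] H) (v w : H ⊗[k] (H ⊗[k] (H ⊗[k] H))) :
    TensorProduct.map Q.zigzag Q.zigzag (lift2 la (lift3 lb lc ld) v *
      (lift2 la lb x * (lift2 lc ld y * lift2 le lf z)) * lift2 lc (lift3 ld le lf) w)
      = Q.flipS x * Q.nestα v * y * Q.nestβ w * Q.flipS z := by
  induction v using induction4 with
  | add v v' hv hv' => simp only [map_add, add_mul, mul_add, hv, hv']
  | tmul a b c d =>
  induction w using induction4 with
  | add v v' hv hv' => simp only [map_add, add_mul, mul_add, hv, hv']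
  | tmul a b c d =>
  induction x using induction2 with
  | add v v' hv hv' => simp only [map_add, add_mul, mul_add, hv, hv']
  | tmul x x' =>
  induction y using induction2 with
  | add v v' hv hv' => simp only [map_add, add_mul, mul_add, hv, hv']
  | tmul y y' =>
  induction z using induction2 with
  | add v v' hv hv' => simp only [map_add, add_mul, mul_add, hv, hv']
  | tmul z z' => simp [Q.S_mul, mul_assoc]

/-- `x ⊗ y ⊗ z ↦ (S ⊗ S)(Δᶜᵒᵖ x) * γ * Δ y * δ * (S ⊗ S)(Δᶜᵒᵖ z)`. -/
def zigzagΔ : H ⊗[k] (H ⊗[k] H) →ₗ[k] H ⊗[k] H :=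
  tri (fun x y z => Q.SSΔcop x * Q.γ * Q.Δ y * Q.δ * Q.SSΔcop z)
    (fun _ _ => by constructor <;> intros <;> simp [add_mul])
    (fun _ _ => by constructor <;> intros <;> simp [mul_add, add_mul])
    (fun _ _ => by constructor <;> intros <;> simp [mul_add])

@[simp] lemma zigzagΔ_tmul (x y z : H) : Q.zigzagΔ (x ⊗ₜ (y ⊗ₜ z))
    = Q.SSΔcop x * Q.γ * Q.Δ y * Q.δ * Q.SSΔcop z := by simp [zigzagΔ]

/-- The six legs are distributed over two tensor cubes, b, c, f in the first and a, d, e in the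
second. The expression is then the nested word, and `nested_zigzag` splits it into one ordinary
zigzag in each cube. -/
lemma zigzagΔ_Φ : Q.zigzagΔ Q.Φ⁻¹.val = 1 := by
  have e : ∀ t, Q.zigzagΔ t = TensorProduct.map Q.zigzag Q.zigzag
      (lift2 la (lift3 lb lc ld) Q.wordα * lift3 (la ◇ lb) (lc ◇ ld) (le ◇ lf) t *
        lift2 lc (lift3 ld le lf) Q.wordβ) := fun t => by
    induction t using induction3 with
    | add s t hs ht => rw [map_add, hs, ht, map_add, mul_add, add_mul, map_add]
    | tmul x y z =>
      have h := Q.zigzag_map_words (Q.Δ x) (Q.Δ y) (Q.Δ z) Q.wordα Q.wordβ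
      rw [lift2_tmul, lift2_tmul]
      exact (zigzagΔ_tmul Q x y z).trans h.symm
  rw [e, lift4_wordα, lift4_wordβ, nested_zigzag Q.toQuasiBialgebra la lb lc ld le lf _
    (LeftEq.inl_map Q Q.leftEq_zigzag) (LeftEq.inr_map Q Q.leftEq_zigzag)
    (RightEq.inr_map Q Q.rightEq_zigzag) (RightEq.inl_map Q Q.rightEq_zigzag)]
  have h₃ : ∀ t, lift3 la ld le t = jr t := fun t => by
    induction t using induction3 with
    | tmul a b c => simp
    | add s t hs ht => rw [map_add, hs, ht, map_add]
  have h₄ : ∀ t, lift3 lb lc lf t = jl t := fun t => by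
    induction t using induction3 with
    | tmul a b c => simp
    | add s t hs ht => rw [map_add, hs, ht, map_add]
  rw [h₃, h₄]
  simp only [Algebra.TensorProduct.includeLeft_apply, Algebra.TensorProduct.includeRight_apply,
    Algebra.TensorProduct.tmul_mul_tmul, one_mul, mul_one, TensorProduct.map_tmul, Q.zigzag_Φ]
  rfl

end Legs6

section Twist

local notation "ι₁" => (inl : H →ₐ[k] H ⊗[k] (H ⊗[k] H))
local notation "ι₂" => AlgHom.comp (inr : _ →ₐ[k] H ⊗[k] (H ⊗[k] H)) inl
local notation "ι₃" => AlgHom.comp (inr : _ →ₐ[k] H ⊗[k] (H ⊗[k] H)) inr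

/-- `x ⊗ y ⊗ z ↦ Δ (S x * α * y) * δ * (S ⊗ S)(Δᶜᵒᵖ z)`. -/
def twistInvMap : H ⊗[k] (H ⊗[k] H) →ₗ[k] H ⊗[k] H :=
  tri (fun x₁ x₂ x₃ => Q.Δ (Q.S x₁ * Q.α * x₂) * Q.δ * Q.SSΔcop x₃)
    (fun _ _ => by constructor <;> intros <;> simp [add_mul])
    (fun _ _ => by constructor <;> intros <;> simp [mul_add, add_mul])
    (fun _ _ => by constructor <;> intros <;> simp [mul_add])

@[simp] lemma twistInvMap_tmul (x y z : H) : Q.twistInvMap (x ⊗ₜ (y ⊗ₜ z))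
    = Q.Δ (Q.S x * Q.α * y) * Q.δ * Q.SSΔcop z := by simp [twistInvMap]

lemma twistInv_eq : Q.twistInv = Q.twistInvMap Q.Φ⁻¹.val := rfl

lemma leftEq_twistInvMap : LeftEq Q.twistInvMap (ι₁ ◇ ι₂) (Q.counit _) := by
  refine leftEq_counit _ Q.evα Q.α Q.evα_Δ fun r => ?_
  induction r using induction3 with
  | tmul a b c =>
    refine ⟨fun z => Q.Δ (Q.S a * z * b) * Q.δ * Q.SSΔcop c, ?_, fun x y => ?_⟩
    · constructor <;> intros <;> simp [mul_add, add_mul]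
    · simp [Q.S_mul, mul_assoc]
  | add s t hs ht =>
    obtain ⟨f, hf, hf'⟩ := hs
    obtain ⟨g, hg, hg'⟩ := ht
    exact ⟨fun z => f z + g z, (hf.mk' f + hg.mk' g).isLinear, fun x y => by
      simp only [mul_add, map_add, hf', hg']⟩

lemma rightEq_twistInvMap : RightEq Q.twistInvMap (ι₂ ◇ ι₃) (Q.counit _) := by
  refine rightEq_counit _ Q.coevδ Q.δ Q.coevδ_Δ fun r => ?_
  induction r using induction3 with
  | tmul a b c =>
    refine ⟨fun z => Q.Δ (Q.S a * Q.α * b) * z * Q.SSΔcop c, ?_, fun x y => ?_⟩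
    · constructor <;> intros <;> simp [mul_add, add_mul]
    · simp [Q.SSΔcop_mul, mul_assoc]
  | add s t hs ht =>
    obtain ⟨f, hf, hf'⟩ := hs
    obtain ⟨g, hg, hg'⟩ := ht
    exact ⟨fun z => f z + g z, (hf.mk' f + hg.mk' g).isLinear, fun x y => by
      simp only [add_mul, map_add, hf', hg']⟩

/-- Apply the contraction defining f⁻¹ to the relation between Φ⁻¹ and the two bracketings of the
iterated coproduct of h. On one side α absorbs the first two legs, leaving h on the third; on the
other δ absorbs the last two, leaving h on the first. -/
lemma Δ_S_mul_twistInv (h : H) : Q.Δ (Q.S h) * Q.twistInv = Q.twistInv * Q.SSΔcop h := by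
  have h₁ : ∀ t, Q.twistInvMap (t * ι₁ h) = Q.Δ (Q.S h) * Q.twistInvMap t := fun t => by
    induction t using induction3 with
    | tmul a b c => simp [Q.S_mul, mul_assoc]
    | add s t hs ht => rw [add_mul, map_add, hs, ht, map_add, mul_add]
  have h₂ : ∀ t, Q.twistInvMap (ι₃ h * t) = Q.twistInvMap t * Q.SSΔcop h := fun t => by
    induction t using induction3 with
    | tmul a b c => simp [Q.SSΔcop_mul, mul_assoc]
    | add s t hs ht => rw [mul_add, map_add, hs, ht, map_add, add_mul]
  have e := congrArg Q.twistInvMap (Q.Φ_intertwine_inv ι₁ ι₂ ι₃ h)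
  have l := Q.leftEq_twistInvMap.conv_left (δ := Q.Δ) (v := ι₃)
  have r := Q.rightEq_twistInvMap.conv_right (δ := Q.Δ) (u := ι₁)
  rw [Q.conv_counit_left] at l
  rw [Q.conv_counit_right] at r
  rw [l, r, h₁, h₂, lift3_legs] at e
  exact e.symm

/-- `x ⊗ y ⊗ z ↦ (S ⊗ S)(Δᶜᵒᵖ x) * γ * Δ (y * β * S z)`. -/
def twistMap : H ⊗[k] (H ⊗[k] H) →ₗ[k] H ⊗[k] H :=
  tri (fun x y z => Q.SSΔcop x * Q.γ * Q.Δ (y * Q.β * Q.S z))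
    (fun _ _ => by constructor <;> intros <;> simp [add_mul])
    (fun _ _ => by constructor <;> intros <;> simp [mul_add, add_mul])
    (fun _ _ => by constructor <;> intros <;> simp [mul_add])

@[simp] lemma twistMap_tmul (x y z : H) : Q.twistMap (x ⊗ₜ (y ⊗ₜ z))
    = Q.SSΔcop x * Q.γ * Q.Δ (y * Q.β * Q.S z) := by simp [twistMap]

/-- The Drinfeld twist `f`. -/
def twist : H ⊗[k] H := Q.twistMap Q.Φ⁻¹.val

lemma leftEq_twistMap : LeftEq Q.twistMap (ι₁ ◇ ι₂) (Q.counit _) := by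
  refine leftEq_counit _ Q.evγ Q.γ Q.evγ_Δ fun r => ?_
  induction r using induction3 with
  | tmul a b c =>
    refine ⟨fun z => Q.SSΔcop a * z * Q.Δ (b * Q.β * Q.S c), ?_, fun x y => ?_⟩
    · constructor <;> intros <;> simp [mul_add, add_mul]
    · simp [Q.SSΔcop_mul, mul_assoc]
  | add s t hs ht =>
    obtain ⟨f, hf, hf'⟩ := hs
    obtain ⟨g, hg, hg'⟩ := ht
    exact ⟨fun z => f z + g z, (hf.mk' f + hg.mk' g).isLinear, fun x y => by
      simp only [mul_add, map_add, hf', hg']⟩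

lemma rightEq_twistMap : RightEq Q.twistMap (ι₂ ◇ ι₃) (Q.counit _) := by
  refine rightEq_counit _ Q.coevβ Q.β Q.coevβ_Δ fun r => ?_
  induction r using induction3 with
  | tmul a b c =>
    refine ⟨fun z => Q.SSΔcop a * Q.γ * Q.Δ (b * z * Q.S c), ?_, fun x y => ?_⟩
    · constructor <;> intros <;> simp [mul_add, add_mul]
    · simp [Q.S_mul, mul_assoc]
  | add s t hs ht =>
    obtain ⟨f, hf, hf'⟩ := hs
    obtain ⟨g, hg, hg'⟩ := ht
    exact ⟨fun z => f z + g z, (hf.mk' f + hg.mk' g).isLinear, fun x y => by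
      simp only [add_mul, map_add, hf', hg']⟩

/-- The argument of `Δ_S_mul_twistInv`, with γ absorbing the first two legs and β the last two. -/
lemma twist_mul_Δ_S (h : H) : Q.twist * Q.Δ (Q.S h) = Q.SSΔcop h * Q.twist := by
  have h₁ : ∀ t, Q.twistMap (t * ι₁ h) = Q.SSΔcop h * Q.twistMap t := fun t => by
    induction t using induction3 with
    | tmul a b c => simp [Q.SSΔcop_mul, mul_assoc]
    | add s t hs ht => rw [add_mul, map_add, hs, ht, map_add, mul_add]
  have h₂ : ∀ t, Q.twistMap (ι₃ h * t) = Q.twistMap t * Q.Δ (Q.S h) := fun t => by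
    induction t using induction3 with
    | tmul a b c => simp [Q.S_mul, mul_assoc]
    | add s t hs ht => rw [mul_add, map_add, hs, ht, map_add, add_mul]
  have e := congrArg Q.twistMap (Q.Φ_intertwine_inv ι₁ ι₂ ι₃ h)
  have l := Q.leftEq_twistMap.conv_left (δ := Q.Δ) (v := ι₃)
  have r := Q.rightEq_twistMap.conv_right (δ := Q.Δ) (u := ι₁)
  rw [Q.conv_counit_left] at l
  rw [Q.conv_counit_right] at r
  rw [l, r, h₁, h₂, lift3_legs] at e
  exact e

end Twist

section Legs4

local notation "ℓ₁" => (inl : H →ₐ[k] H ⊗[k] (H ⊗[k] (H ⊗[k] H)))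
local notation "ℓ₂" => AlgHom.comp (inr : _ →ₐ[k] H ⊗[k] (H ⊗[k] (H ⊗[k] H))) inl
local notation "ℓ₃" => AlgHom.comp (inr : _ →ₐ[k] H ⊗[k] (H ⊗[k] (H ⊗[k] H))) (AlgHom.comp inr inl)
local notation "ℓ₄" => AlgHom.comp (inr : _ →ₐ[k] H ⊗[k] (H ⊗[k] (H ⊗[k] H))) (AlgHom.comp inr inr)

/-- `x ⊗ y ⊗ z ⊗ w ↦ (S ⊗ S)(Δᶜᵒᵖ x) * γ * Δ (y * β * S z * α * w)`. -/
def twistαMap : H ⊗[k] (H ⊗[k] (H ⊗[k] H)) →ₗ[k] H ⊗[k] H :=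
  quad (fun x y z w => Q.SSΔcop x * Q.γ * Q.Δ (y * Q.β * Q.S z * Q.α * w))
    (fun _ _ _ => by constructor <;> intros <;> simp [add_mul])
    (fun _ _ _ => by constructor <;> intros <;> simp [mul_add, add_mul])
    (fun _ _ _ => by constructor <;> intros <;> simp [mul_add, add_mul])
    (fun _ _ _ => by constructor <;> intros <;> simp [mul_add])

@[simp] lemma twistαMap_tmul (x y z w : H) : Q.twistαMap (x ⊗ₜ (y ⊗ₜ (z ⊗ₜ w)))
    = Q.SSΔcop x * Q.γ * Q.Δ (y * Q.β * Q.S z * Q.α * w) := by simp [twistαMap]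

lemma leftEq_twistαMap₁ : LeftEq Q.twistαMap (ℓ₁ ◇ ℓ₂) (Q.counit _) := by
  refine leftEq_counit _ Q.evγ Q.γ Q.evγ_Δ fun r => ?_
  induction r using induction4 with
  | tmul a b c d =>
    refine ⟨fun z => Q.SSΔcop a * z * Q.Δ (b * Q.β * Q.S c * Q.α * d), ?_, fun x y => ?_⟩
    · constructor <;> intros <;> simp [mul_add, add_mul]
    · simp [Q.SSΔcop_mul, mul_assoc]
  | add s t hs ht =>
    obtain ⟨f, hf, hf'⟩ := hs
    obtain ⟨g, hg, hg'⟩ := ht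
    exact ⟨fun z => f z + g z, (hf.mk' f + hg.mk' g).isLinear, fun x y => by
      simp only [mul_add, map_add, hf', hg']⟩

lemma leftEq_twistαMap₃ : LeftEq Q.twistαMap (ℓ₃ ◇ ℓ₄) (Q.counit _) := by
  refine leftEq_counit _ Q.evα Q.α Q.evα_Δ fun r => ?_
  induction r using induction4 with
  | tmul a b c d =>
    refine ⟨fun z => Q.SSΔcop a * Q.γ * Q.Δ (b * Q.β * Q.S c * z * d), ?_, fun x y => ?_⟩
    · constructor <;> intros <;> simp [mul_add, add_mul]
    · simp [Q.S_mul, mul_assoc]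
  | add s t hs ht =>
    obtain ⟨f, hf, hf'⟩ := hs
    obtain ⟨g, hg, hg'⟩ := ht
    exact ⟨fun z => f z + g z, (hf.mk' f + hg.mk' g).isLinear, fun x y => by
      simp only [mul_add, map_add, hf', hg']⟩

lemma rightEq_twistαMap : RightEq Q.twistαMap (ℓ₂ ◇ ℓ₃) (Q.counit _) := by
  refine rightEq_counit _ Q.coevβ Q.β Q.coevβ_Δ fun r => ?_
  induction r using induction4 with
  | tmul a b c d =>
    refine ⟨fun z => Q.SSΔcop a * Q.γ * Q.Δ (b * z * Q.S c * Q.α * d), ?_, fun x y => ?_⟩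
    · constructor <;> intros <;> simp [mul_add, add_mul]
    · simp [Q.S_mul, mul_assoc]
  | add s t hs ht =>
    obtain ⟨f, hf, hf'⟩ := hs
    obtain ⟨g, hg, hg'⟩ := ht
    exact ⟨fun z => f z + g z, (hf.mk' f + hg.mk' g).isLinear, fun x y => by
      simp only [add_mul, map_add, hf', hg']⟩

/-- Once the pentagon is solved, only one factor survives the collapses, and it contributes
X¹βS(X²)αX³ = 1. -/
lemma twist_mul_Δ_α : Q.twist * Q.Δ Q.α = Q.γ := by
  have h₁ : ∀ t, Q.twistαMap (lift3 ℓ₁ ℓ₂ ℓ₃ t) = Q.twistMap t * Q.Δ Q.α := fun t => by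
    induction t using induction3 with
    | tmul a b c => simp [mul_assoc]
    | add s t hs ht => rw [map_add, map_add, hs, ht, map_add, add_mul]
  have h₂ : ∀ t, Q.twistαMap (lift3 ℓ₂ ℓ₃ ℓ₄ t) = Q.γ * Q.Δ (tri
      (fun X₁ X₂ X₃ => X₁ * Q.β * Q.S X₂ * Q.α * X₃)
      (fun _ _ => by constructor <;> intros <;> simp [add_mul])
      (fun _ _ => by constructor <;> intros <;> simp [mul_add, add_mul])
      (fun _ _ => by constructor <;> intros <;> simp [mul_add]) t) := fun t => by
    induction t using induction3 with
    | tmul a b c => simp [mul_assoc, Q.SSΔcop_one]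
    | add s t hs ht => rw [map_add, map_add, hs, ht, map_add, map_add, mul_add]
  -- Each of the three factors with a convolved leg has it at a pair that collapses: ℓ₂ ◇ ℓ₃ by β
  -- from the right, ℓ₁ ◇ ℓ₂ by γ and ℓ₃ ◇ ℓ₄ by α from the left.
  have e : Φ⁻(ℓ₁, ℓ₂, ℓ₃) = Φ⁻(ℓ₁ ◇ ℓ₂, ℓ₃, ℓ₄) * Φ⁻(ℓ₁, ℓ₂, ℓ₃ ◇ ℓ₄) * Φ(ℓ₂, ℓ₃, ℓ₄)
      * Φ(ℓ₁, ℓ₂ ◇ ℓ₃, ℓ₄) :=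
    congrArg Units.val (pentagon_solve (Q.Φ_pentagon ℓ₁ ℓ₂ ℓ₃ ℓ₄))
  rw [twist, ← h₁, e, Q.rightEq_twistαMap.snd, Q.Φ_counit_mid, mul_one, mul_assoc,
    Q.leftEq_twistαMap₁.fst, lift3_inv_eq_one _ _ _ (Q.Φ_counit_left _ _), one_mul,
    Q.leftEq_twistαMap₃.trd, lift3_inv_eq_one _ _ _ (Q.Φ_counit_right _ _), one_mul, h₂,
    Q.Φ_β_α, map_one, mul_one]

end Legs4

/-- Pushing f through Δ(S(x¹)αx²) turns it into (S ⊗ S)(Δᶜᵒᵖ x¹)γΔ(x²), and the zigzag for γ and δ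
remains. This one-sided inverse is all that is needed below. -/
lemma twist_mul_twistInv : Q.twist * Q.twistInv = 1 := by
  have h : ∀ t, Q.twist * Q.twistInvMap t = Q.zigzagΔ t := fun t => by
    induction t using induction3 with
    | tmul a b c =>
      rw [twistInvMap_tmul, zigzagΔ_tmul, map_mul, map_mul, ← Q.twist_mul_Δ_α]
      simp only [← mul_assoc, ← Q.twist_mul_Δ_S]
    | add s t hs ht => rw [map_add, mul_add, hs, ht, map_add]
  rw [twistInv_eq, h, zigzagΔ_Φ]

/-- Write γ = fΔ(α) and carry Δ(α) = Δ(S(S⁻¹α)) across f⁻¹; then ff⁻¹ cancels. -/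
lemma γ_mul_twistInv : Q.γ * Q.twistInv = Q.SSΔcop (Q.Sinv Q.α) := by
  have h := Q.Δ_S_mul_twistInv (Q.Sinv Q.α)
  rw [LinearEquiv.apply_symm_apply] at h
  rw [← Q.twist_mul_Δ_α, mul_assoc, h, ← mul_assoc, Q.twist_mul_twistInv, one_mul]

lemma Δ_mul_twistInv (h : H) : Q.Δ h * Q.twistInv = Q.twistInv * Q.SSΔcop (Q.Sinv h) := by
  rw [← Q.Δ_S_mul_twistInv, LinearEquiv.apply_symm_apply]

end QuasiHopfAlgebra
end Twist

/-! ### The elements p̃ and q̃ and their relations -/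

section LeftCoaction

variable {k H A : Type*} [Field k] [Ring H] [Algebra k H] [Ring A] [Algebra k A]
  {Q : QuasiHopfAlgebra k H} (B : BicomoduleAlgebra Q.toQuasiBialgebra A)

local infixl:75 " ◇ " => conv (QuasiBialgebra.Δ (QuasiHopfAlgebra.toQuasiBialgebra Q))
local infixl:75 " ◁ " => conv (BicomoduleAlgebra.lam B)
local notation "Φ(" u "," v "," w ")" =>
  lift3 u v w (Units.val (QuasiBialgebra.Φ (QuasiHopfAlgebra.toQuasiBialgebra Q)))
local notation "Φ⁻(" u "," v "," w ")" =>
  lift3 u v w (Units.val (Inv.inv (QuasiBialgebra.Φ (QuasiHopfAlgebra.toQuasiBialgebra Q))))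
local notation "Ψ(" u "," v "," w ")" => lift3 u v w (Units.val (BicomoduleAlgebra.Φl B))
local notation "Ψ⁻(" u "," v "," w ")" =>
  lift3 u v w (Units.val (Inv.inv (BicomoduleAlgebra.Φl B)))

variable (Q) in
/-- `x ⊗ y ⊗ a ↦ S x * α * y ⊗ a`. -/
def qMap (A : Type*) [Ring A] [Algebra k A] : H ⊗[k] (H ⊗[k] A) →ₗ[k] H ⊗[k] A :=
  tri (fun x₁ x₂ x₃ => (Q.S x₁ * Q.α * x₂) ⊗ₜ[k] x₃)
    (fun _ _ => by constructor <;> intros <;> simp [add_mul, add_tmul, smul_tmul'])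
    (fun _ _ => by constructor <;> intros <;> simp [mul_add, add_tmul, smul_tmul'])
    (fun _ _ => by constructor <;> intros <;> simp [tmul_add])

@[simp] lemma qMap_tmul (x y : H) (a : A) :
    qMap Q A (x ⊗ₜ (y ⊗ₜ a)) = (Q.S x * Q.α * y) ⊗ₜ[k] a := by simp [qMap]

lemma qElt_eq : qElt B = qMap Q A B.Φl⁻¹.val := rfl

variable (Q) in
/-- `x ⊗ y ⊗ a ↦ y * S⁻¹ (x * β) ⊗ a`. -/
def pMap (A : Type*) [Ring A] [Algebra k A] : H ⊗[k] (H ⊗[k] A) →ₗ[k] H ⊗[k] A :=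
  tri (fun x₁ x₂ x₃ => (x₂ * Q.Sinv (x₁ * Q.β)) ⊗ₜ[k] x₃)
    (fun _ _ => by constructor <;> intros <;> simp [mul_add, add_mul, add_tmul, smul_tmul'])
    (fun _ _ => by constructor <;> intros <;> simp [add_mul, add_tmul, smul_tmul'])
    (fun _ _ => by constructor <;> intros <;> simp [tmul_add])

@[simp] lemma pMap_tmul (x y : H) (a : A) :
    pMap Q A (x ⊗ₜ (y ⊗ₜ a)) = (y * Q.Sinv (x * Q.β)) ⊗ₜ[k] a := by simp [pMap]

/-- The element `p̃ = X² S⁻¹(X¹ β) ⊗ X³` of `H ⊗ A`, where `X = Φ_λ`. -/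
def pElt : H ⊗[k] A := pMap Q A B.Φl.val

/-- `h ⊗ a ↦ lam a * w * (S⁻¹ h ⊗ 1)`. -/
def coadj (w : H ⊗[k] A) : H ⊗[k] A →ₗ[k] H ⊗[k] A :=
  bi (fun h a => B.lam a * w * (Q.Sinv h ⊗ₜ 1))
    (fun _ => by constructor <;> intros <;> simp [mul_add, add_tmul, ← smul_tmul'])
    (fun _ => by constructor <;> intros <;> simp [add_mul])

@[simp] lemma coadj_tmul (w : H ⊗[k] A) (h : H) (a : A) :
    coadj B w (h ⊗ₜ a) = B.lam a * w * (Q.Sinv h ⊗ₜ 1) := by simp [coadj]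

/-- `h ⊗ a ↦ (S h ⊗ 1) * w * lam a`. -/
def adj (w : H ⊗[k] A) : H ⊗[k] A →ₗ[k] H ⊗[k] A :=
  bi (fun h a => (Q.S h ⊗ₜ 1) * w * B.lam a)
    (fun _ => by constructor <;> intros <;> simp [add_mul, add_tmul, ← smul_tmul'])
    (fun _ => by constructor <;> intros <;> simp [mul_add])

@[simp] lemma adj_tmul (w : H ⊗[k] A) (h : H) (a : A) :
    adj B w (h ⊗ₜ a) = (Q.S h ⊗ₜ 1) * w * B.lam a := by simp [adj]

section Legs3

local notation "ι₁" => (inl : H →ₐ[k] H ⊗[k] (H ⊗[k] A))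
local notation "ι₂" => AlgHom.comp (inr : _ →ₐ[k] H ⊗[k] (H ⊗[k] A)) inl
local notation "ιₘ" => AlgHom.comp (inr : _ →ₐ[k] H ⊗[k] (H ⊗[k] A)) inr

lemma lift3_legs_left (t : H ⊗[k] (H ⊗[k] A)) : lift3 ι₁ ι₂ ιₘ t = t := by
  induction t using induction3 with
  | tmul a b c => simp
  | add s t hs ht => rw [map_add, hs, ht]

lemma leftEq_qMap : LeftEq (qMap Q A) (ι₁ ◇ ι₂) (Q.counit _) := by
  refine leftEq_counit _ Q.evα Q.α Q.evα_Δ fun r => ?_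
  induction r using induction3 with
  | tmul a b c =>
    refine ⟨fun z => (Q.S a * z * b) ⊗ₜ c, ?_, fun x y => ?_⟩
    · constructor <;> intros <;> simp [mul_add, add_mul, add_tmul, smul_tmul']
    · simp [Q.S_mul, mul_assoc]
  | add s t hs ht =>
    obtain ⟨f, hf, hf'⟩ := hs
    obtain ⟨g, hg, hg'⟩ := ht
    exact ⟨fun z => f z + g z, (hf.mk' f + hg.mk' g).isLinear, fun x y => by
      simp only [mul_add, map_add, hf', hg']⟩

lemma rightEq_pMap : RightEq (pMap Q A) (ι₁ ◇ ι₂) (Q.counit _) := by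
  refine rightEq_counit _ Q.coevβ Q.β Q.coevβ_Δ fun r => ?_
  induction r using induction3 with
  | tmul a b c =>
    refine ⟨fun z => (b * Q.Sinv (a * z)) ⊗ₜ c, ?_, fun x y => ?_⟩
    · constructor <;> intros <;> simp [mul_add, add_tmul, smul_tmul']
    · simp [Q.Sinv_mul, mul_assoc]
  | add s t hs ht =>
    obtain ⟨f, hf, hf'⟩ := hs
    obtain ⟨g, hg, hg'⟩ := ht
    exact ⟨fun z => f z + g z, (hf.mk' f + hg.mk' g).isLinear, fun x y => by
      simp only [add_mul, map_add, hf', hg']⟩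

/-- Contract the intertwining relation of Φ_λ⁻¹ by S(x)αy: one side loses its first two legs. The
mirror relation for p̃ makes `hat r` an A-linear map; this one makes `qOp` compatible. -/
lemma tmul_mul_qElt (u : A) : (1 ⊗ₜ u) * qElt B = adj B (qElt B) (B.lam u) := by
  have h₁ : ∀ t, qMap Q A (ιₘ u * t) = (1 ⊗ₜ u) * qMap Q A t := fun t => by
    induction t using induction3 with
    | tmul a b c => simp
    | add s t hs ht => rw [mul_add, map_add, hs, ht, map_add, mul_add]
  have h₂ : ∀ s t, qMap Q A (t * lift2 ι₁ (ι₂ ◁ ιₘ) s) = adj B (qMap Q A t) s := fun s t => by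
    induction s using induction2 with
    | add s s' hs hs' => rw [map_add, mul_add, map_add, hs, hs', map_add]
    | tmul x a =>
      rw [lift2_tmul, conv_apply, adj_tmul]
      generalize B.lam a = l
      induction l using induction2 with
      | add s s' hs hs' => simp only [map_add, mul_add, hs, hs']
      | tmul y b =>
      induction t using induction3 with
      | tmul a b c => simp [Q.S_mul, mul_assoc]
      | add s t hs ht => simp only [add_mul, map_add, hs, ht, mul_add]
  have l := (leftEq_qMap (Q := Q) (A := A)).conv_left (δ := B.lam) (v := ιₘ)
  rw [B.conv_lam_counit] at l
  have e := congrArg (qMap Q A) (B.Φl_intertwine_inv ι₁ ι₂ ιₘ u)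
  rw [l, h₁, lift3_legs_left, conv_apply, h₂] at e
  exact e

/-- Here the contraction is y S⁻¹(xβ), which absorbs a coproduct from the right because
S⁻¹(h₁βS(h₂)) = h₂S⁻¹(β)S⁻¹(h₁). -/
lemma pElt_mul_tmul (u : A) : pElt B * (1 ⊗ₜ u) = coadj B (pElt B) (B.lam u) := by
  have h₁ : ∀ t, pMap Q A (t * ιₘ u) = pMap Q A t * (1 ⊗ₜ u) := fun t => by
    induction t using induction3 with
    | tmul a b c => simp
    | add s t hs ht => rw [add_mul, map_add, hs, ht, map_add, add_mul]
  have h₂ : ∀ s t, pMap Q A (lift2 ι₁ (ι₂ ◁ ιₘ) s * t) = coadj B (pMap Q A t) s := fun s t => by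
    induction s using induction2 with
    | add s s' hs hs' => rw [map_add, add_mul, map_add, hs, hs', map_add]
    | tmul x a =>
      rw [lift2_tmul, conv_apply, coadj_tmul]
      generalize B.lam a = l
      induction l using induction2 with
      | add s s' hs hs' => simp only [map_add, mul_add, add_mul, hs, hs']
      | tmul y b =>
      induction t using induction3 with
      | tmul a b c => simp [Q.Sinv_mul, mul_assoc]
      | add s t hs ht => simp only [add_mul, map_add, hs, ht, mul_add]
  have r := (rightEq_pMap (Q := Q) (A := A)).conv_left (δ := B.lam) (v := ιₘ)
  rw [B.conv_lam_counit] at r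
  have e := congrArg (pMap Q A) (B.Φl_intertwine ι₁ ι₂ ιₘ u)
  rw [r, h₁, lift3_legs_left, conv_apply, h₂] at e
  exact e.symm

end Legs3

section Legs4

local notation "ℓ₁" => (inl : H →ₐ[k] H ⊗[k] (H ⊗[k] (H ⊗[k] A)))
local notation "ℓ₂" => AlgHom.comp (inr : _ →ₐ[k] H ⊗[k] (H ⊗[k] (H ⊗[k] A))) inl
local notation "ℓ₃" => AlgHom.comp (inr : _ →ₐ[k] H ⊗[k] (H ⊗[k] (H ⊗[k] A))) (AlgHom.comp inr inl)
local notation "ℓₘ" => AlgHom.comp (inr : _ →ₐ[k] H ⊗[k] (H ⊗[k] (H ⊗[k] A))) (AlgHom.comp inr inr)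

variable (Q) in
/-- `x ⊗ y ⊗ z ⊗ a ↦ z * S⁻¹ (S x * α * y * β) ⊗ a`. -/
def pqMap (A : Type*) [Ring A] [Algebra k A] : H ⊗[k] (H ⊗[k] (H ⊗[k] A)) →ₗ[k] H ⊗[k] A :=
  quad (fun x y z a => (z * Q.Sinv (Q.S x * Q.α * y * Q.β)) ⊗ₜ[k] a)
    (fun _ _ _ => by constructor <;> intros <;> simp [mul_add, add_mul, add_tmul, smul_tmul'])
    (fun _ _ _ => by constructor <;> intros <;> simp [mul_add, add_mul, add_tmul, smul_tmul'])
    (fun _ _ _ => by constructor <;> intros <;> simp [add_mul, add_tmul, smul_tmul'])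
    (fun _ _ _ => by constructor <;> intros <;> simp [tmul_add])

@[simp] lemma pqMap_tmul (x y z : H) (a : A) : pqMap Q A (x ⊗ₜ (y ⊗ₜ (z ⊗ₜ a)))
    = (z * Q.Sinv (Q.S x * Q.α * y * Q.β)) ⊗ₜ[k] a := by simp [pqMap]

variable (Q) in
/-- `x ⊗ y ⊗ z ⊗ a ↦ x * β * S y * α * z ⊗ a`. -/
def qpMap (A : Type*) [Ring A] [Algebra k A] : H ⊗[k] (H ⊗[k] (H ⊗[k] A)) →ₗ[k] H ⊗[k] A :=
  quad (fun x y z a => (x * Q.β * Q.S y * Q.α * z) ⊗ₜ[k] a)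
    (fun _ _ _ => by constructor <;> intros <;> simp [add_mul, add_tmul, smul_tmul'])
    (fun _ _ _ => by constructor <;> intros <;> simp [mul_add, add_mul, add_tmul, smul_tmul'])
    (fun _ _ _ => by constructor <;> intros <;> simp [mul_add, add_tmul, smul_tmul'])
    (fun _ _ _ => by constructor <;> intros <;> simp [tmul_add])

@[simp] lemma qpMap_tmul (x y z : H) (a : A) : qpMap Q A (x ⊗ₜ (y ⊗ₜ (z ⊗ₜ a)))
    = (x * Q.β * Q.S y * Q.α * z) ⊗ₜ[k] a := by simp [qpMap]

lemma leftEq_pqMap : LeftEq (pqMap Q A) (ℓ₁ ◇ ℓ₂) (Q.counit _) := by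
  refine leftEq_counit _ Q.evα Q.α Q.evα_Δ fun r => ?_
  induction r using induction4 with
  | tmul a b c d =>
    refine ⟨fun z => (c * Q.Sinv (Q.S a * z * b * Q.β)) ⊗ₜ d, ?_, fun x y => ?_⟩
    · constructor <;> intros <;> simp [mul_add, add_mul, add_tmul, smul_tmul']
    · simp [Q.S_mul, mul_assoc]
  | add s t hs ht =>
    obtain ⟨f, hf, hf'⟩ := hs
    obtain ⟨g, hg, hg'⟩ := ht
    exact ⟨fun z => f z + g z, (hf.mk' f + hg.mk' g).isLinear, fun x y => by
      simp only [mul_add, map_add, hf', hg']⟩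

lemma rightEq_pqMap : RightEq (pqMap Q A) (ℓ₂ ◇ ℓ₃) (Q.counit _) := by
  refine rightEq_counit _ Q.coevβ Q.β Q.coevβ_Δ fun r => ?_
  induction r using induction4 with
  | tmul a b c d =>
    refine ⟨fun z => (c * Q.Sinv (Q.S a * Q.α * b * z)) ⊗ₜ d, ?_, fun x y => ?_⟩
    · constructor <;> intros <;> simp [mul_add, add_tmul, smul_tmul']
    · simp [Q.Sinv_mul, mul_assoc]
  | add s t hs ht =>
    obtain ⟨f, hf, hf'⟩ := hs
    obtain ⟨g, hg, hg'⟩ := ht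
    exact ⟨fun z => f z + g z, (hf.mk' f + hg.mk' g).isLinear, fun x y => by
      simp only [add_mul, map_add, hf', hg']⟩

lemma rightEq_qpMap : RightEq (qpMap Q A) (ℓ₁ ◇ ℓ₂) (Q.counit _) := by
  refine rightEq_counit _ Q.coevβ Q.β Q.coevβ_Δ fun r => ?_
  induction r using induction4 with
  | tmul a b c d =>
    refine ⟨fun z => (a * z * Q.S b * Q.α * c) ⊗ₜ d, ?_, fun x y => ?_⟩
    · constructor <;> intros <;> simp [mul_add, add_mul, add_tmul, smul_tmul']
    · simp [Q.S_mul, mul_assoc]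
  | add s t hs ht =>
    obtain ⟨f, hf, hf'⟩ := hs
    obtain ⟨g, hg, hg'⟩ := ht
    exact ⟨fun z => f z + g z, (hf.mk' f + hg.mk' g).isLinear, fun x y => by
      simp only [add_mul, map_add, hf', hg']⟩

lemma leftEq_qpMap : LeftEq (qpMap Q A) (ℓ₂ ◇ ℓ₃) (Q.counit _) := by
  refine leftEq_counit _ Q.evα Q.α Q.evα_Δ fun r => ?_
  induction r using induction4 with
  | tmul a b c d =>
    refine ⟨fun z => (a * Q.β * Q.S b * z * c) ⊗ₜ d, ?_, fun x y => ?_⟩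
    · constructor <;> intros <;> simp [mul_add, add_mul, add_tmul, smul_tmul']
    · simp [Q.S_mul, mul_assoc]
  | add s t hs ht =>
    obtain ⟨f, hf, hf'⟩ := hs
    obtain ⟨g, hg, hg'⟩ := ht
    exact ⟨fun z => f z + g z, (hf.mk' f + hg.mk' g).isLinear, fun x y => by
      simp only [mul_add, map_add, hf', hg']⟩

/-- The pentagon rewrites the product of the two reassociators in q̃ and p̃ as three factors. The
outer two collapse and the middle one is the zigzag S(x¹)αx²βS(x³) = 1. This gives `qOp ∘ hat r =
r`. -/
lemma coadj_pElt_qElt : coadj B (pElt B) (qElt B) = 1 := by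
  have h₁ : ∀ s t, pqMap Q A (lift3 ℓ₁ ℓ₂ (ℓ₃ ◁ ℓₘ) s * lift3 ℓ₂ ℓ₃ ℓₘ t)
      = coadj B (pMap Q A t) (qMap Q A s) := fun s t => by
    induction s using induction3 with
    | add s s' hs hs' => simp only [map_add, add_mul, hs, hs']
    | tmul x y a =>
      rw [lift2_tmul, lift2_tmul, conv_apply, qMap_tmul, coadj_tmul]
      generalize B.lam a = l
      induction l using induction2 with
      | add s s' hs hs' => simp only [map_add, mul_add, add_mul, hs, hs']
      | tmul y b =>
      induction t using induction3 with
      | tmul a b c => simp [Q.Sinv_mul, mul_assoc]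
      | add s t hs ht => simp only [map_add, hs, ht, mul_add, add_mul]
  have h₂ : ∀ t, pqMap Q A (lift3 ℓ₁ ℓ₂ ℓ₃ t) = Q.Sinv (Q.zigzag t) ⊗ₜ[k] (1 : A) := fun t => by
    induction t using induction3 with
    | tmul a b c => simp [Q.Sinv_mul, mul_assoc]
    | add s t hs ht => rw [map_add, map_add, hs, ht, map_add, map_add, add_tmul]
  have e : Ψ⁻(ℓ₁, ℓ₂, ℓ₃ ◁ ℓₘ) * Ψ(ℓ₂, ℓ₃, ℓₘ)
      = Ψ(ℓ₁ ◇ ℓ₂, ℓ₃, ℓₘ) * Φ⁻(ℓ₁, ℓ₂, ℓ₃) * Ψ⁻(ℓ₁, ℓ₂ ◇ ℓ₃, ℓₘ) :=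
    congrArg Units.val (pentagon_inv_left (B.Φl_pentagon ℓ₁ ℓ₂ ℓ₃ ℓₘ))
  rw [pElt, qElt_eq, ← h₁, e, rightEq_pqMap.snd,
    lift3_inv_eq_one _ _ _ (B.Φl_counit_mid' _ _), mul_one, leftEq_pqMap.fst,
    B.Φl_counit_left', one_mul, h₂, Q.zigzag_Φ, Q.Sinv_one]
  rfl

/-- As for `coadj_pElt_qElt`, but the surviving factor is the other zigzag X¹βS(X²)αX³ = 1. This
gives that the hat of `qOp` is the identity. -/
lemma adj_qElt_pElt : adj B (qElt B) (pElt B) = 1 := by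
  have h₁ : ∀ s t, qpMap Q A (lift3 ℓ₂ ℓ₃ ℓₘ s * lift3 ℓ₁ ℓ₂ (ℓ₃ ◁ ℓₘ) t)
      = adj B (qMap Q A s) (pMap Q A t) := fun s t => by
    induction t using induction3 with
    | add s s' hs hs' => simp only [map_add, mul_add, hs, hs']
    | tmul x y a =>
      simp only [lift2_tmul, conv_apply, pMap_tmul, adj_tmul]
      generalize B.lam a = l
      induction l using induction2 with
      | add s s' hs hs' => simp only [map_add, mul_add, hs, hs']
      | tmul y b =>
      induction s using induction3 with
      | tmul a b c => simp [Q.S_mul, Q.Sinv_mul, mul_assoc]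
      | add s t hs ht => simp only [map_add, hs, ht, mul_add, add_mul]
  have h₂ : ∀ t, qpMap Q A (lift3 ℓ₁ ℓ₂ ℓ₃ t) = (tri
      (fun X₁ X₂ X₃ => X₁ * Q.β * Q.S X₂ * Q.α * X₃)
      (fun _ _ => by constructor <;> intros <;> simp [add_mul])
      (fun _ _ => by constructor <;> intros <;> simp [mul_add, add_mul])
      (fun _ _ => by constructor <;> intros <;> simp [mul_add]) t) ⊗ₜ[k] (1 : A) := fun t => by
    induction t using induction3 with
    | tmul a b c => simp
    | add s t hs ht => rw [map_add, map_add, hs, ht, map_add, add_tmul]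
  have e : Ψ⁻(ℓ₂, ℓ₃, ℓₘ) * Ψ(ℓ₁, ℓ₂, ℓ₃ ◁ ℓₘ)
      = Ψ(ℓ₁, ℓ₂ ◇ ℓ₃, ℓₘ) * Φ(ℓ₁, ℓ₂, ℓ₃) * Ψ⁻(ℓ₁ ◇ ℓ₂, ℓ₃, ℓₘ) :=
    congrArg Units.val (pentagon_inv_right (B.Φl_pentagon ℓ₁ ℓ₂ ℓ₃ ℓₘ))
  rw [pElt, qElt_eq, ← h₁, e, rightEq_qpMap.fst,
    lift3_inv_eq_one _ _ _ (B.Φl_counit_left' _ _), mul_one, leftEq_qpMap.snd,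
    B.Φl_counit_mid', one_mul, h₂, Q.Φ_β_α]
  rfl

end Legs4

section Bicomodule

local notation "ℓ₁" => (inl : H →ₐ[k] H ⊗[k] (H ⊗[k] (A ⊗[k] H)))
local notation "ℓ₂" => AlgHom.comp (inr : _ →ₐ[k] H ⊗[k] (H ⊗[k] (A ⊗[k] H))) inl
local notation "ℓₘ" => AlgHom.comp (inr : _ →ₐ[k] H ⊗[k] (H ⊗[k] (A ⊗[k] H))) (AlgHom.comp inr inl)
local notation "ℓ₄" => AlgHom.comp (inr : _ →ₐ[k] H ⊗[k] (H ⊗[k] (A ⊗[k] H))) (AlgHom.comp inr inr)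

/-- `h ⊗ a ⊗ h' ↦ lam a * w * (S⁻¹ h ⊗ 1) ⊗ h'`. -/
def coadjT (w : H ⊗[k] A) : H ⊗[k] (A ⊗[k] H) →ₗ[k] H ⊗[k] (A ⊗[k] H) :=
  (TensorProduct.assoc k H A H).toLinearMap ∘ₗ (coadj B w).rTensor H ∘ₗ
    (TensorProduct.assoc k H A H).symm.toLinearMap

lemma coadjT_tmul (w : H ⊗[k] A) (h h' : H) (a : A) :
    coadjT B w (h ⊗ₜ (a ⊗ₜ h'))
      = TensorProduct.assoc k H A H ((B.lam a * w * (Q.Sinv h ⊗ₜ 1)) ⊗ₜ h') := by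
  simp [coadjT]

lemma rightEq_pMapT : RightEq (pMap Q (A ⊗[k] H)) (ℓ₁ ◇ ℓ₂) (Q.counit _) := by
  simpa using rightEq_pMap (Q := Q) (A := A ⊗[k] H)

/-- The pentagon mixing Φ_λ and Φ_{λ,ρ}, contracted by the map that defines p̃: the factor with leg
ℓ₁ ◇ ℓ₂ collapses. It serves to compute the hat of an extended map. -/
lemma Φlr_inv_mul_pElt : (B.Φlr⁻¹.val : H ⊗[k] (A ⊗[k] H)) * idT H B.rho (pElt B)
    = coadjT B (pElt B) B.Φlr.val := by
  have h₁ : ∀ s t, pMap Q (A ⊗[k] H) (lift3 ℓ₂ ℓₘ ℓ₄ s * lift3 ℓ₁ ℓ₂ (conv B.rho ℓₘ ℓ₄) t)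
      = s * idT H B.rho (pMap Q A t) := fun s t => by
    induction t using induction3 with
    | add t t' ht ht' => simp only [map_add, mul_add, ht, ht']
    | tmul x y a =>
      simp only [lift2_tmul, conv_apply, pMap_tmul, Algebra.TensorProduct.map_tmul]
      generalize B.rho a = l
      induction l using induction2 with
      | add l l' hl hl' => simp only [map_add, mul_add, tmul_add, hl, hl']
      | tmul b z =>
      induction s using induction3 with
      | tmul a b c => simp [mul_assoc]
      | add s s' hs hs' => simp only [map_add, hs, hs', add_mul]
  have h₂ : ∀ s t, pMap Q (A ⊗[k] H) (lift3 ℓ₁ (ℓ₂ ◁ ℓₘ) ℓ₄ s * lift3 ℓ₁ ℓ₂ ℓₘ t)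
      = coadjT B (pMap Q A t) s := fun s t => by
    induction s using induction3 with
    | add s s' hs hs' => simp only [map_add, add_mul, hs, hs']
    | tmul x a h =>
      simp only [lift2_tmul, conv_apply, coadjT_tmul]
      generalize B.lam a = l
      induction l using induction2 with
      | add l l' hl hl' => simp only [map_add, mul_add, add_mul, add_tmul, hl, hl']
      | tmul b z =>
      induction t using induction3 with
      | tmul a b c => simp [Q.Sinv_mul, mul_assoc]
      | add s t hs ht => simp only [map_add, hs, ht, mul_add, add_mul, add_tmul]
  have e := congrArg Units.val (pentagon_inv_right (B.Φlr_pentagon_left ℓ₁ ℓ₂ ℓₘ ℓ₄))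
  have r := (rightEq_pMapT (Q := Q) (A := A)).fst (v := ℓₘ) (w := ℓ₄) B.Φlr⁻¹.val
    (lift3 ℓ₁ (ℓ₂ ◁ ℓₘ) ℓ₄ B.Φlr.val * lift3 ℓ₁ ℓ₂ ℓₘ B.Φl.val)
  rw [lift3_inv_eq_one _ _ _ (B.Φlr_counit_left _ _), mul_one, h₂] at r
  refine (h₁ _ _).symm.trans (Eq.trans ?_ r)
  exact congrArg _ e

end Bicomodule

end LeftCoaction

/-! ### The comultiplication transported along the antipode -/

namespace QuasiHopfAlgebra

variable {k H : Type*} [Field k] [Ring H] [Algebra k H] (Q : QuasiHopfAlgebra k H)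

/-- The algebra map `(S ⊗ S) ∘ Δᶜᵒᵖ ∘ S⁻¹`. -/
def coΔ : H →ₐ[k] H ⊗[k] H :=
  AlgHom.ofLinearMap (Q.SSΔcop ∘ₗ Q.Sinv.toLinearMap)
    (by simp [Q.Sinv_one, Q.SSΔcop_one])
    (fun x y => by simp [Q.Sinv_mul, Q.SSΔcop_mul])

lemma coΔ_apply (h : H) : Q.coΔ h = Q.SSΔcop (Q.Sinv h) := rfl

lemma coΔ_S (h : H) : Q.coΔ (Q.S h) = Q.SSΔcop h := by simp [coΔ_apply]

lemma tId_Δ_mul_twistInv {A : Type*} [Ring A] [Algebra k A] (t : H ⊗[k] A) :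
    tId Q.Δ A t * idT H (tOne A) Q.twistInv = idT H (tOne A) Q.twistInv * tId Q.coΔ A t := by
  have e (s : H ⊗[k] H) (a : A) : idT H (tOne A) s * (1 ⊗ₜ (1 ⊗ₜ a))
      = Algebra.TensorProduct.assoc k k k H H A (s ⊗ₜ a) := by
    induction s using induction2 with
    | add s t hs ht => rw [map_add, add_mul, hs, ht, add_tmul, map_add]
    | tmul x y => simp
  have e' (s : H ⊗[k] H) (a : A) : (1 ⊗ₜ (1 ⊗ₜ a)) * idT H (tOne A) s
      = Algebra.TensorProduct.assoc k k k H H A (s ⊗ₜ a) := by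
    induction s using induction2 with
    | add s t hs ht => rw [map_add, mul_add, hs, ht, add_tmul, map_add]
    | tmul x y => simp
  have e'' (δ : H →ₐ[k] H ⊗[k] H) (h : H) (a : A) : tId δ A (h ⊗ₜ a)
      = Algebra.TensorProduct.assoc k k k H H A (δ h ⊗ₜ a) := rfl
  induction t using induction2 with
  | add s t hs ht => rw [map_add, add_mul, hs, ht, map_add, mul_add]
  | tmul h a =>
    rw [e'', e'', ← e, mul_assoc, e', ← e, ← e, ← mul_assoc, ← map_mul, Q.Δ_mul_twistInv,
      map_mul, mul_assoc]
    rfl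

end QuasiHopfAlgebra

/-! ### The element z of the coaction and its two identities -/

section LeftCoaction

set_option maxSynthPendingDepth 10

variable {k H A : Type*} [Field k] [Ring H] [Algebra k H] [Ring A] [Algebra k A]
  {Q : QuasiHopfAlgebra k H} (B : BicomoduleAlgebra Q.toQuasiBialgebra A)

local infixl:75 " ◇ " => conv (QuasiBialgebra.Δ (QuasiHopfAlgebra.toQuasiBialgebra Q))
local infixl:75 " ◁ " => conv (BicomoduleAlgebra.lam B)
local notation "Φ(" u "," v "," w ")" =>
  lift3 u v w (Units.val (QuasiBialgebra.Φ (QuasiHopfAlgebra.toQuasiBialgebra Q)))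
local notation "Φ⁻(" u "," v "," w ")" =>
  lift3 u v w (Units.val (Inv.inv (QuasiBialgebra.Φ (QuasiHopfAlgebra.toQuasiBialgebra Q))))
local notation "Ψ(" u "," v "," w ")" => lift3 u v w (Units.val (BicomoduleAlgebra.Φl B))
local notation "Ψ⁻(" u "," v "," w ")" =>
  lift3 u v w (Units.val (Inv.inv (BicomoduleAlgebra.Φl B)))

/-- `h ⊗ a ↦ (S h ⊗ 1 ⊗ 1) * w * (δ ⊗ id) (lam a)`. -/
def adjT (δ : H →ₐ[k] H ⊗[k] H) (w : H ⊗[k] (H ⊗[k] A)) : H ⊗[k] A →ₗ[k] H ⊗[k] (H ⊗[k] A) :=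
  bi (fun h a => (Q.S h ⊗ₜ 1) * w * tId δ A (B.lam a))
    (fun _ => by constructor <;> intros <;> simp [add_mul, add_tmul, ← smul_tmul'])
    (fun _ => by constructor <;> intros <;> simp [mul_add])

@[simp] lemma adjT_tmul (δ : H →ₐ[k] H ⊗[k] H) (w : H ⊗[k] (H ⊗[k] A)) (h : H) (a : A) :
    adjT B δ w (h ⊗ₜ a) = (Q.S h ⊗ₜ 1) * w * tId δ A (B.lam a) := by simp [adjT]

/-- `(id ⊗ lam)(q̃) Φ_λ`, so that `zElt = yElt * (f⁻¹ ⊗ 1)`. -/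
def yElt : H ⊗[k] (H ⊗[k] A) := idT H B.lam (qElt B) * B.Φl

lemma zElt_eq : zElt B = yElt B * idT H (tOne A) Q.twistInv := rfl

section Legs4

local notation "ℓ₁" => (inl : H →ₐ[k] H ⊗[k] (H ⊗[k] (H ⊗[k] A)))
local notation "ℓ₂" => AlgHom.comp (inr : _ →ₐ[k] H ⊗[k] (H ⊗[k] (H ⊗[k] A))) inl
local notation "ℓ₃" => AlgHom.comp (inr : _ →ₐ[k] H ⊗[k] (H ⊗[k] (H ⊗[k] A))) (AlgHom.comp inr inl)
local notation "ℓₘ" => AlgHom.comp (inr : _ →ₐ[k] H ⊗[k] (H ⊗[k] (H ⊗[k] A))) (AlgHom.comp inr inr)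

lemma qMap_mul_legs (s t : H ⊗[k] (H ⊗[k] A)) :
    qMap Q (H ⊗[k] A) (lift3 ℓ₁ ℓ₂ (ℓ₃ ◁ ℓₘ) s * lift3 ℓ₂ ℓ₃ ℓₘ t)
      = idT H B.lam (qMap Q A s) * t := by
  induction s using induction3 with
  | add s s' hs hs' => simp only [map_add, add_mul, hs, hs']
  | tmul x y a =>
    simp only [lift2_tmul, conv_apply, qMap_tmul, Algebra.TensorProduct.map_tmul]
    generalize B.lam a = l
    induction l using induction2 with
    | add l l' hl hl' => simp only [map_add, mul_add, add_mul, tmul_add, hl, hl']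
    | tmul z b =>
    induction t using induction3 with
    | add t t' ht ht' => simp only [map_add, mul_add, ht, ht']
    | tmul c d a => simp [mul_assoc]

lemma yElt_eq : yElt B = qMap Q (H ⊗[k] A) (Ψ⁻(ℓ₁, ℓ₂, ℓ₃ ◁ ℓₘ) * Ψ(ℓ₂, ℓ₃, ℓₘ)) :=
  (qMap_mul_legs B _ _).symm

/-- Two intertwining relations in succession carry u through Φ_λ⁻¹ and Φ_λ. The first leaves u on
the leg ℓ₃ ◁ ℓₘ alone, since α absorbs ℓ₁ ◇ ℓ₂. -/
lemma tmul_mul_yElt (u : A) : (1 ⊗ₜ B.lam u) * yElt B = adjT B Q.Δ (yElt B) (B.lam u) := by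
  have h₁ : ∀ t, qMap Q (H ⊗[k] A) ((ℓ₃ ◁ ℓₘ) u * t) = (1 ⊗ₜ B.lam u) * qMap Q (H ⊗[k] A) t :=
      fun t => by
    rw [conv_apply]
    generalize B.lam u = l
    induction l using induction2 with
    | add l l' hl hl' => simp only [map_add, add_mul, tmul_add, hl, hl']
    | tmul z b =>
    induction t using induction4 with
    | tmul a b c => simp
    | add s t hs ht => rw [mul_add, map_add, hs, ht, map_add, mul_add]
  have h₂ : ∀ s t, qMap Q (H ⊗[k] A) (t * lift2 ℓ₁ (ℓ₂ ◇ ℓ₃ ◁ ℓₘ) s)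
      = adjT B Q.Δ (qMap Q (H ⊗[k] A) t) s := fun s t => by
    induction s using induction2 with
    | add s s' hs hs' => rw [map_add, mul_add, map_add, hs, hs', map_add]
    | tmul x a =>
      rw [lift2_tmul, conv_apply, adjT_tmul, ← lift2_tId]
      generalize tId Q.Δ A (B.lam a) = l
      induction l using induction3 with
      | add s s' hs hs' => simp only [map_add, mul_add, hs, hs']
      | tmul y z b =>
      induction t using induction4 with
      | tmul a b c d => simp [Q.S_mul, mul_assoc]
      | add s t hs ht => simp only [add_mul, map_add, hs, ht, mul_add]
  have l := (leftEq_qMap (Q := Q) (A := H ⊗[k] A)).conv_left (δ := B.lam) (v := ℓ₃ ◁ ℓₘ)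
  rw [B.conv_lam_counit] at l
  have e := B.Φl_intertwine_inv ℓ₁ ℓ₂ (ℓ₃ ◁ ℓₘ) u
  have e' := conv_intertwine (δ := B.lam) (r := Ψ(ℓ₂, ℓ₃, ℓₘ)) (u := ℓ₁) (u' := ℓ₁)
    (v := ℓ₂ ◇ ℓ₃ ◁ ℓₘ) (v' := ℓ₂ ◁ (ℓ₃ ◁ ℓₘ)) (comm_eq ℓ₁ (lift3 ℓ₂ ℓ₃ ℓₘ) · _)
    (fun a => (B.Φl_intertwine _ _ _ a).symm) u
  rw [yElt_eq, ← h₁, ← h₂, ← conv_apply, mul_assoc, e',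
    ← mul_assoc Ψ⁻(ℓ₁, ℓ₂, ℓ₃ ◁ ℓₘ), ← e, mul_assoc]
  exact (l u _).symm

/-- Passing f⁻¹ replaces Δ by `coΔ`, the comultiplication seen by a right action twisted by S⁻¹. The
result makes the coaction on M ⊗ C compatible. -/
lemma tmul_mul_zElt (u : A) : (1 ⊗ₜ B.lam u) * zElt B = adjT B Q.coΔ (zElt B) (B.lam u) := by
  rw [zElt_eq, ← mul_assoc, tmul_mul_yElt]
  generalize B.lam u = l
  induction l using induction2 with
  | add l l' hl hl' => simp only [map_add, add_mul, hl, hl']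
  | tmul x a =>
    rw [adjT_tmul, adjT_tmul, mul_assoc, Q.tId_Δ_mul_twistInv]
    simp only [mul_assoc]

end Legs4

section Legs5

local notation "R₅" => H ⊗[k] (H ⊗[k] (H ⊗[k] (H ⊗[k] A)))
local notation "ℓa" => (inl : H →ₐ[k] R₅)
local notation "ℓb" => AlgHom.comp (inr : _ →ₐ[k] R₅) inl
local notation "ℓc" => AlgHom.comp (inr : _ →ₐ[k] R₅) (AlgHom.comp inr inl)
local notation "ℓd" => AlgHom.comp (inr : _ →ₐ[k] R₅) (AlgHom.comp inr (AlgHom.comp inr inl))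
local notation "ℓₘ" => AlgHom.comp (inr : _ →ₐ[k] R₅) (AlgHom.comp inr (AlgHom.comp inr inr))

variable (Q) in
/-- `a ⊗ b ⊗ c ⊗ d ⊗ e ↦ S b * α * c ⊗ S a * α * d ⊗ e`. -/
def nestMap (A : Type*) [Ring A] [Algebra k A] : H ⊗[k] (H ⊗[k] (H ⊗[k] (H ⊗[k] A))) →ₗ[k] H ⊗[k] (H ⊗[k] A) :=
  quad (fun a b c t => (Q.S b * Q.α * c) ⊗ₜ[k] ((Q.S a * Q.α) ⊗ₜ 1 * t))
    (fun _ _ _ => by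
      constructor <;> intros <;> simp [add_mul, tmul_add, add_tmul, ← smul_tmul'])
    (fun _ _ _ => by constructor <;> intros <;> simp [add_mul, add_tmul, smul_tmul'])
    (fun _ _ _ => by constructor <;> intros <;> simp [mul_add, add_tmul, smul_tmul'])
    (fun _ _ _ => by constructor <;> intros <;> simp [mul_add, tmul_add])

@[simp] lemma nestMap_tmul (a b c d : H) (e : A) :
    nestMap Q A (a ⊗ₜ (b ⊗ₜ (c ⊗ₜ (d ⊗ₜ e))))
      = (Q.S b * Q.α * c) ⊗ₜ[k] ((Q.S a * Q.α * d) ⊗ₜ e) := by simp [nestMap]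

lemma leftEq_nestMap : LeftEq (nestMap Q A) (ℓb ◇ ℓc) (Q.counit _) := by
  refine leftEq_counit _ Q.evα Q.α Q.evα_Δ fun r => ?_
  induction r using induction5 with
  | tmul a b c d e =>
    refine ⟨fun z => (Q.S b * z * c) ⊗ₜ ((Q.S a * Q.α * d) ⊗ₜ e), ?_, fun x y => ?_⟩
    · constructor <;> intros <;> simp [mul_add, add_mul, add_tmul, smul_tmul']
    · simp [Q.S_mul, mul_assoc]
  | add s t hs ht =>
    obtain ⟨f, hf, hf'⟩ := hs
    obtain ⟨g, hg, hg'⟩ := ht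
    exact ⟨fun z => f z + g z, (hf.mk' f + hg.mk' g).isLinear, fun x y => by
      simp only [mul_add, map_add, hf', hg']⟩

lemma nestMap_mul_lift3 (t : R₅) (y : H ⊗[k] (H ⊗[k] A)) :
    nestMap Q A (t * lift3 ℓc ℓd ℓₘ y) = nestMap Q A t * y := by
  induction t using induction5 with
  | add s t hs ht => simp only [add_mul, map_add, hs, ht]
  | tmul a b c d e =>
  induction y using induction3 with
  | add s t hs ht => simp only [mul_add, map_add, hs, ht]
  | tmul x y z => simp [mul_assoc]

lemma nestMap_mul_lift2 (t : R₅) (p : H ⊗[k] H) :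
    nestMap Q A (t * lift2 ℓa ℓb p) = idT H (tOne A) (Q.flipS p) * nestMap Q A t := by
  induction t using induction5 with
  | add s t hs ht => simp only [add_mul, mul_add, map_add, hs, ht]
  | tmul a b c d e =>
  induction p using induction2 with
  | add s t hs ht => simp only [mul_add, add_mul, map_add, hs, ht]
  | tmul x y => simp [Q.S_mul, mul_assoc]

lemma nestMap_lift4 (s : H ⊗[k] (H ⊗[k] (H ⊗[k] H))) :
    nestMap Q A (lift2 ℓa (lift3 ℓb ℓc ℓd) s) = idT H (tOne A) (Q.nestα s) := by
  induction s using induction4 with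
  | add s t hs ht => simp only [map_add, hs, ht]
  | tmul x y z w => simp

lemma nestMap_legs (s t : H ⊗[k] (H ⊗[k] A)) (w : H ⊗[k] (H ⊗[k] A)) :
    nestMap Q A (lift3 ℓa ℓd ℓₘ s * (lift3 ℓb ℓc (ℓd ◁ ℓₘ) t * lift3 ℓc ℓd ℓₘ w))
      = (1 ⊗ₜ qMap Q A s) * (idT H B.lam (qMap Q A t) * w) := by
  rw [← mul_assoc, ← mul_assoc, nestMap_mul_lift3]
  congr 1
  induction t using induction3 with
  | add s s' hs hs' => simp only [map_add, mul_add, hs, hs']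
  | tmul x y a =>
    simp only [lift2_tmul, conv_apply, qMap_tmul, Algebra.TensorProduct.map_tmul]
    generalize B.lam a = l
    induction l using induction2 with
    | add l l' hl hl' => simp only [map_add, mul_add, tmul_add, hl, hl']
    | tmul z b =>
    induction s using induction3 with
    | add t t' ht ht' => simp only [map_add, add_mul, tmul_add, ht, ht']
    | tmul c d a => simp [mul_assoc]

/-- `x ⊗ y ⊗ a ↦ (S y ⊗ S x ⊗ 1) * w * (δ ⊗ id) (lam a)`. -/
def adj₂ (δ : H →ₐ[k] H ⊗[k] H) (w : H ⊗[k] (H ⊗[k] A)) :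
    H ⊗[k] (H ⊗[k] A) →ₗ[k] H ⊗[k] (H ⊗[k] A) :=
  tri (fun x y a => (Q.S y ⊗ₜ (Q.S x ⊗ₜ 1)) * w * tId δ A (B.lam a))
    (fun _ _ => by constructor <;> intros <;> simp [add_mul, tmul_add, add_tmul, ← smul_tmul'])
    (fun _ _ => by constructor <;> intros <;> simp [add_mul, add_tmul, ← smul_tmul'])
    (fun _ _ => by constructor <;> intros <;> simp [mul_add])

@[simp] lemma adj₂_tmul (δ : H →ₐ[k] H ⊗[k] H) (w : H ⊗[k] (H ⊗[k] A)) (x y : H) (a : A) :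
    adj₂ B δ w (x ⊗ₜ (y ⊗ₜ a)) = (Q.S y ⊗ₜ (Q.S x ⊗ₜ 1)) * w * tId δ A (B.lam a) := by
  simp [adj₂]

/-- `x ⊗ y ⊗ a ↦ ((S ⊗ S)(Δᶜᵒᵖ x) γ ⊗ 1) (Δ ⊗ id)(y ⊗ a)`. -/
def γMap : H ⊗[k] (H ⊗[k] A) →ₗ[k] H ⊗[k] (H ⊗[k] A) :=
  bi (fun x t => idT H (tOne A) (Q.SSΔcop x * Q.γ) * tId Q.Δ A t)
    (fun _ => by constructor <;> intros <;> simp [add_mul])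
    (fun _ => by constructor <;> intros <;> simp [mul_add])

@[simp] lemma γMap_tmul (x : H) (t : H ⊗[k] A) :
    γMap (Q := Q) (x ⊗ₜ t) = idT H (tOne A) (Q.SSΔcop x * Q.γ) * tId Q.Δ A t := by simp [γMap]

lemma nestMap_mul_adj₂ (s : R₅) (t : H ⊗[k] (H ⊗[k] A)) :
    nestMap Q A (s * lift3 ℓa ℓb (ℓc ◇ ℓd ◁ ℓₘ) t) = adj₂ B Q.Δ (nestMap Q A s) t := by
  induction t using induction3 with
  | add t t' ht ht' => simp only [map_add, mul_add, ht, ht']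
  | tmul x y a =>
    rw [lift2_tmul, lift2_tmul, conv_apply, ← lift2_tId, ← mul_assoc (ℓa x),
      ← lift2_tmul ℓa ℓb, ← mul_assoc, nestMap_mul_lift3, nestMap_mul_lift2, Q.flipS_tmul,
      adj₂_tmul]
    rfl

lemma nestMap_wordα_mul (t : H ⊗[k] (H ⊗[k] A)) :
    nestMap Q A (lift2 ℓa (lift3 ℓb ℓc ℓd) Q.wordα * lift3 (ℓa ◇ ℓb) (ℓc ◇ ℓd) ℓₘ t)
      = γMap (Q := Q) t := by
  induction t using induction2 with
  | add t t' ht ht' => simp only [map_add, mul_add, ht, ht']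
  | tmul x t =>
    rw [lift2_tmul, conv_apply, ← lift2_tId, ← mul_assoc, nestMap_mul_lift3, nestMap_mul_lift2,
      nestMap_lift4, γMap_tmul, map_mul]
    rfl

-- The contractions of the two copies of q̃ become nested: b with c inside a with d. Pentagons
-- gather the reassociators of H into the word that defines γ and leave two copies of Φ_λ⁻¹.
set_option maxHeartbeats 800000 in
lemma tmul_qElt_mul_yElt : (1 ⊗ₜ qElt B) * yElt B
    = adj₂ B Q.Δ (γMap (Q := Q) B.Φl⁻¹.val) B.Φl⁻¹.val := by
  have c₁ : ∀ x, Commute Ψ⁻(ℓa, ℓd, ℓₘ) ((ℓb ◇ ℓc) x) := fun x =>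
    (commute_lift2 ℓa (lift2 ℓd ℓₘ) (fun y => (Comm.comm y x).symm)
      (fun y => Comm.comm x y) _).symm
  have hd : LeftEq (nestMap Q A) (ℓb ◇ ℓc ◇ ℓd) ℓd := by
    simpa using (leftEq_nestMap (Q := Q) (A := A)).conv_left (δ := Q.Δ) (v := ℓd)
  have s₁ : Ψ⁻(ℓb, ℓc, ℓd ◁ ℓₘ) * Ψ(ℓc, ℓd, ℓₘ)
      = Ψ(ℓb ◇ ℓc, ℓd, ℓₘ) * Φ⁻(ℓb, ℓc, ℓd) * Ψ⁻(ℓb, ℓc ◇ ℓd, ℓₘ) :=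
    congrArg Units.val (pentagon_inv_left (B.Φl_pentagon ℓb ℓc ℓd ℓₘ))
  have s₂ : Φ⁻(ℓb, ℓc, ℓd) * Ψ⁻(ℓa, ℓb ◇ (ℓc ◇ ℓd), ℓₘ)
      = Ψ⁻(ℓa, ℓb ◇ ℓc ◇ ℓd, ℓₘ) * Φ⁻(ℓb, ℓc, ℓd) :=
    lift3_intertwine (fun x => comm_eq ℓa (lift3 ℓb ℓc ℓd) x _)
      (fun y => (Q.Φ_intertwine_inv ℓb ℓc ℓd y).symm)
      (fun y => (comm_eq (lift3 ℓb ℓc ℓd) ℓₘ _ y).symm) _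
  have s₃ : Ψ⁻(ℓa, ℓb ◇ (ℓc ◇ ℓd), ℓₘ) * Ψ⁻(ℓb, ℓc ◇ ℓd, ℓₘ)
      = Φ(ℓa, ℓb, ℓc ◇ ℓd) * Ψ⁻(ℓa ◇ ℓb, ℓc ◇ ℓd, ℓₘ) * Ψ⁻(ℓa, ℓb, ℓc ◇ ℓd ◁ ℓₘ) :=
    congrArg Units.val (pentagon_inv_inv (B.Φl_pentagon ℓa ℓb (ℓc ◇ ℓd) ℓₘ))
  have g := (leftEq_nestMap (Q := Q) (A := A)).mul_left c₁ (fun x => Q.commute_counit _ x)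
  have g' := g.fst (v := ℓd) (w := ℓₘ) B.Φl.val (Φ⁻(ℓb, ℓc, ℓd) * Ψ⁻(ℓb, ℓc ◇ ℓd, ℓₘ))
  rw [B.Φl_counit_left', one_mul] at g'
  calc _ = nestMap Q A (Ψ⁻(ℓa, ℓd, ℓₘ) * (Ψ⁻(ℓb, ℓc, ℓd ◁ ℓₘ) * Ψ(ℓc, ℓd, ℓₘ))) :=
        (nestMap_legs B _ _ _).symm
    _ = nestMap Q A (Ψ⁻(ℓa, ℓd, ℓₘ) * (Φ⁻(ℓb, ℓc, ℓd) * Ψ⁻(ℓb, ℓc ◇ ℓd, ℓₘ))) := by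
        rw [s₁, mul_assoc]
        exact g'
    _ = nestMap Q A (lift2 ℓa (lift3 ℓb ℓc ℓd) Q.wordα * Ψ⁻(ℓa ◇ ℓb, ℓc ◇ ℓd, ℓₘ)
          * Ψ⁻(ℓa, ℓb, ℓc ◇ ℓd ◁ ℓₘ)) := by
        -- The collapse is used backwards: d is inflated to (bc)d so that Φ⁻(b,c,d) can slide past
        -- and the pentagon for a, b, cd becomes available.
        rw [← hd.snd, ← mul_assoc, ← s₂, mul_assoc, s₃, Q.lift4_wordα]
        simp only [mul_assoc]
    _ = _ := by rw [nestMap_mul_adj₂, nestMap_wordα_mul]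

/-- This identity is why f⁻¹ occurs in the coaction: it converts each Δ into `coΔ`, and since γf⁻¹
equals `coΔ` of α, the expression in γ becomes (`coΔ` ⊗ id)(q̃). The mixed law is this identity read
as one of operators. -/
lemma tmul_qElt_mul_zElt : (1 ⊗ₜ qElt B) * zElt B
    = adj₂ B Q.coΔ (tId Q.coΔ A (qElt B)) B.Φl⁻¹.val := by
  have e₁ : ∀ s t, adj₂ B Q.Δ s t * idT H (tOne A) Q.twistInv
      = adj₂ B Q.coΔ (s * idT H (tOne A) Q.twistInv) t := fun s t => by
    induction t using induction3 with
    | add t t' ht ht' => simp only [map_add, add_mul, ht, ht']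
    | tmul x y a =>
      rw [adj₂_tmul, adj₂_tmul, mul_assoc, Q.tId_Δ_mul_twistInv]
      simp only [mul_assoc]
  have e₂ : ∀ t, γMap (Q := Q) t * idT H (tOne A) Q.twistInv = tId Q.coΔ A (qMap Q A t) :=
      fun t => by
    induction t using induction3 with
    | add t t' ht ht' => simp only [map_add, add_mul, ht, ht']
    | tmul x y a =>
      rw [γMap_tmul, mul_assoc, Q.tId_Δ_mul_twistInv, ← mul_assoc, ← map_mul, mul_assoc,
        Q.γ_mul_twistInv, ← Q.coΔ_S, ← Q.coΔ_apply, ← map_mul, qMap_tmul]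
      have h (c : H) (b : A) : tId Q.coΔ A (c ⊗ₜ b)
          = idT H (tOne A) (Q.coΔ c) * (1 ⊗ₜ (1 ⊗ₜ b)) := by
        change Algebra.TensorProduct.assoc k k k H H A (Q.coΔ c ⊗ₜ b) = _
        generalize Q.coΔ c = d
        induction d using induction2 with
        | add s t hs ht => rw [map_add, add_mul, ← hs, ← ht, add_tmul, map_add]
        | tmul x y => simp
      rw [h, h, ← mul_assoc, ← map_mul, ← map_mul]
  rw [zElt_eq, ← mul_assoc, tmul_qElt_mul_yElt, e₁, e₂, qElt_eq]

end Legs5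

end LeftCoaction

/-! ### Operators on Hom spaces, acting from the right -/

section HomOperators

variable {k : Type*} [CommRing k] {N P N' P' : Type*} [AddCommGroup N] [Module k N]
  [AddCommGroup P] [Module k P] [AddCommGroup N'] [Module k N'] [AddCommGroup P'] [Module k P']

/-- The algebra of operators on `Hom(N, P)`, acting from the right. -/
abbrev HomOp (k N P : Type*) [CommRing k] [AddCommGroup N] [Module k N] [AddCommGroup P]
    [Module k P] : Type _ := (Module.End k (N →ₗ[k] P))ᵐᵒᵖ

/-- The right action of `HomOp k N P` on `Hom(N, P)`. -/
def act (r : N →ₗ[k] P) : HomOp k N P →ₗ[k] (N →ₗ[k] P) :=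
  LinearMap.applyₗ r ∘ₗ (MulOpposite.opLinearEquiv k).symm.toLinearMap

local infixl:72 " ⊲ " => act

@[simp] lemma act_one (r : N →ₗ[k] P) : r ⊲ (1 : HomOp k N P) = r := rfl

lemma act_mul (r : N →ₗ[k] P) (w w' : HomOp k N P) : r ⊲ (w * w') = (r ⊲ w) ⊲ w' := rfl

variable {A H S T U : Type*} [Ring A] [Algebra k A] [Ring H] [Algebra k H] [Ring S] [Algebra k S]
  [Ring T] [Algebra k T] [Ring U] [Algebra k U]

/-- Right multiplication, as composition with an action on the target. -/
def post (N : Type*) [AddCommGroup N] [Module k N] (b : Hᵐᵒᵖ →ₐ[k] Module.End k P) :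
    H →ₐ[k] HomOp k N P :=
  AlgHom.ofLinearMap
    ((MulOpposite.opLinearEquiv k).toLinearMap ∘ₗ LinearMap.llcomp k N P P ∘ₗ b.toLinearMap ∘ₗ
      (MulOpposite.opLinearEquiv k : H ≃ₗ[k] Hᵐᵒᵖ).toLinearMap)
    (by
      apply MulOpposite.unop_injective
      ext r
      simp)
    (fun x y => by
      apply MulOpposite.unop_injective
      ext r
      simp)

/-- Right multiplication, as composition with an action on the source. -/
def pre (P : Type*) [AddCommGroup P] [Module k P] (a : A →ₐ[k] Module.End k N) :
    A →ₐ[k] HomOp k N P :=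
  AlgHom.ofLinearMap
    ((MulOpposite.opLinearEquiv k).toLinearMap ∘ₗ (LinearMap.llcomp k N N P).flip ∘ₗ a.toLinearMap)
    (by
      apply MulOpposite.unop_injective
      ext r
      simp)
    (fun x y => by
      apply MulOpposite.unop_injective
      ext r
      simp)

@[simp] lemma act_post (r : N →ₗ[k] P) (b : Hᵐᵒᵖ →ₐ[k] Module.End k P) (h : H) :
    r ⊲ post N b h = b (MulOpposite.op h) ∘ₗ r := rfl

@[simp] lemma act_pre (r : N →ₗ[k] P) (a : A →ₐ[k] Module.End k N) (x : A) :
    r ⊲ pre P a x = r ∘ₗ a x := rfl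

lemma homOp_ext {w w' : HomOp k N P} (h : ∀ r : N →ₗ[k] P, r ⊲ w = r ⊲ w') : w = w' :=
  MulOpposite.unop_injective (LinearMap.ext h)

instance (b : Hᵐᵒᵖ →ₐ[k] Module.End k P) (a : A →ₐ[k] Module.End k N) :
    Comm (post N b) (pre P a) :=
  ⟨fun _ _ => homOp_ext fun _ => rfl⟩

instance {b : Hᵐᵒᵖ →ₐ[k] Module.End k P} {b' : Sᵐᵒᵖ →ₐ[k] Module.End k P} [Comm b b'] :
    Comm (post N b) (post N b') :=
  ⟨fun x y => homOp_ext fun r => by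
    rw [act_mul, act_mul, act_post, act_post, act_post, act_post, ← LinearMap.comp_assoc,
      ← LinearMap.comp_assoc]
    exact congrArg (· ∘ₗ r) (comm_eq b b' _ _)⟩

instance {a : A →ₐ[k] Module.End k N} {a' : S →ₐ[k] Module.End k N} [Comm a a'] :
    Comm (pre P a) (pre P a') :=
  ⟨fun x y => homOp_ext fun r => by
    rw [act_mul, act_mul, act_pre, act_pre, act_pre, act_pre, LinearMap.comp_assoc,
      LinearMap.comp_assoc]
    exact congrArg (r ∘ₗ ·) (comm_eq a a' _ _).symm⟩

/-- The linear map `G` turns the right action through `u` into the one through `u'`, on the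
subspace `L`, which is stable under the first of these actions. -/
def Intertwines (L : Submodule k (N →ₗ[k] P)) (G : (N →ₗ[k] P) →ₗ[k] (N' →ₗ[k] P'))
    (u : S →ₐ[k] HomOp k N P) (u' : S →ₐ[k] HomOp k N' P') : Prop :=
  ∀ x, ∀ r ∈ L, r ⊲ u x ∈ L ∧ G (r ⊲ u x) = G r ⊲ u' x

section Intertwines

variable {L : Submodule k (N →ₗ[k] P)} {G : (N →ₗ[k] P) →ₗ[k] (N' →ₗ[k] P')}
  {u : S →ₐ[k] HomOp k N P} {u' : S →ₐ[k] HomOp k N' P'} {v : T →ₐ[k] HomOp k N P}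
  {v' : T →ₐ[k] HomOp k N' P'}

lemma Intertwines.of_top (h : ∀ x r, G (r ⊲ u x) = G r ⊲ u' x) : Intertwines ⊤ G u u' :=
  fun x r _ => ⟨trivial, h x r⟩

lemma Intertwines.top (h : Intertwines ⊤ G u u') (x : S) (r : N →ₗ[k] P) :
    G (r ⊲ u x) = G r ⊲ u' x := (h x r trivial).2

lemma Intertwines.lift2 [Comm u v] [Comm u' v'] (hu : Intertwines L G u u')
    (hv : Intertwines L G v v') : Intertwines L G (lift2 u v) (lift2 u' v') := fun t r hr => by
  induction t using induction2 with
  | tmul x y =>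
    obtain ⟨h₁, h₁'⟩ := hu x r hr
    obtain ⟨h₂, h₂'⟩ := hv y _ h₁
    rw [lift2_tmul, lift2_tmul, act_mul, act_mul]
    exact ⟨h₂, h₂'.trans (by rw [h₁'])⟩
  | add s t hs ht =>
    rw [map_add, map_add, map_add, map_add]
    exact ⟨L.add_mem hs.1 ht.1, by rw [map_add, hs.2, ht.2]⟩

lemma Intertwines.conv [Comm u v] [Comm u' v'] (hu : Intertwines L G u u')
    (hv : Intertwines L G v v') (δ : U →ₐ[k] S ⊗[k] T) :
    Intertwines L G (conv δ u v) (conv δ u' v') :=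
  fun x => hu.lift2 hv (δ x)

end Intertwines

/-- Composition with `f` on the left. -/
abbrev compL (N : Type*) [AddCommGroup N] [Module k N] (f : P →ₗ[k] P') :
    (N →ₗ[k] P) →ₗ[k] (N →ₗ[k] P') := LinearMap.llcomp k N P P' f

/-- Composition with `g` on the right. -/
abbrev compR (P : Type*) [AddCommGroup P] [Module k P] (g : N' →ₗ[k] N) :
    (N →ₗ[k] P) →ₗ[k] (N' →ₗ[k] P) := (LinearMap.llcomp k N' N P).flip g

/-- The maps that commute with the actions `b` and `b'`. -/
def commutant (b : S →ₐ[k] Module.End k N) (b' : S →ₐ[k] Module.End k P) :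
    Submodule k (N →ₗ[k] P) where
  carrier := {f | ∀ h, f ∘ₗ b h = b' h ∘ₗ f}
  zero_mem' _ := by simp
  add_mem' hf hg h := by rw [LinearMap.add_comp, LinearMap.comp_add, hf h, hg h]
  smul_mem' c f hf h := by rw [LinearMap.smul_comp, LinearMap.comp_smul, hf h]

lemma comp_lift2 {f : N →ₗ[k] P} {u : S →ₐ[k] Module.End k N} {u' : S →ₐ[k] Module.End k P}
    {v : T →ₐ[k] Module.End k N} {v' : T →ₐ[k] Module.End k P} [Comm u v] [Comm u' v']
    (hu : f ∈ commutant u u') (hv : f ∈ commutant v v') :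
    f ∈ commutant (lift2 u v) (lift2 u' v') := fun t => by
  induction t using induction2 with
  | tmul x y =>
    rw [lift2_tmul, lift2_tmul, Module.End.mul_eq_comp, ← LinearMap.comp_assoc, hu,
      LinearMap.comp_assoc, hv]
    rfl
  | add s t hs ht => rw [map_add, map_add, LinearMap.comp_add, LinearMap.add_comp, hs, ht]

lemma comp_conv_mem {f : N →ₗ[k] P} {u : S →ₐ[k] Module.End k N} {u' : S →ₐ[k] Module.End k P}
    {v : T →ₐ[k] Module.End k N} {v' : T →ₐ[k] Module.End k P} [Comm u v] [Comm u' v']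
    (hu : f ∈ commutant u u') (hv : f ∈ commutant v v') (δ : U →ₐ[k] S ⊗[k] T) :
    f ∈ commutant (conv δ u v) (conv δ u' v') := fun x => comp_lift2 hu hv (δ x)

lemma mem_commutant_of_commute {f : Module.End k N} {u : S →ₐ[k] Module.End k N}
    (h : ∀ x, Commute f (u x)) : f ∈ commutant u u := fun x => (h x).eq

lemma commutant_comp {M : Type*} [AddCommGroup M] [Module k M] {u : S →ₐ[k] Module.End k N}
    {v : S →ₐ[k] Module.End k P} {w : S →ₐ[k] Module.End k M} {f : N →ₗ[k] P} {g : P →ₗ[k] M}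
    (hg : g ∈ commutant v w) (hf : f ∈ commutant u v) : g ∘ₗ f ∈ commutant u w := fun x => by
  rw [LinearMap.comp_assoc, hf, ← LinearMap.comp_assoc, hg, LinearMap.comp_assoc]

lemma intertwines_compL_post {f : P →ₗ[k] P'} {b : Hᵐᵒᵖ →ₐ[k] Module.End k P}
    {b' : Hᵐᵒᵖ →ₐ[k] Module.End k P'} (h : f ∈ commutant b b') :
    Intertwines ⊤ (compL N f) (post N b) (post N b') :=
  .of_top fun x r => congrArg (· ∘ₗ r) (h (.op x))

lemma intertwines_compL_pre (f : P →ₗ[k] P') (a : A →ₐ[k] Module.End k N) :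
    Intertwines ⊤ (compL N f) (pre P a) (pre P' a) :=
  .of_top fun _ _ => rfl

section Commutant

variable {b : S →ₐ[k] Module.End k N} {b' : S →ₐ[k] Module.End k P}

lemma act_post_mem {r : N →ₗ[k] P} (hr : r ∈ commutant b b') (c : Hᵐᵒᵖ →ₐ[k] Module.End k P)
    [Comm c b'] (x : H) : r ⊲ post N c x ∈ commutant b b' := fun h => by
  rw [act_post, LinearMap.comp_assoc, hr h, ← LinearMap.comp_assoc, ← LinearMap.comp_assoc]
  exact congrArg (· ∘ₗ r) (comm_eq c b' _ h).symm

lemma act_pre_mem {r : N →ₗ[k] P} (hr : r ∈ commutant b b') (a : A →ₐ[k] Module.End k N)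
    [Comm a b] (x : A) : r ⊲ pre P a x ∈ commutant b b' := fun h => by
  rw [act_pre, ← LinearMap.comp_assoc, ← hr h, LinearMap.comp_assoc, LinearMap.comp_assoc]
  exact congrArg (r ∘ₗ ·) (comm_eq a b _ h).symm

lemma act_lift2_mem {u : T →ₐ[k] HomOp k N P} {v : U →ₐ[k] HomOp k N P} [Comm u v]
    (hu : ∀ r ∈ commutant b b', ∀ x, r ⊲ u x ∈ commutant b b')
    (hv : ∀ r ∈ commutant b b', ∀ x, r ⊲ v x ∈ commutant b b') {r : N →ₗ[k] P}
    (hr : r ∈ commutant b b') (t : T ⊗[k] U) : r ⊲ lift2 u v t ∈ commutant b b' := by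
  induction t using induction2 with
  | tmul x y =>
    rw [lift2_tmul, act_mul]
    exact hv _ (hu _ hr _) _
  | add s t hs ht =>
    rw [map_add, map_add]
    exact (commutant b b').add_mem hs ht

lemma intertwines_compR_post (g : N' →ₗ[k] N) (c : Hᵐᵒᵖ →ₐ[k] Module.End k P) [Comm c b'] :
    Intertwines (commutant b b') (compR P g) (post N c) (post N' c) :=
  fun x _ hr => ⟨act_post_mem hr c x, rfl⟩

lemma intertwines_compR_pre {g : N' →ₗ[k] N} {a : A →ₐ[k] Module.End k N}
    {a' : A →ₐ[k] Module.End k N'} (h : g ∈ commutant a' a) [Comm a b] :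
    Intertwines (commutant b b') (compR P g) (pre P a) (pre P a') :=
  fun x r hr => ⟨act_pre_mem hr a x, congrArg (r ∘ₗ ·) (h x).symm⟩

lemma intertwines_compR_pre_top {g : N' →ₗ[k] N} {a : A →ₐ[k] Module.End k N}
    {a' : A →ₐ[k] Module.End k N'} (h : g ∈ commutant a' a) :
    Intertwines ⊤ (compR P g) (pre P a) (pre P a') :=
  .of_top fun x r => congrArg (r ∘ₗ ·) (h x).symm

end Commutant

end HomOperators

/-! ### Operators on a tensor product with C -/

section TensorOperators

variable {k : Type*} [CommRing k] {N P V A C S : Type*} [AddCommGroup N] [Module k N]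
  [AddCommGroup P] [Module k P] [AddCommGroup V] [Module k V] [AddCommGroup C] [Module k C]
  [Ring A] [Algebra k A] [Ring S] [Algebra k S]

/-- The action on the first factor of `V ⊗ C`. -/
abbrev onL (C : Type*) [AddCommGroup C] [Module k C] (a : A →ₐ[k] Module.End k V) :
    A →ₐ[k] Module.End k (V ⊗[k] C) :=
  (Module.End.rTensorAlgHom k V C).comp a

/-- The action on the second factor of `V ⊗ C`. -/
abbrev onR (V : Type*) [AddCommGroup V] [Module k V] (c : S →ₐ[k] Module.End k C) :
    S →ₐ[k] Module.End k (V ⊗[k] C) :=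
  (Module.End.lTensorAlgHom k C V).comp c

instance instCommOnLOnR (a : A →ₐ[k] Module.End k V) (c : S →ₐ[k] Module.End k C) :
    Comm (onL C a) (onR V c) :=
  ⟨fun _ _ => (LinearMap.rTensor_comp_lTensor _ _ _).trans
    (LinearMap.lTensor_comp_rTensor _ _ _).symm⟩

instance instCommOnROnL (a : A →ₐ[k] Module.End k V) (c : S →ₐ[k] Module.End k C) :
    Comm (onR V c) (onL C a) :=
  ⟨fun x y => (Comm.comm (u := onL C a) (v := onR V c) y x).symm⟩

lemma rTensor_mem_onL {f : N →ₗ[k] P} {a : A →ₐ[k] Module.End k N} {a' : A →ₐ[k] Module.End k P}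
    (h : f ∈ commutant a a') : f.rTensor C ∈ commutant (onL C a) (onL C a') := fun x =>
  (LinearMap.rTensor_comp C f (a x)).symm.trans
    ((congrArg _ (h x)).trans (LinearMap.rTensor_comp C (a' x) f))

lemma rTensor_mem_onR (f : N →ₗ[k] P) (c : S →ₐ[k] Module.End k C) :
    f.rTensor C ∈ commutant (onR N c) (onR P c) := fun _ =>
  (LinearMap.rTensor_comp_lTensor _ _ _).trans (LinearMap.lTensor_comp_rTensor _ _ _).symm

/-- `f ↦ f ⊗ id`, as a linear map. -/
abbrev upHom (C N P : Type*) [AddCommGroup C] [Module k C] [AddCommGroup N] [Module k N]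
    [AddCommGroup P] [Module k P] : (N →ₗ[k] P) →ₗ[k] (N ⊗[k] C →ₗ[k] P ⊗[k] C) :=
  LinearMap.rTensorHom C

lemma intertwines_upHom_post (b : Sᵐᵒᵖ →ₐ[k] Module.End k P) :
    Intertwines ⊤ (upHom C N P) (post N b) (post (N ⊗[k] C) (onL C b)) :=
  .of_top fun _ r => LinearMap.rTensor_comp C _ r

lemma intertwines_upHom_pre (a : A →ₐ[k] Module.End k N) :
    Intertwines ⊤ (upHom C N P) (pre P a) (pre (P ⊗[k] C) (onL C a)) :=
  .of_top fun _ r => LinearMap.rTensor_comp C r _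

end TensorOperators

section HomOperators

variable {k : Type*} [CommRing k] {N P : Type*} [AddCommGroup N] [Module k N]
  [AddCommGroup P] [Module k P] {S T U : Type*} [Ring S] [Algebra k S]
  [Ring T] [Algebra k T] [Ring U] [Algebra k U]

lemma pre_conv (δ : U →ₐ[k] S ⊗[k] T) (a : S →ₐ[k] Module.End k N) (a' : T →ₐ[k] Module.End k N)
    [Comm a a'] : pre P (conv δ a a') = conv δ (pre P a) (pre P a') := by
  have h (t : S ⊗[k] T) : pre P (AlgHom.id k _) (lift2 a a' t) = lift2 (pre P a) (pre P a') t := by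
    induction t using induction2 with
    | tmul x y =>
      rw [lift2_tmul, lift2_tmul, map_mul]
      rfl
    | add s t hs ht => rw [map_add, map_add, map_add, hs, ht]
  exact AlgHom.ext fun x => h (δ x)

lemma lift2_congr {R : Type*} [Ring R] [Algebra k R] {u u' : S →ₐ[k] R} {v v' : T →ₐ[k] R}
    [Comm u v] [Comm u' v'] (hu : u = u') (hv : v = v') : lift2 u v = lift2 u' v' := by
  subst hu hv
  rfl

lemma conv_congr {R : Type*} [Ring R] [Algebra k R] {δ : U →ₐ[k] S ⊗[k] T} {u u' : S →ₐ[k] R}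
    {v v' : T →ₐ[k] R} [Comm u v] [Comm u' v'] (hu : u = u') (hv : v = v') :
    conv δ u v = conv δ u' v' := by
  subst hu hv
  rfl

end HomOperators

/-! ### Compatible maps correspond to linear maps into the twisted module -/

section Universal

variable {k H A : Type*} [Field k] [Ring H] [Algebra k H] [Ring A] [Algebra k A]
  {Q : QuasiHopfAlgebra k H} (B : BicomoduleAlgebra Q.toQuasiBialgebra A)
  {N P : Type*} [AddCommGroup N] [Module k N] [AddCommGroup P] [Module k P]

local infixl:72 " ⊲ " => act

variable (Q) in
/-- The left action `p ↦ p · S⁻¹(h)` obtained from a right action. -/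
def twistR (b : Hᵐᵒᵖ →ₐ[k] Module.End k P) : H →ₐ[k] Module.End k P :=
  AlgHom.ofLinearMap (b.toLinearMap ∘ₗ (MulOpposite.opLinearEquiv k).toLinearMap ∘ₗ
      Q.Sinv.toLinearMap)
    (by simp [Q.Sinv_one])
    (fun x y => by simp [Q.Sinv_mul])

lemma twistR_apply (b : Hᵐᵒᵖ →ₐ[k] Module.End k P) (h : H) :
    twistR Q b h = b (.op (Q.Sinv h)) := rfl

lemma twistR_S (b : Hᵐᵒᵖ →ₐ[k] Module.End k P) (h : H) : twistR Q b (Q.S h) = b (.op h) := by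
  simp [twistR_apply]

instance {S : Type*} [Ring S] [Algebra k S] (b : Hᵐᵒᵖ →ₐ[k] Module.End k P)
    (a : S →ₐ[k] Module.End k P) [Comm b a] : Comm (twistR Q b) a :=
  ⟨fun _ y => Comm.comm (u := b) _ y⟩

instance {S : Type*} [Ring S] [Algebra k S] (b : Hᵐᵒᵖ →ₐ[k] Module.End k P)
    (a : S →ₐ[k] Module.End k P) [Comm a b] : Comm a (twistR Q b) :=
  ⟨fun x _ => Comm.comm (v := b) x _⟩

/-- The compatibility `u · r(n) = r(u₀ · n) · u₋₁` of `r : N → P` with actions `a` and `a'` of `A`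
on `N` and `P` and a right action `b` of `H` on `P`. -/
def Compat (a : A →ₐ[k] Module.End k N) (a' : A →ₐ[k] Module.End k P)
    (b : Hᵐᵒᵖ →ₐ[k] Module.End k P) (r : N →ₗ[k] P) : Prop :=
  ∀ u, a' u ∘ₗ r = r ⊲ conv B.lam (post N b) (pre P a) u

/-- The action `u · p = u₀ · p · S⁻¹(u₋₁)`. -/
def twist (a : A →ₐ[k] Module.End k P) (b : Hᵐᵒᵖ →ₐ[k] Module.End k P) [Comm b a] :
    A →ₐ[k] Module.End k P :=
  conv B.lam (twistR Q b) a

/-- The operator `p ↦ q̃² · p · S⁻¹(q̃¹)`. -/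
def qOp (a : A →ₐ[k] Module.End k P) (b : Hᵐᵒᵖ →ₐ[k] Module.End k P) [Comm b a] :
    P →ₗ[k] P :=
  lift2 (twistR Q b) a (qElt B)

/-- The map `n ↦ r(p̃² · n) · p̃¹`. -/
def hat (a : A →ₐ[k] Module.End k N) (b : Hᵐᵒᵖ →ₐ[k] Module.End k P) (r : N →ₗ[k] P) :
    N →ₗ[k] P :=
  r ⊲ lift2 (post N b) (pre P a) (pElt B)

variable {B} {a : A →ₐ[k] Module.End k N} {a' : A →ₐ[k] Module.End k P}
  {b : Hᵐᵒᵖ →ₐ[k] Module.End k P} {r : N →ₗ[k] P}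

/-- Compatibility carries an operator a'(x) on the target over to the source as λ(x). Together with
the twisted right action this is exactly the pattern of `coadj`. -/
lemma Compat.lift2_comp [Comm b a'] (hr : Compat B a a' b r) (t w : H ⊗[k] A) :
    lift2 (twistR Q b) a' t ∘ₗ (r ⊲ lift2 (post N b) (pre P a) w)
      = r ⊲ lift2 (post N b) (pre P a) (coadj B w t) := by
  induction t using induction2 with
  | add s t hs ht => rw [map_add, LinearMap.add_comp, hs, ht, map_add, map_add, map_add]
  | tmul h x =>
    have e : a' x ∘ₗ (r ⊲ lift2 (post N b) (pre P a) w)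
        = (a' x ∘ₗ r) ⊲ lift2 (post N b) (pre P a) w :=
      ((intertwines_compL_post (mem_commutant_of_commute fun y =>
        (Comm.comm (u := b) y x).symm)).lift2 (intertwines_compL_pre _ a)).top w r
    rw [lift2_tmul, coadj_tmul, map_mul (lift2 _ _), map_mul (lift2 _ _), lift2_tmul, map_one, mul_one,
      act_mul, act_mul, ← conv_apply, ← hr, act_post, Module.End.mul_eq_comp, LinearMap.comp_assoc, e]
    rfl

/-- The relation between p̃(1 ⊗ u) and λ(u), transported to operators. -/
lemma Compat.hat_mem [Comm b a'] (hr : Compat B a a' b r) :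
    hat B a b r ∈ commutant a (twist B a' b) := fun u => by
  have e := hr.lift2_comp (B.lam u) (pElt B)
  rw [← pElt_mul_tmul, map_mul, act_mul, lift2_tmul, map_one, one_mul, act_pre] at e
  exact e.symm

lemma Compat.qOp_comp_hat [Comm b a'] (hr : Compat B a a' b r) :
    qOp B a' b ∘ₗ hat B a b r = r := by
  rw [qOp, hat, hr.lift2_comp, coadj_pElt_qElt, map_one, act_one]

lemma lift2_act_twist [Comm b a'] (w t : H ⊗[k] A) :
    (lift2 (twistR Q b) a' w : P →ₗ[k] P) ⊲ lift2 (post P b) (pre P (twist B a' b)) t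
      = lift2 (twistR Q b) a' (adj B w t) := by
  induction t using induction2 with
  | add s t hs ht => rw [map_add, map_add, hs, ht, map_add, map_add]
  | tmul h x =>
    rw [lift2_tmul, act_mul, adj_tmul, map_mul, map_mul, lift2_tmul, map_one, mul_one, twistR_S]
    rfl

-- With `Compat.qOp_comp_hat` and `hat_qOp` this makes `qOp` the universal compatible map: any
-- compatible r factors through it by exactly one A-linear map into the twisted module, namely its
-- hat.
variable (B) in
lemma compat_qOp (a' : A →ₐ[k] Module.End k P) (b : Hᵐᵒᵖ →ₐ[k] Module.End k P) [Comm b a'] :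
    Compat B (twist B a' b) a' b (qOp B a' b) := fun u => by
  rw [conv_apply, qOp, lift2_act_twist, ← tmul_mul_qElt, map_mul, lift2_tmul, map_one, one_mul]
  rfl

variable (B) in
lemma hat_qOp (a' : A →ₐ[k] Module.End k P) (b : Hᵐᵒᵖ →ₐ[k] Module.End k P) [Comm b a'] :
    hat B (twist B a' b) b (qOp B a' b) = LinearMap.id := by
  rw [hat, qOp, lift2_act_twist, adj_qElt_pElt, map_one]
  rfl

/-- A map `f` satisfying a compatibility is determined, after composition, by its hat. -/
lemma hat_comp_eq {M : Type*} [AddCommGroup M] [Module k M] {x y : M →ₗ[k] N}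
    (h : ∀ u, r ∘ₗ a u ∘ₗ x = r ∘ₗ a u ∘ₗ y) : hat B a b r ∘ₗ x = hat B a b r ∘ₗ y := by
  rw [hat]
  generalize pElt B = w
  induction w using induction2 with
  | add s t hs ht => rw [map_add, map_add, LinearMap.add_comp, LinearMap.add_comp, hs, ht]
  | tmul c u =>
    rw [lift2_tmul, act_mul, act_pre, act_post, LinearMap.comp_assoc, LinearMap.comp_assoc, h]
    rfl

end Universal

/-! ### Extending a compatible map to the tensor product with C -/

section Extension

variable {k H A : Type*} [Field k] [Ring H] [Algebra k H] [Ring A] [Algebra k A]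
  {Q : QuasiHopfAlgebra k H} (B : BicomoduleAlgebra Q.toQuasiBialgebra A)
  {N P : Type*} [AddCommGroup N] [Module k N] [AddCommGroup P] [Module k P]
  {C : Type*} [AddCommGroup C] [Module k C] (c : H →ₐ[k] Module.End k C)

local infixl:72 " ⊲ " => act

/-- The action of `A` on `N ⊗ C`, for an action of `A` on `N` and an action `c` of `H` on `C`. -/
def actT (a : A →ₐ[k] Module.End k N) : A →ₐ[k] Module.End k (N ⊗[k] C) :=
  conv B.rho (onL C a) (onR N c)

instance (a : A →ₐ[k] Module.End k N) {S : Type*} [Ring S] [Algebra k S]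
    (b : S →ₐ[k] Module.End k (N ⊗[k] C)) [Comm b (onL C a)] [Comm b (onR N c)] :
    Comm b (actT B c a) :=
  inferInstanceAs (Comm b (conv B.rho (onL C a) (onR N c)))

instance (a : A →ₐ[k] Module.End k N) {S : Type*} [Ring S] [Algebra k S]
    (b : S →ₐ[k] Module.End k (N ⊗[k] C)) [Comm (onL C a) b] [Comm (onR N c) b] :
    Comm (actT B c a) b :=
  inferInstanceAs (Comm (conv B.rho (onL C a) (onR N c)) b)

/-- The map `n ⊗ c ↦ r(θ² · n) · θ¹ ⊗ θ³ · c`, where `θ = Φ_{λ,ρ}⁻¹`. -/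
def extend (a : A →ₐ[k] Module.End k N) (b : Hᵐᵒᵖ →ₐ[k] Module.End k P) (r : N →ₗ[k] P) :
    N ⊗[k] C →ₗ[k] P ⊗[k] C :=
  r.rTensor C ⊲ lift3 (post _ (onL C b)) (pre _ (onL C a)) (pre _ (onR N c)) B.Φlr⁻¹.val

/-- The operator `Φ_{λ,ρ}` on `P ⊗ C`, twisted by the inverse of the antipode. -/
def lrOp (a : A →ₐ[k] Module.End k P) (b : Hᵐᵒᵖ →ₐ[k] Module.End k P) [Comm b a] :
    P ⊗[k] C →ₗ[k] P ⊗[k] C :=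
  lift3 (twistR Q (onL C b)) (onL C a) (onR P c) B.Φlr.val

variable {B c} {a : A →ₐ[k] Module.End k N} {a' : A →ₐ[k] Module.End k P}
  {b : Hᵐᵒᵖ →ₐ[k] Module.End k P} {r : N →ₗ[k] P}

lemma lrOp_injective [Comm b a'] : Function.Injective (lrOp B c a' b) := by
  refine Function.LeftInverse.injective
    (g := lift3 (twistR Q (onL C b)) (onL C a') (onR P c) B.Φlr⁻¹.val) fun x => ?_
  exact LinearMap.congr_fun (lift3_inv_mul (twistR Q (onL C b)) (onL C a') (onR P c) B.Φlr) x

lemma Compat.lift2_comp_rTensor [Comm b a'] (hr : Compat B a a' b r) (t : A ⊗[k] H) :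
    lift2 (onL C a') (onR P c) t ∘ₗ r.rTensor C
      = r.rTensor C ⊲ lift2 (conv B.lam (post _ (onL C b)) (pre _ (onL C a))) (pre _ (onR N c)) t := by
  induction t using induction2 with
  | add s t hs ht => rw [map_add, LinearMap.add_comp, hs, ht, map_add, map_add]
  | tmul u h =>
    have e₁ := ((intertwines_upHom_post (C := C) (N := N) b).conv
      (intertwines_upHom_pre a) B.lam).top u r
    have e₂ : onL C a' u ∘ₗ r.rTensor C = (a' u ∘ₗ r).rTensor C :=
      (LinearMap.rTensor_comp C (a' u) r).symm
    rw [lift2_tmul, lift2_tmul, Module.End.mul_eq_comp, LinearMap.comp_assoc,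
      ← rTensor_mem_onR r c h, ← LinearMap.comp_assoc, e₂, hr u, act_mul, act_pre]
    exact congrArg (· ∘ₗ onR N c h) e₁

/-- Φ_{λ,ρ}⁻¹ intertwines the two orders in which the left and right coactions of A can be applied,
which is what allows the extension to be iterated. -/
lemma Compat.compat_extend [Comm b a'] (hr : Compat B a a' b r) :
    Compat B (actT B c a) (actT B c a') (onL C b) (extend B c a b r) := fun u => by
  have e : actT B c a' u ∘ₗ extend B c a b r = (actT B c a' u ∘ₗ r.rTensor C)
      ⊲ lift3 (post _ (onL C b)) (pre _ (onL C a)) (pre _ (onR N c)) B.Φlr⁻¹.val :=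
    ((intertwines_compL_post (mem_commutant_of_commute fun y =>
      (Comm.comm (u := onL C b) (v := actT B c a') y u).symm)).lift2
      ((intertwines_compL_pre _ _).lift2 (intertwines_compL_pre _ _))).top _ _
  have e' := B.Φlr_intertwine_inv (post (N ⊗[k] C) (onL C b)) (pre (P ⊗[k] C) (onL C a))
    (pre (P ⊗[k] C) (onR N c)) u
  rw [e, actT, conv_apply, hr.lift2_comp_rTensor, ← conv_apply, ← act_mul, e', act_mul]
  exact congrArg (act _) (DFunLike.congr_fun (conv_congr rfl (pre_conv _ _ _).symm) u)

/-- Since `lrOp` is invertible, extension preserves injectivity of the hat, over a field even when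
iterated. This makes cancellation of `extend e` and `extend (extend e)` legitimate. -/
lemma Compat.hat_extend [Comm b a'] (hr : Compat B a a' b r) :
    hat B (actT B c a) (onL C b) (extend B c a b r)
      = lrOp B c a' b ∘ₗ (hat B a b r).rTensor C := by
  have e (t : H ⊗[k] (A ⊗[k] H)) (w : H ⊗[k] A) :
      lift3 (twistR Q (onL C b)) (onL C a') (onR P c) t
          ∘ₗ (r ⊲ lift2 (post N b) (pre P a) w).rTensor C
        = r.rTensor C ⊲ lift3 (post _ (onL C b)) (pre _ (onL C a)) (pre _ (onR N c))
          (coadjT B w t) := by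
    induction t using induction3 with
    | add s t hs ht => rw [map_add, LinearMap.add_comp, hs, ht, map_add, map_add, map_add]
    | tmul h x h' =>
      have e₁ := congrArg (LinearMap.rTensor C) (hr.lift2_comp (h ⊗ₜ x) w)
      have e₂ := ((intertwines_upHom_post (C := C) (N := N) b).lift2
        (intertwines_upHom_pre a)).top (coadj B w (h ⊗ₜ x)) r
      have e₃ := e₁.trans e₂
      rw [lift2_tmul, LinearMap.rTensor_comp, Module.End.mul_eq_comp, LinearMap.rTensor_comp,
        LinearMap.comp_assoc, LinearMap.coe_rTensorHom] at e₃
      rw [coadjT_tmul]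
      refine Eq.trans ?_ (congrArg (act _) (lift2_assoc _ _ _ _ _)).symm
      rw [act_mul, act_pre, ← coadj_tmul, ← e₃, lift2_tmul, lift2_tmul, Module.End.mul_eq_comp,
        Module.End.mul_eq_comp, LinearMap.comp_assoc, LinearMap.comp_assoc, ← rTensor_mem_onR]
      rfl
  have e' : lift2 (post (N ⊗[k] C) (onL C b)) (pre (P ⊗[k] C) (actT B c a)) (pElt B)
      = lift3 (post _ (onL C b)) (pre _ (onL C a)) (pre _ (onR N c)) (idT H B.rho (pElt B)) := by
    rw [lift2_idT_conv]
    exact DFunLike.congr_fun (lift2_congr rfl (pre_conv _ _ _)) _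
  rw [hat, extend, ← act_mul, e', ← map_mul, Φlr_inv_mul_pElt, lrOp, hat, e]

lemma extend_comp_left {P' : Type*} [AddCommGroup P'] [Module k P'] {b' : Hᵐᵒᵖ →ₐ[k] Module.End k P'}
    {f : P →ₗ[k] P'} (hf : f ∈ commutant b b') :
    extend B c a b' (f ∘ₗ r) = f.rTensor C ∘ₗ extend B c a b r := by
  have e := ((intertwines_compL_post (N := N ⊗[k] C) (rTensor_mem_onL (C := C) hf)).lift2
    ((intertwines_compL_pre _ (onL C a)).lift2 (intertwines_compL_pre _ (onR N c)))).top
    B.Φlr⁻¹.val (r.rTensor C)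
  rw [extend, LinearMap.rTensor_comp]
  exact e.symm

lemma extend_comp_right {N' : Type*} [AddCommGroup N'] [Module k N'] {a₀ : A →ₐ[k] Module.End k N'}
    {g : N' →ₗ[k] N} (hg : g ∈ commutant a₀ a) :
    extend B c a₀ b (r ∘ₗ g) = extend B c a b r ∘ₗ g.rTensor C := by
  have e₁ : Intertwines ⊤ (compR (P ⊗[k] C) (g.rTensor C)) (post (N ⊗[k] C) (onL C b))
      (post (N' ⊗[k] C) (onL C b)) := .of_top fun _ _ => rfl
  have e := (e₁.lift2 ((intertwines_compR_pre_top (rTensor_mem_onL (C := C) hg)).lift2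
    (intertwines_compR_pre_top (rTensor_mem_onR g c)))).top B.Φlr⁻¹.val (r.rTensor C)
  rw [extend, LinearMap.rTensor_comp]
  exact e.symm

lemma extend_mem_onL {S : Type*} [Ring S] [Algebra k S] {b₁ : S →ₐ[k] Module.End k N}
    {b₂ : S →ₐ[k] Module.End k P} [Comm b b₂] [Comm a b₁] (hr : r ∈ commutant b₁ b₂) :
    extend B c a b r ∈ commutant (onL C b₁) (onL C b₂) :=
  act_lift2_mem (fun _ h x => act_post_mem h _ x)
    (fun _ h x => act_lift2_mem (fun _ h x => act_pre_mem h _ x)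
      (fun _ h x => act_pre_mem h _ x) h x)
    (rTensor_mem_onL hr) _

lemma extend_mem_onR {S : Type*} [Ring S] [Algebra k S] {c' : S →ₐ[k] Module.End k C} [Comm c c'] :
    extend B c a b r ∈ commutant (onR N c') (onR P c') :=
  act_lift2_mem (fun _ h x => act_post_mem h _ x)
    (fun _ h x => act_lift2_mem (fun _ h x => act_pre_mem h _ x)
      (fun _ h x => act_pre_mem h _ x) h x)
    (rTensor_mem_onR r c') _

end Extension

/-! ### The right-hand side of the coassociativity axiom -/

section Coaction

set_option maxSynthPendingDepth 10

variable {k H A : Type*} [Field k] [Ring H] [Algebra k H] [Ring A] [Algebra k A]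
  {Q : QuasiHopfAlgebra k H} (B : BicomoduleAlgebra Q.toQuasiBialgebra A)
  {N P : Type*} [AddCommGroup N] [Module k N] [AddCommGroup P] [Module k P]
  {C : Type*} [AddCommGroup C] [Module k C] [Module H C] [Module Hᵐᵒᵖ C]

local infixl:72 " ⊲ " => act

attribute [local instance] SMulZeroClass.toSMul DistribSMul.toSMulZeroClass
  DistribMulAction.toDistribSMul Module.toDistribMulAction Module.End.instAlgebra
  Module.End.instRing Module.End.instSemiring

variable [IsScalarTower k H C] [IsScalarTower k Hᵐᵒᵖ C] [SMulCommClass H Hᵐᵒᵖ C]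
  (D : BimoduleCoalgebra Q.toQuasiBialgebra C)

variable (k H C) in
/-- The left action of `H` on `C`. -/
abbrev lact : H →ₐ[k] Module.End k C := Algebra.lsmul k k C

variable (k H C) in
/-- The right action of `H` on `C`. -/
abbrev ract : Hᵐᵒᵖ →ₐ[k] Module.End k C := Algebra.lsmul k k C

instance : Comm (lact k H C) (ract k H C) :=
  ⟨fun x y => LinearMap.ext fun c => smul_comm x y c⟩

instance : Comm (ract k H C) (lact k H C) :=
  ⟨fun x y => LinearMap.ext fun c => (smul_comm y x c).symm⟩

local notation "cₗ" => lact k H C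
local notation "cᵣ" => ract k H C

/-- `n ⊗ c ↦ n ⊗ c₁ ⊗ c₂`. -/
def comulT (N : Type*) [AddCommGroup N] [Module k N] : N ⊗[k] C →ₗ[k] (N ⊗[k] C) ⊗[k] C :=
  (TensorProduct.assoc k N C C).symm.toLinearMap ∘ₗ D.Δ.lTensor N

/-- `n ⊗ c ↦ ε(c) n`. -/
def counitT (N : Type*) [AddCommGroup N] [Module k N] : N ⊗[k] C →ₗ[k] N :=
  (TensorProduct.rid k N).toLinearMap ∘ₗ D.ε.lTensor N

@[simp] lemma counitT_tmul (n : N) (c : C) : counitT D N (n ⊗ₜ c) = D.ε c • n := by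
  simp [counitT]

/-- The operator `n ⊗ c ⊗ d ↦ y¹ n ⊗ y² c ⊗ y³ d`, where `y = Φ_ρ⁻¹`. -/
def rOp (a : A →ₐ[k] Module.End k N) : (N ⊗[k] C) ⊗[k] C →ₗ[k] (N ⊗[k] C) ⊗[k] C :=
  lift3 (onL C (onL C a)) (onL C (onR N cₗ)) (onR (N ⊗[k] C) cₗ) B.Φr⁻¹.val

/-- `n ↦ y¹ (x³ n)₀ ⊗ y² (x³ n)₁₁ x¹ ⊗ y³ (x³ n)₁₂ x²` with `y = Φ_ρ⁻¹` and `x = Φ_λ⁻¹`, for a map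
`r : n ↦ n₀ ⊗ n₁`. -/
def double (a : A →ₐ[k] Module.End k N) (a' : A →ₐ[k] Module.End k P) (r : N →ₗ[k] P ⊗[k] C) :
    N →ₗ[k] (P ⊗[k] C) ⊗[k] C :=
  rOp B a' ∘ₗ ((comulT D P ∘ₗ r) ⊲ lift3 (post N (onL C (onR P cᵣ)))
    (post N (onR (P ⊗[k] C) cᵣ)) (pre _ a) B.Φl⁻¹.val)

variable {B}

lemma comulT_natural (f : N →ₗ[k] P) :
    comulT D P ∘ₗ f.rTensor C = (f.rTensor C).rTensor C ∘ₗ comulT D N := by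
  refine TensorProduct.ext' fun n c => ?_
  simp only [comulT, LinearMap.comp_apply, LinearMap.rTensor_tmul, LinearMap.lTensor_tmul,
    LinearEquiv.coe_coe]
  generalize D.Δ c = t
  induction t using induction2 with
  | add s t hs ht => simp only [tmul_add, map_add, hs, ht]
  | tmul c d => simp

lemma comulT_mem_onL {S : Type*} [Ring S] [Algebra k S] (a : S →ₐ[k] Module.End k N) :
    comulT D N ∈ commutant (onL C a) (onL C (onL C a)) := fun x => comulT_natural D (a x)

lemma comulT_mem_onR :
    comulT D N ∈ commutant (onR N cₗ) (conv Q.Δ (onL C (onR N cₗ)) (onR (N ⊗[k] C) cₗ)) := fun h => by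
  refine TensorProduct.ext' fun n c => ?_
  have e := D.Δ_left h c
  have e' (s t) : (TensorProduct.assoc k N C C).symm (n ⊗ₜ opT (lop C) (lop C) s t)
      = lift2 (onL C (onR N cₗ)) (onR (N ⊗[k] C) cₗ) s
        ((TensorProduct.assoc k N C C).symm (n ⊗ₜ t)) := by
    induction s using induction2 with
    | add s s' hs hs' => simp only [map_add, LinearMap.add_apply, tmul_add, hs, hs']
    | tmul x y =>
    induction t using induction2 with
    | add s s' hs hs' => simp only [map_add, tmul_add, hs, hs']
    | tmul c d => rw [lift2_tmul]; rfl
  simp only [comulT, LinearMap.comp_apply, LinearEquiv.coe_coe, conv_apply]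
  rw [LinearMap.lTensor_tmul, ← e', ← e]
  rfl

lemma comulT_mem_actT (a : A →ₐ[k] Module.End k N) :
    comulT D N ∈ commutant (actT B cₗ a)
      (conv B.rho (onL C (onL C a)) (conv Q.Δ (onL C (onR N cₗ)) (onR (N ⊗[k] C) cₗ))) :=
  comp_conv_mem (comulT_mem_onL D a) (comulT_mem_onR D) _

lemma act_post_post (s : N →ₗ[k] (P ⊗[k] C) ⊗[k] C) (t : H ⊗[k] H) :
    s ⊲ lift2 (post N (onL C (onR P cᵣ))) (post N (onR (P ⊗[k] C) cᵣ)) t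
      = (TensorProduct.assoc k P C C).symm.toLinearMap ∘ₗ
        (opT (rop C) (rop C) t).lTensor P ∘ₗ (TensorProduct.assoc k P C C).toLinearMap ∘ₗ s := by
  induction t using induction2 with
  | add t t' ht ht' =>
    rw [map_add, map_add, ht, ht', map_add, LinearMap.lTensor_add, LinearMap.add_comp,
      LinearMap.comp_add]
  | tmul x y =>
    rw [lift2_tmul, act_mul, act_post, act_post, ← LinearMap.comp_assoc, ← LinearMap.comp_assoc,
      ← LinearMap.comp_assoc]
    refine congrArg (· ∘ₗ s) ?_
    ext p c d
    rfl

lemma intertwines_comulT : Intertwines ⊤ (compL N (comulT D P)) (post N (onR P cᵣ))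
    (conv Q.Δ (post N (onL C (onR P cᵣ))) (post N (onR (P ⊗[k] C) cᵣ))) :=
  .of_top fun h r => by
    have e : comulT D P ∘ₗ onR P cᵣ (.op h) = (TensorProduct.assoc k P C C).symm.toLinearMap ∘ₗ
        (opT (rop C) (rop C) (Q.Δ h)).lTensor P ∘ₗ (TensorProduct.assoc k P C C).toLinearMap ∘ₗ
          comulT D P := by
      refine TensorProduct.ext' fun p c => ?_
      have e := D.Δ_right h c
      simp only [comulT, LinearMap.comp_apply, LinearEquiv.coe_coe, LinearMap.lTensor_tmul,
        LinearEquiv.apply_symm_apply]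
      exact congrArg (fun t => (TensorProduct.assoc k P C C).symm (p ⊗ₜ t)) e
    rw [conv_apply, act_post_post]
    exact congrArg (· ∘ₗ r) e

lemma rOp_commute {S : Type*} [Ring S] [Algebra k S] (a : A →ₐ[k] Module.End k N)
    (b : S →ₐ[k] Module.End k ((N ⊗[k] C) ⊗[k] C)) [Comm b (onL C (onL C a))]
    [Comm b (onL C (onR N cₗ))] [Comm b (onR (N ⊗[k] C) cₗ)] :
    rOp B a ∈ commutant b b :=
  mem_commutant_of_commute fun x =>
    (Comm.comm (u := b) (v := lift3 (onL C (onL C a)) (onL C (onR N cₗ)) (onR (N ⊗[k] C) cₗ))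
      x B.Φr⁻¹.val).symm

lemma rOp_natural {a : A →ₐ[k] Module.End k N} {a' : A →ₐ[k] Module.End k P} {f : N →ₗ[k] P}
    (hf : f ∈ commutant a a') :
    (f.rTensor C).rTensor C ∘ₗ rOp B a = rOp (H := H) (C := C) B a' ∘ₗ (f.rTensor C).rTensor C :=
  comp_lift2 (rTensor_mem_onL (rTensor_mem_onL hf))
    (comp_lift2 (rTensor_mem_onL (rTensor_mem_onR f _)) (rTensor_mem_onR _ _)) _

variable {a : A →ₐ[k] Module.End k N} {a' : A →ₐ[k] Module.End k P}

lemma double_comp_left {P' : Type*} [AddCommGroup P'] [Module k P'] {a₁ : A →ₐ[k] Module.End k P'}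
    {f : P →ₗ[k] P'} (hf : f ∈ commutant a' a₁) (r : N →ₗ[k] P ⊗[k] C) :
    double B D a a₁ (f.rTensor C ∘ₗ r) = (f.rTensor C).rTensor C ∘ₗ double B D a a' r := by
  have e := ((intertwines_compL_post (N := N) (rTensor_mem_onL (rTensor_mem_onR f cᵣ))).lift2
    ((intertwines_compL_post (rTensor_mem_onR (f.rTensor C) cᵣ)).lift2
      (intertwines_compL_pre _ a))).top B.Φl⁻¹.val (comulT D P ∘ₗ r)
  rw [double, double, ← LinearMap.comp_assoc, comulT_natural, LinearMap.comp_assoc,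
    ← LinearMap.comp_assoc _ (rOp B a'), rOp_natural hf, LinearMap.comp_assoc]
  exact congrArg (_ ∘ₗ ·) e.symm

lemma double_comp_right {N' : Type*} [AddCommGroup N'] [Module k N']
    {a₀ : A →ₐ[k] Module.End k N'} {g : N' →ₗ[k] N} (hg : g ∈ commutant a₀ a)
    (r : N →ₗ[k] P ⊗[k] C) :
    double B D a₀ a' (r ∘ₗ g) = double B D a a' r ∘ₗ g := by
  have e₁ (b : Hᵐᵒᵖ →ₐ[k] Module.End k ((P ⊗[k] C) ⊗[k] C)) :
    Intertwines ⊤ (compR _ g) (post N b) (post N' b) := .of_top fun _ _ => rfl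
  have e := ((e₁ (onL C (onR P cᵣ))).lift2 ((e₁ (onR (P ⊗[k] C) cᵣ)).lift2
      (intertwines_compR_pre_top hg))).top B.Φl⁻¹.val (comulT D P ∘ₗ r)
  rw [double, double, LinearMap.comp_assoc, ← LinearMap.comp_assoc g]
  exact congrArg (_ ∘ₗ ·) e.symm

end Coaction

/-! ### Coassociativity and counit deduced from the mixed law -/

section Coassociativity

set_option maxSynthPendingDepth 10

set_option linter.unusedSectionVars false

attribute [local instance] SMulZeroClass.toSMul DistribSMul.toSMulZeroClass
  DistribMulAction.toDistribSMul Module.toDistribMulAction Module.End.instAlgebra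
  Module.End.instRing Module.End.instSemiring

variable {k H A : Type*} [Field k] [Ring H] [Algebra k H] [Ring A] [Algebra k A]
  {Q : QuasiHopfAlgebra k H} {B : BicomoduleAlgebra Q.toQuasiBialgebra A}
  {N P V M : Type*} [AddCommGroup N] [Module k N] [AddCommGroup P] [Module k P] [AddCommGroup M]
  [AddCommGroup V] [Module k V] [Module k M]
  {C : Type*} [AddCommGroup C] [Module k C] [Module H C] [Module Hᵐᵒᵖ C]

local infixl:72 " ⊲ " => act
local notation "cₗ" => lact k H C
local notation "cᵣ" => ract k H C
local infixl:75 " ◇ " => conv (QuasiBialgebra.Δ (QuasiHopfAlgebra.toQuasiBialgebra Q))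
local infixl:75 " ◁ " => conv (BicomoduleAlgebra.lam B)
local infixl:75 " ▷ " => conv (BicomoduleAlgebra.rho B)
local notation "Θ⁻(" u "," v "," w ")" =>
  lift3 u v w (Units.val (Inv.inv (BicomoduleAlgebra.Φlr B)))
local notation "Υ⁻(" u "," v "," w ")" =>
  lift3 u v w (Units.val (Inv.inv (BicomoduleAlgebra.Φr B)))
local notation "Ψ⁻(" u "," v "," w ")" =>
  lift3 u v w (Units.val (Inv.inv (BicomoduleAlgebra.Φl B)))
local notation "Φ(" u "," v "," w ")" =>
  lift3 u v w (Units.val (QuasiBialgebra.Φ (QuasiHopfAlgebra.toQuasiBialgebra Q)))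
local notation "Φ⁻(" u "," v "," w ")" =>
  lift3 u v w (Units.val (Inv.inv (QuasiBialgebra.Φ (QuasiHopfAlgebra.toQuasiBialgebra Q))))

variable [IsScalarTower k H C] [IsScalarTower k Hᵐᵒᵖ C] [SMulCommClass H Hᵐᵒᵖ C]
  (D : BimoduleCoalgebra Q.toQuasiBialgebra C)

section

lemma comp_lift3_eq_act {X S T U : Type*} [AddCommGroup X] [Module k X] [Ring S] [Algebra k S]
    [Ring T] [Algebra k T] [Ring U] [Algebra k U] (f : N →ₗ[k] X) (u : S →ₐ[k] Module.End k N)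
    (v : T →ₐ[k] Module.End k N) (w : U →ₐ[k] Module.End k N) [Comm u v] [Comm u w] [Comm v w]
    (t : S ⊗[k] (T ⊗[k] U)) :
    f ∘ₗ lift3 u v w t = f ⊲ lift3 (pre X u) (pre X v) (pre X w) t := by
  induction t using induction3 with
  | add s t hs ht => rw [map_add, LinearMap.comp_add, hs, ht, map_add, map_add]
  | tmul x y z =>
    rw [lift2_tmul, lift2_tmul, lift2_tmul, lift2_tmul, act_mul, act_mul]
    rfl

variable {a : A →ₐ[k] Module.End k N} {a' : A →ₐ[k] Module.End k P}
  {b : Hᵐᵒᵖ →ₐ[k] Module.End k P} {r : N →ₗ[k] P}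

lemma Compat.lift3_comp_rTensor [Comm b a'] (hr : Compat B a a' b r) (t : A ⊗[k] (H ⊗[k] H)) :
    lift3 (onL C (onL C a')) (onL C (onR P cₗ)) (onR (P ⊗[k] C) cₗ) t ∘ₗ (r.rTensor C).rTensor C
      = (r.rTensor C).rTensor C ⊲ lift3 (post _ (onL C (onL C b)) ◁ pre _ (onL C (onL C a)))
        (pre _ (onL C (onR N cₗ))) (pre _ (onR (N ⊗[k] C) cₗ)) t := by
  induction t using induction3 with
  | add s t hs ht => rw [map_add, LinearMap.add_comp, hs, ht, map_add, map_add]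
  | tmul u h h' =>
    have e₁ := ((intertwines_upHom_post (C := C) (N := N) b).conv
      (intertwines_upHom_pre a) B.lam).top u r
    have e₂ := ((intertwines_upHom_post (C := C) (N := N ⊗[k] C) (onL C b)).conv
      (intertwines_upHom_pre (onL C a)) B.lam).top u (r.rTensor C)
    have e₃ : onL C (onL C a') u ∘ₗ (r.rTensor C).rTensor C
        = (r.rTensor C).rTensor C ⊲ (post _ (onL C (onL C b)) ◁ pre _ (onL C (onL C a))) u := by
      refine Eq.trans ?_ e₂
      refine (LinearMap.rTensor_comp C _ _).symm.trans (congrArg (LinearMap.rTensor C) ?_)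
      refine Eq.trans ?_ e₁
      exact (LinearMap.rTensor_comp C _ _).symm.trans (congrArg (LinearMap.rTensor C) (hr u))
    rw [lift2_tmul, lift2_tmul, lift2_tmul, lift2_tmul, Module.End.mul_eq_comp,
      Module.End.mul_eq_comp, LinearMap.comp_assoc, LinearMap.comp_assoc,
      ← rTensor_mem_onR _ cₗ h', ← LinearMap.comp_assoc (onR _ cₗ h'),
      ← rTensor_mem_onL (rTensor_mem_onR r cₗ) h, ← LinearMap.comp_assoc, ← LinearMap.comp_assoc,
      e₃, act_mul, act_mul, act_pre, act_pre]

/-- Extending once and then comultiplying C agrees with comultiplying first and extending over both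
copies. After both sides are written as words acting on r ⊗ id ⊗ id, this is the pentagon mixing Φ_ρ
and Φ_{λ,ρ}. -/
lemma Compat.rOp_comulT_extend [Comm b a'] (hr : Compat B a a' b r) :
    rOp B a' ∘ₗ comulT D P ∘ₗ extend B cₗ a b r
      = extend B cₗ (actT B cₗ a) (onL C b) (extend B cₗ a b r) ∘ₗ rOp B a ∘ₗ comulT D N := by
  obtain ⟨f, hf⟩ : ∃ f, f = (r.rTensor C).rTensor C := ⟨_, rfl⟩
  have h₁ : Intertwines ⊤ (compL (N ⊗[k] C) (comulT D P)) (post _ (onL C b))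
      (post _ (onL C (onL C b))) := intertwines_compL_post (comulT_mem_onL D b)
  have h₂ : Intertwines ⊤ (compR ((P ⊗[k] C) ⊗[k] C) (comulT D N)) (post _ (onL C (onL C b)))
    (post _ (onL C (onL C b))) := .of_top fun _ _ => rfl
  have h₃ : Intertwines ⊤ (compR ((P ⊗[k] C) ⊗[k] C) (comulT D N))
      (pre _ (onL C (onR N cₗ)) ◇ pre _ (onR (N ⊗[k] C) cₗ)) (pre _ (onR N cₗ)) := by
    rw [← pre_conv]
    exact intertwines_compR_pre_top (comulT_mem_onR D)
  have e₁ : comulT D P ∘ₗ extend B cₗ a b r = (f ⊲ Θ⁻(post _ (onL C (onL C b)),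
      pre _ (onL C (onL C a)), pre _ (onL C (onR N cₗ)) ◇ pre _ (onR (N ⊗[k] C) cₗ))) ∘ₗ comulT D N := by
    have e := (h₁.lift2 ((intertwines_compL_pre _ (onL C a)).lift2
      (intertwines_compL_pre _ (onR N cₗ)))).top B.Φlr⁻¹.val (r.rTensor C)
    have e' := (h₂.lift2 ((intertwines_compR_pre_top (comulT_mem_onL D a)).lift2
      h₃)).top B.Φlr⁻¹.val f
    refine e.trans (Eq.trans ?_ e'.symm)
    exact congrArg (act · _) ((comulT_natural D r).trans (congrArg (· ∘ₗ _) hf.symm))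
  have e₂ : rOp B a' ∘ₗ (f ⊲ Θ⁻(post _ (onL C (onL C b)),
      pre _ (onL C (onL C a)), pre _ (onL C (onR N cₗ)) ◇ pre _ (onR (N ⊗[k] C) cₗ)))
        = f ⊲ (Υ⁻(post _ (onL C (onL C b)) ◁ pre _ (onL C (onL C a)),
            pre _ (onL C (onR N cₗ)), pre _ (onR (N ⊗[k] C) cₗ)) *
          Θ⁻(post _ (onL C (onL C b)), pre _ (onL C (onL C a)),
            pre _ (onL C (onR N cₗ)) ◇ pre _ (onR (N ⊗[k] C) cₗ))) := by
    have e := ((intertwines_compL_post (N := (N ⊗[k] C) ⊗[k] C)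
      (rOp_commute (B := B) (C := C) a' (onL C (onL C b)))).lift2
      ((intertwines_compL_pre _ (onL C (onL C a))).lift2
        ((intertwines_compL_pre _ (onL C (onR N cₗ))).conv
          (intertwines_compL_pre _ (onR (N ⊗[k] C) cₗ)) Q.Δ))).top B.Φlr⁻¹.val f
    refine e.trans (Eq.trans ?_ (act_mul f _ _).symm)
    refine congrArg (act · _) (Eq.trans ?_ ((hr.lift3_comp_rTensor B.Φr⁻¹.val).trans
      (congrArg (act · _) hf.symm)))
    exact congrArg (rOp B a' ∘ₗ ·) hf
  have e₃ : extend B cₗ (actT B cₗ a) (onL C b) (extend B cₗ a b r)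
      = f ⊲ (Θ⁻(post _ (onL C (onL C b)), pre _ (onL C (onL C a)), pre _ (onL C (onR N cₗ)))
        * Θ⁻(post _ (onL C (onL C b)), pre _ (onL C (onL C a)) ▷ pre _ (onL C (onR N cₗ)),
          pre _ (onR (N ⊗[k] C) cₗ))) := by
    have e := ((intertwines_upHom_post (C := C) (N := N ⊗[k] C) (onL C b)).lift2
      ((intertwines_upHom_pre (onL C a)).lift2 (intertwines_upHom_pre (onR N cₗ)))).top
      B.Φlr⁻¹.val (r.rTensor C)
    have e' : pre ((P ⊗[k] C) ⊗[k] C) (onL C (actT B cₗ a))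
        = pre _ (onL C (onL C a)) ▷ pre _ (onL C (onR N cₗ)) := by
      rw [← pre_conv, ← comp_conv]
      rfl
    rw [act_mul, hf]
    refine (congrArg (act · _) e).trans (congrArg (act _) ?_)
    exact DFunLike.congr_fun (lift2_congr rfl (lift2_congr e' rfl)) _
  have e₄ : Θ⁻(post ((N ⊗[k] C) ⊗[k] C) (onL C (onL C b)), pre _ (onL C (onL C a)),
      pre _ (onL C (onR N cₗ))) * Θ⁻(post _ (onL C (onL C b)),
        pre _ (onL C (onL C a)) ▷ pre _ (onL C (onR N cₗ)), pre _ (onR (N ⊗[k] C) cₗ))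
      * Υ⁻(pre _ (onL C (onL C a)), pre _ (onL C (onR N cₗ)), pre _ (onR (N ⊗[k] C) cₗ))
      = Υ⁻(post _ (onL C (onL C b)) ◁ pre _ (onL C (onL C a)),
          pre _ (onL C (onR N cₗ)), pre _ (onR (N ⊗[k] C) cₗ)) *
        Θ⁻(post _ (onL C (onL C b)), pre _ (onL C (onL C a)),
          pre _ (onL C (onR N cₗ)) ◇ pre _ (onR (N ⊗[k] C) cₗ)) :=
    congrArg Units.val (pentagon_inv (B.Φlr_pentagon_right _ _ _ _))
  rw [e₁, ← LinearMap.comp_assoc, e₂, ← e₄, act_mul, ← e₃, ← LinearMap.comp_assoc, rOp,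
    comp_lift3_eq_act]

end

section

lemma Compat.rTensor {a : A →ₐ[k] Module.End k N} {a' : A →ₐ[k] Module.End k P}
    {b : Hᵐᵒᵖ →ₐ[k] Module.End k P} {t : N →ₗ[k] P} (ht : Compat B a a' b t) :
    Compat B (onL C a) (onL C a') (onL C b) (t.rTensor C) := fun u => by
  refine Eq.trans ?_ (((intertwines_upHom_post (C := C) (N := N) b).conv
      (intertwines_upHom_pre a) B.lam).top u t)
  exact (LinearMap.rTensor_comp C _ _).symm.trans (congrArg (LinearMap.rTensor C) (ht u))

/-- Precomposing r with a compatible t creates a factor u_[-1] acting on the target of t. It can be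
moved to the target of r only when r commutes with the right H-actions, hence the restriction to the
commutant. -/
lemma Compat.intertwines_compR {a : A →ₐ[k] Module.End k N} {a' : A →ₐ[k] Module.End k P}
    {b : Hᵐᵒᵖ →ₐ[k] Module.End k P} [Comm a' b] {b' : Hᵐᵒᵖ →ₐ[k] Module.End k V} {t : N →ₗ[k] P}
    (ht : Compat B a a' b t) :
    Intertwines (commutant b b') (compR V t) (pre V a') (post N b' ◁ pre V a) := fun u r hr =>
  ⟨act_pre_mem hr a' u, (congrArg (r ∘ₗ ·) (ht u)).trans
    (((intertwines_compL_post hr).conv (intertwines_compL_pre r a) B.lam).top u t)⟩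

variable {a : A →ₐ[k] Module.End k N} {m : A →ₐ[k] Module.End k P}
  {b : Hᵐᵒᵖ →ₐ[k] Module.End k P} {e : N →ₗ[k] P} {t : N →ₗ[k] N ⊗[k] C}

/-- Both copies of Φ_{λ,ρ}⁻¹ are pulled outside, so that `extend e ∘ t` appears unbroken and the
mixed law can be substituted for it. -/
lemma Compat.extend_comp_extend (ht : Compat B a (actT B cₗ a) (onR N cᵣ) t) :
    extend B cₗ (actT B cₗ a) (onL C b) (extend B cₗ a b e) ∘ₗ extend B cₗ a (onR N cᵣ) t
      = (extend B cₗ a b e ∘ₗ t).rTensor C ⊲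
        (Θ⁻(post _ (onL C (onL C b)), post _ (onL C (onR P cᵣ)) ◁ pre _ (onL C a),
            pre _ (onR N cₗ))
          * Θ⁻(post _ (onL C (onR P cᵣ)), pre _ (onL C a), pre _ (onR N cₗ))) := by
  have h₁ : extend B cₗ a b e ∈ commutant (onR N cᵣ) (onR P cᵣ) := extend_mem_onR
  have h₂ : extend B cₗ (actT B cₗ a) (onL C b) (extend B cₗ a b e) ∈
    commutant (onL C (onR N cᵣ)) (onL C (onR P cᵣ)) := extend_mem_onL h₁
  have e₁ := ((intertwines_compL_post (N := N ⊗[k] C) h₂).lift2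
    ((intertwines_compL_pre _ (onL C a)).lift2
      (intertwines_compL_pre _ (onR N cₗ)))).top B.Φlr⁻¹.val (t.rTensor C)
  have e₂ := ((intertwines_compR_post (t.rTensor C) (onL C (onL C b))).lift2
    ((ht.rTensor (C := C)).intertwines_compR.lift2
      (intertwines_compR_pre (rTensor_mem_onR t cₗ)))) B.Φlr⁻¹.val _ (rTensor_mem_onL h₁)
  rw [act_mul]
  refine e₁.trans (congrArg (act · _) ?_)
  refine e₂.2.trans (congrArg (act · _) ?_)
  exact (LinearMap.rTensor_comp C _ _).symm

lemma intertwines_comulT_rTensor : Intertwines ⊤ (compL N ((comulT D P).rTensor C))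
    (post N (onL C (onR P cᵣ)))
    (post N (onL C (onL C (onR P cᵣ))) ◇ post N (onL C (onR (P ⊗[k] C) cᵣ))) :=
  .of_top fun h r => by
    have e := (intertwines_comulT D (N := P ⊗[k] C)).top h LinearMap.id
    have e' := ((intertwines_upHom_post (C := C) (N := P ⊗[k] C) (onL C (onR P cᵣ))).conv
      (intertwines_upHom_post (onR (P ⊗[k] C) cᵣ)) Q.Δ).top h (comulT D P)
    have e₁ : (comulT D P).rTensor C ∘ₗ onL C (onR P cᵣ) (.op h) = (comulT D P).rTensor C ⊲
        (post _ (onL C (onL C (onR P cᵣ))) ◇ post _ (onL C (onR (P ⊗[k] C) cᵣ))) h :=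
      (LinearMap.rTensor_comp C _ _).symm.trans ((congrArg (LinearMap.rTensor C) e).trans e')
    have h₂ (b : Hᵐᵒᵖ →ₐ[k] Module.End k (((P ⊗[k] C) ⊗[k] C) ⊗[k] C)) :
      Intertwines ⊤ (compR _ r) (post _ b) (post N b) := .of_top fun _ _ => rfl
    exact (congrArg (· ∘ₗ r) e₁).trans
      (((h₂ (onL C (onL C (onR P cᵣ)))).conv (h₂ (onL C (onR (P ⊗[k] C) cᵣ))) Q.Δ).top h _)

variable {m : A →ₐ[k] Module.End k M} {e : N →ₗ[k] M ⊗[k] C}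

/-- The mixed law is used twice, before and after the pentagon of Φ_λ and Φ_{λ,ρ}. The pentagon
recombines the two copies of Φ_{λ,ρ}⁻¹, next to a Φ_λ⁻¹, into a single `extend e`. -/
lemma extend_extend_comp_extend_comp (ht : Compat B a (actT B cₗ a) (onR N cᵣ) t)
    (he : extend B cₗ a (onR M cᵣ) e ∘ₗ t = double B D a m e) :
    extend B cₗ (actT B cₗ a) (onL C (onR M cᵣ)) (extend B cₗ a (onR M cᵣ) e) ∘ₗ
        extend B cₗ a (onR N cᵣ) t ∘ₗ t
      = (rOp B m).rTensor C ∘ₗ (((comulT D M).rTensor C ∘ₗ double B D a m e) ⊲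
        Ψ⁻(post _ (onL C (onL C (onR M cᵣ))), post _ (onL C (onR (M ⊗[k] C) cᵣ)),
          post _ (onR ((M ⊗[k] C) ⊗[k] C) cᵣ) ◁ pre _ a)) := by
  have e₁ : (double B D a m e).rTensor C = (rOp B m).rTensor C ∘ₗ
      (((comulT D M).rTensor C ∘ₗ e.rTensor C) ⊲
        Ψ⁻(post _ (onL C (onL C (onR M cᵣ))), post _ (onL C (onR (M ⊗[k] C) cᵣ)),
          pre _ (onL C a))) := by
    rw [← LinearMap.rTensor_comp, double]
    refine (LinearMap.rTensor_comp C _ _).trans ?_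
    exact congrArg ((rOp B m).rTensor C ∘ₗ ·) (((intertwines_upHom_post (C := C) (N := N) (onL C (onR M cᵣ))).lift2
      ((intertwines_upHom_post (onR (M ⊗[k] C) cᵣ)).lift2
        (intertwines_upHom_pre a))).top B.Φl⁻¹.val (comulT D M ∘ₗ e))
  have h₁ : Intertwines ⊤ (compL (N ⊗[k] C) ((rOp B m).rTensor C))
      (post _ (onL C (onL C (onR M cᵣ)))) (post _ (onL C (onL C (onR M cᵣ)))) :=
    intertwines_compL_post (rTensor_mem_onL (rOp_commute m _))
  have h₂ : Intertwines ⊤ (compL (N ⊗[k] C) ((rOp B m).rTensor C))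
      (post _ (onL C (onR (M ⊗[k] C) cᵣ))) (post _ (onL C (onR (M ⊗[k] C) cᵣ))) :=
    intertwines_compL_post (rTensor_mem_onL (rOp_commute m _))
  have e₂ (x) := ((h₁.lift2 (((h₂.conv (intertwines_compL_pre _ (onL C a)) B.lam)).lift2
    (intertwines_compL_pre _ (onR N cₗ)))).top B.Φlr⁻¹.val x)
  have e₃ (x) := ((h₂.lift2 ((intertwines_compL_pre _ (onL C a)).lift2
    (intertwines_compL_pre _ (onR N cₗ)))).top B.Φlr⁻¹.val x)
  have e₄ : Ψ⁻(post (N ⊗[k] C) (onL C (onL C (onR M cᵣ))),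
          post _ (onL C (onR (M ⊗[k] C) cᵣ)), pre _ (onL C a)) *
        Θ⁻(post _ (onL C (onL C (onR M cᵣ))),
          post _ (onL C (onR (M ⊗[k] C) cᵣ)) ◁ pre _ (onL C a), pre _ (onR N cₗ)) *
        Θ⁻(post _ (onL C (onR (M ⊗[k] C) cᵣ)), pre _ (onL C a), pre _ (onR N cₗ))
      = Θ⁻(post (N ⊗[k] C) (onL C (onL C (onR M cᵣ))) ◇ post _ (onL C (onR (M ⊗[k] C) cᵣ)),
          pre _ (onL C a), pre _ (onR N cₗ)) *
        Ψ⁻(post (N ⊗[k] C) (onL C (onL C (onR M cᵣ))), post _ (onL C (onR (M ⊗[k] C) cᵣ)),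
          pre _ (onL C a) ▷ pre _ (onR N cₗ)) :=
    congrArg Units.val (pentagon_inv (B.Φlr_pentagon_left _ _ _ _))
  have e₅ : ((comulT D M).rTensor C ∘ₗ e.rTensor C) ⊲
      Θ⁻(post (N ⊗[k] C) (onL C (onL C (onR M cᵣ))) ◇ post _ (onL C (onR (M ⊗[k] C) cᵣ)),
          pre _ (onL C a), pre _ (onR N cₗ))
      = (comulT D M).rTensor C ∘ₗ extend B cₗ a (onR M cᵣ) e :=
    (((intertwines_comulT_rTensor D).lift2 ((intertwines_compL_pre _ (onL C a)).lift2
      (intertwines_compL_pre _ (onR N cₗ)))).top B.Φlr⁻¹.val _).symm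
  have e₆ : pre (((M ⊗[k] C) ⊗[k] C) ⊗[k] C) (actT B cₗ a)
      = pre _ (onL C a) ▷ pre _ (onR N cₗ) := pre_conv _ _ _
  have e₆' : Ψ⁻(post (N ⊗[k] C) (onL C (onL C (onR M cᵣ))),
      post _ (onL C (onR (M ⊗[k] C) cᵣ)), pre _ (actT B cₗ a))
      = Ψ⁻(post (N ⊗[k] C) (onL C (onL C (onR M cᵣ))),
      post _ (onL C (onR (M ⊗[k] C) cᵣ)), pre _ (onL C a) ▷ pre _ (onR N cₗ)) :=
    DFunLike.congr_fun (lift2_congr rfl (lift2_congr rfl e₆)) B.Φl⁻¹.val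
  have e₇ := ((intertwines_compR_post t (onL C (onL C (onR M cᵣ)))).lift2
    ((intertwines_compR_post t (onL C (onR (M ⊗[k] C) cᵣ))).lift2 ht.intertwines_compR))
    B.Φl⁻¹.val ((comulT D M).rTensor C ∘ₗ extend B cₗ a (onR M cᵣ) e)
    (commutant_comp (rTensor_mem_onR _ cᵣ) extend_mem_onR)
  have e₈ := congrArg (· ∘ₗ t) (ht.extend_comp_extend (e := e) (b := onR M cᵣ))
  refine e₈.trans ?_
  rw [he, e₁, act_mul]
  refine (congrArg (· ∘ₗ t) ((congrArg (act · _) (e₂ _).symm).trans ((e₃ _).symm.trans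
    (congrArg ((rOp B m).rTensor C ∘ₗ ·) (?_ : _ =
      ((comulT D M).rTensor C ∘ₗ extend B cₗ a (onR M cᵣ) e) ⊲
        Ψ⁻(post (N ⊗[k] C) (onL C (onL C (onR M cᵣ))),
          post _ (onL C (onR (M ⊗[k] C) cᵣ)), pre _ (actT B cₗ a))))))).trans ?_
  · refine (congrArg (act _) e₄).trans ?_
    rw [act_mul, e₅, e₆']
  · refine congrArg ((rOp B m).rTensor C ∘ₗ ·) (e₇.2.trans (congrArg (act · _) ?_))
    exact congrArg ((comulT D M).rTensor C ∘ₗ ·) he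

end

section

/-- The associativity isomorphism `N ⊗ (C ⊗ (C ⊗ C)) ≃ ((N ⊗ C) ⊗ C) ⊗ C`. -/
def assoc₄ (k N C : Type*) [Field k] [AddCommGroup N] [Module k N] [AddCommGroup C] [Module k C] :
    N ⊗[k] (C ⊗[k] (C ⊗[k] C)) ≃ₗ[k] ((N ⊗[k] C) ⊗[k] C) ⊗[k] C :=
  (TensorProduct.assoc k N C (C ⊗[k] C)).symm ≪≫ₗ (TensorProduct.assoc k (N ⊗[k] C) C C).symm

lemma comulT_comulT_tmul (n : N) (c : C) :
    comulT D (N ⊗[k] C) (comulT D N (n ⊗ₜ c)) = assoc₄ k N C (n ⊗ₜ D.Δ.lTensor C (D.Δ c)) := by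
  simp only [comulT, LinearMap.comp_apply, LinearMap.lTensor_tmul, LinearEquiv.coe_coe]
  generalize D.Δ c = t
  induction t using induction2 with
  | add s t hs ht => simp only [tmul_add, map_add, hs, ht]
  | tmul c d =>
    rw [LinearMap.lTensor_tmul, TensorProduct.assoc_symm_tmul, LinearMap.lTensor_tmul]
    rfl

lemma comulT_rTensor_comulT_tmul (n : N) (c : C) :
    (comulT D N).rTensor C (comulT D N (n ⊗ₜ c))
      = assoc₄ k N C (n ⊗ₜ TensorProduct.assoc k C C C (D.Δ.rTensor C (D.Δ c))) := by
  simp only [comulT, LinearMap.comp_apply, LinearMap.lTensor_tmul, LinearEquiv.coe_coe]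
  generalize D.Δ c = t
  induction t using induction2 with
  | add s t hs ht => simp only [tmul_add, map_add, hs, ht]
  | tmul c d =>
    rw [LinearMap.rTensor_tmul, TensorProduct.assoc_symm_tmul, LinearMap.rTensor_tmul]
    simp only [LinearMap.comp_apply, LinearMap.lTensor_tmul, LinearEquiv.coe_coe]
    generalize D.Δ c = t
    induction t using induction2 with
    | add s t hs ht => simp only [tmul_add, add_tmul, map_add, hs, ht]
    | tmul c d => rfl

lemma lift3_lact_assoc₄ (t : H ⊗[k] (H ⊗[k] H)) (n : N) (x : C ⊗[k] (C ⊗[k] C)) :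
    lift3 (onL C (onL C (onR N cₗ))) (onL C (onR (N ⊗[k] C) cₗ)) (onR ((N ⊗[k] C) ⊗[k] C) cₗ) t
        (assoc₄ k N C (n ⊗ₜ x))
      = assoc₄ k N C (n ⊗ₜ opT (lop C) (opT (lop C) (lop C)) t x) := by
  induction t using induction3 with
  | add s t hs ht => simp only [map_add, LinearMap.add_apply, tmul_add, hs, ht]
  | tmul u v w =>
    induction x using induction3 with
    | add s t hs ht => simp only [map_add, tmul_add, hs, ht]
    | tmul c d e =>
      rw [lift2_tmul, lift2_tmul]
      rfl

lemma act_lift3_post_assoc₄ {r : N →ₗ[k] ((P ⊗[k] C) ⊗[k] C) ⊗[k] C} (t : H ⊗[k] (H ⊗[k] H))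
    {n : N} {p : P} {x : C ⊗[k] (C ⊗[k] C)} (h : r n = assoc₄ k P C (p ⊗ₜ x)) :
    (r ⊲ lift3 (post _ (onL C (onL C (onR P cᵣ)))) (post _ (onL C (onR (P ⊗[k] C) cᵣ)))
        (post _ (onR ((P ⊗[k] C) ⊗[k] C) cᵣ)) t) n
      = assoc₄ k P C (p ⊗ₜ opT (rop C) (opT (rop C) (rop C)) t x) := by
  induction t using induction3 with
  | add s t hs ht => simp only [map_add, LinearMap.add_apply, tmul_add, hs, ht]
  | tmul u v w =>
    rw [lift2_tmul, lift2_tmul, act_mul, act_mul, act_post, act_post, act_post,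
      LinearMap.comp_apply, LinearMap.comp_apply, LinearMap.comp_apply, h]
    clear h
    induction x using induction3 with
    | add s t hs ht => simp only [map_add, tmul_add, hs, ht]
    | tmul c d e => rfl

lemma comulT_comp_comulT :
    comulT D (N ⊗[k] C) ∘ₗ comulT D N
      = Φ(onL C (onL C (onR N cₗ)), onL C (onR (N ⊗[k] C) cₗ), onR ((N ⊗[k] C) ⊗[k] C) cₗ) ∘ₗ
        (((comulT D N).rTensor C ∘ₗ comulT D N) ⊲ Φ⁻(post _ (onL C (onL C (onR N cᵣ))),
          post _ (onL C (onR (N ⊗[k] C) cᵣ)), post _ (onR ((N ⊗[k] C) ⊗[k] C) cᵣ))) := by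
  refine TensorProduct.ext' fun n c => ?_
  rw [LinearMap.comp_apply, LinearMap.comp_apply, comulT_comulT_tmul,
    act_lift3_post_assoc₄ (r := (comulT D N).rTensor C ∘ₗ comulT D N) _
      (comulT_rTensor_comulT_tmul D n c), lift3_lact_assoc₄, D.coassoc]

variable {a : A →ₐ[k] Module.End k N} {m : A →ₐ[k] Module.End k M} {e : N →ₗ[k] M ⊗[k] C}
  {t : N →ₗ[k] N ⊗[k] C}

/-- The extension passes through the comultiplication by `Compat.rOp_comulT_extend`, and then the
mixed law applies inside. -/
lemma Compat.extend_extend_comp_double (hr : Compat B a (actT B cₗ m) (onR M cᵣ) e)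
    (he : extend B cₗ a (onR M cᵣ) e ∘ₗ t = double B D a m e) :
    extend B cₗ (actT B cₗ a) (onL C (onR M cᵣ)) (extend B cₗ a (onR M cᵣ) e) ∘ₗ double B D a a t
      = double B D a (actT B cₗ m) (double B D a m e) := by
  have h₀ : extend B cₗ a (onR M cᵣ) e ∈ commutant (onR N cᵣ) (onR (M ⊗[k] C) cᵣ) := extend_mem_onR
  have h₁ : extend B cₗ (actT B cₗ a) (onL C (onR M cᵣ)) (extend B cₗ a (onR M cᵣ) e) ∘ₗ rOp B a ∈
      commutant (onL C (onR N cᵣ)) (onL C (onR (M ⊗[k] C) cᵣ)) :=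
    commutant_comp (extend_mem_onL h₀) (rOp_commute a _)
  have h₂ : extend B cₗ (actT B cₗ a) (onL C (onR M cᵣ)) (extend B cₗ a (onR M cᵣ) e) ∘ₗ rOp B a ∈
      commutant (onR (N ⊗[k] C) cᵣ) (onR ((M ⊗[k] C) ⊗[k] C) cᵣ) :=
    commutant_comp extend_mem_onR (rOp_commute a _)
  have e₁ := ((intertwines_compL_post (N := N) h₁).lift2 ((intertwines_compL_post h₂).lift2
    (intertwines_compL_pre _ a))).top B.Φl⁻¹.val (comulT D N ∘ₗ t)
  have h₃ : Intertwines ⊤ (compL N (rOp (C := C) B (actT B cₗ m))) (post _ (onL C (onR (M ⊗[k] C) cᵣ)))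
    (post _ (onL C (onR (M ⊗[k] C) cᵣ))) := intertwines_compL_post (rOp_commute _ _)
  have h₄ : Intertwines ⊤ (compL N (rOp (C := C) B (actT B cₗ m)))
    (post _ (onR ((M ⊗[k] C) ⊗[k] C) cᵣ)) (post _ (onR ((M ⊗[k] C) ⊗[k] C) cᵣ)) :=
    intertwines_compL_post (rOp_commute _ _)
  have e₂ := (h₃.lift2 (h₄.lift2 (intertwines_compL_pre _ a))).top B.Φl⁻¹.val
    (comulT D (M ⊗[k] C) ∘ₗ double B D a m e)
  refine e₁.trans (Eq.trans ?_ e₂.symm)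
  refine congrArg (act · _) ?_
  have e₃ := congrArg (· ∘ₗ t) (hr.rOp_comulT_extend D)
  refine Eq.trans ?_ (e₃.symm.trans ?_)
  · rfl
  · exact congrArg (fun x => rOp B (actT B cₗ m) ∘ₗ comulT D (M ⊗[k] C) ∘ₗ x) he

end

/-! ### Comparison of the two threefold expressions, and cancellation -/

section

local notation "c₁" => onL C (onL C (onR M (lact k H C)))
local notation "c₂" => onL C (onR (M ⊗[k] C) (lact k H C))
local notation "c₃" => onR ((M ⊗[k] C) ⊗[k] C) (lact k H C)
local notation "r₁" => onL C (onL C (onR M (ract k H C)))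
local notation "r₂" => onL C (onR (M ⊗[k] C) (ract k H C))
local notation "r₃" => onR ((M ⊗[k] C) ⊗[k] C) (ract k H C)

variable {a : A →ₐ[k] Module.End k N} {m : A →ₐ[k] Module.End k M} {e : N →ₗ[k] M ⊗[k] C}
  {t : N →ₗ[k] N ⊗[k] C}

local notation "m₁" => onL C (onL C (onL C m))

lemma comp_act_post_post_pre {X : Type*} [AddCommGroup X] [Module k X] {f : P →ₗ[k] X}
    {b b' : Hᵐᵒᵖ →ₐ[k] Module.End k P} {d d' : Hᵐᵒᵖ →ₐ[k] Module.End k X} [Comm b b'] [Comm d d']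
    (h : f ∈ commutant b d) (h' : f ∈ commutant b' d') (x : N →ₗ[k] P) (w : H ⊗[k] (H ⊗[k] A)) :
    f ∘ₗ (x ⊲ lift3 (post N b) (post N b') (pre P a) w)
      = (f ∘ₗ x) ⊲ lift3 (post N d) (post N d') (pre X a) w :=
  ((intertwines_compL_post h).lift2 ((intertwines_compL_post h').lift2
    (intertwines_compL_pre f a))).top w x

lemma double_double : double B D a (actT B cₗ m) (double B D a m e)
    = (Υ⁻(m₁ ▷ c₁, c₂, c₃) * Υ⁻(m₁, c₁, c₂ ◇ c₃)) ∘ₗ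
      ((comulT D (M ⊗[k] C) ∘ₗ comulT D M ∘ₗ e) ⊲
        (Ψ⁻(post N r₁, post N r₂ ◇ post N r₃, pre _ a) * Ψ⁻(post N r₂, post N r₃, pre _ a))) := by
  have e₁ : comulT D (M ⊗[k] C) ∘ₗ rOp B m = Υ⁻(m₁, c₁, c₂ ◇ c₃) ∘ₗ comulT D (M ⊗[k] C) :=
    comp_lift2 (comulT_mem_onL D _) (comp_lift2 (comulT_mem_onL D _) (comulT_mem_onR D)) _
  have e₂ := ((intertwines_compL_post (N := N) (comulT_mem_onL D (onR M cᵣ))).lift2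
    ((intertwines_comulT D).lift2 (intertwines_compL_pre _ a))).top B.Φl⁻¹.val (comulT D M ∘ₗ e)
  have h₂ : Υ⁻(m₁, c₁, c₂ ◇ c₃) ∈ commutant r₂ r₂ := mem_commutant_of_commute fun x =>
    (Comm.comm (u := r₂) (v := lift3 m₁ c₁ (c₂ ◇ c₃)) x B.Φr⁻¹.val).symm
  have h₃ : Υ⁻(m₁, c₁, c₂ ◇ c₃) ∈ commutant r₃ r₃ := mem_commutant_of_commute fun x =>
    (Comm.comm (u := r₃) (v := lift3 m₁ c₁ (c₂ ◇ c₃)) x B.Φr⁻¹.val).symm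
  have e₃ : rOp B (actT B cₗ m) = Υ⁻(m₁ ▷ c₁, c₂, c₃) := by
    refine DFunLike.congr_fun (lift2_congr ?_ rfl) B.Φr⁻¹.val
    rw [← comp_conv, ← comp_conv]
    rfl
  rw [Module.End.mul_eq_comp, LinearMap.comp_assoc, ← e₃, act_mul,
    comp_act_post_post_pre h₂ h₃, double]
  refine congrArg (fun x => rOp B (actT B cₗ m) ∘ₗ (x ⊲ _)) ?_
  rw [double, ← LinearMap.comp_assoc, e₁, LinearMap.comp_assoc]
  exact congrArg (_ ∘ₗ ·) e₂

lemma rOp_rTensor_double : (rOp B m).rTensor C ∘ₗ (((comulT D M).rTensor C ∘ₗ double B D a m e) ⊲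
      Ψ⁻(post N r₁, post N r₂, post N r₃ ◁ pre _ a))
    = (Υ⁻(m₁, c₁, c₂) * Υ⁻(m₁, c₁ ◇ c₂, c₃)) ∘ₗ
      (((comulT D M).rTensor C ∘ₗ comulT D M ∘ₗ e) ⊲
        (Ψ⁻(post N r₁ ◇ post N r₂, post N r₃, pre _ a) *
          Ψ⁻(post N r₁, post N r₂, post N r₃ ◁ pre _ a))) := by
  have e₀ : onL C (onL C (onR M cₗ) ◇ onR (M ⊗[k] C) cₗ) = c₁ ◇ c₂ := by
    rw [← comp_conv]
  have e₁ : (comulT D M).rTensor C ∘ₗ rOp B m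
      = Υ⁻(m₁, c₁ ◇ c₂, c₃) ∘ₗ (comulT D M).rTensor C :=
    comp_lift2 (rTensor_mem_onL (comulT_mem_onL D _))
      (comp_lift2 (e₀ ▸ rTensor_mem_onL (comulT_mem_onR D)) (rTensor_mem_onR _ _)) _
  have e₂ := ((intertwines_comulT_rTensor D (N := N)).lift2
    ((intertwines_compL_post (rTensor_mem_onR (comulT D M) cᵣ)).lift2
      (intertwines_compL_pre _ a))).top B.Φl⁻¹.val (comulT D M ∘ₗ e)
  have h (b : Hᵐᵒᵖ →ₐ[k] Module.End k (((M ⊗[k] C) ⊗[k] C) ⊗[k] C)) [Comm b m₁] [Comm b c₁]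
      [Comm b c₂] [Comm b c₃] : Υ⁻(m₁, c₁ ◇ c₂, c₃) ∈ commutant b b :=
    mem_commutant_of_commute fun x =>
      (Comm.comm (u := b) (v := lift3 m₁ (c₁ ◇ c₂) c₃) x B.Φr⁻¹.val).symm
  have e₃ : (rOp B m).rTensor C = Υ⁻(m₁, c₁, c₂) := by
    refine (map_lift2 (Module.End.rTensorAlgHom k ((M ⊗[k] C) ⊗[k] C) C) (onL C (onL C m))
      (lift2 (onL C (onR M cₗ)) (onR (M ⊗[k] C) cₗ)) B.Φr⁻¹.val).trans ?_
    refine DFunLike.congr_fun (lift2_congr rfl ?_) B.Φr⁻¹.val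
    exact AlgHom.ext fun x => map_lift2 (Module.End.rTensorAlgHom k ((M ⊗[k] C) ⊗[k] C) C)
      (onL C (onR M cₗ)) (onR (M ⊗[k] C) cₗ) x
  have e₄ := ((intertwines_compL_post (N := N) (h r₁)).lift2
    ((intertwines_compL_post (N := N) (h r₂)).lift2
      ((intertwines_compL_post (N := N) (h r₃)).conv (intertwines_compL_pre _ a) B.lam))).top
    B.Φl⁻¹.val
  rw [Module.End.mul_eq_comp, LinearMap.comp_assoc, ← e₃, act_mul]
  refine congrArg ((rOp B m).rTensor C ∘ₗ ·) (Eq.trans ?_ (e₄ _).symm)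
  refine congrArg (act · _) ?_
  rw [double, ← LinearMap.comp_assoc, e₁, LinearMap.comp_assoc]
  exact congrArg (_ ∘ₗ ·) e₂

/-- Coassociativity of C produces Φ on the left and Φ⁻¹ on the right. The Φ_ρ-pentagon absorbs the
former and the Φ_λ-pentagon the latter. -/
lemma double_double_eq : double B D a (actT B cₗ m) (double B D a m e)
    = (rOp B m).rTensor C ∘ₗ (((comulT D M).rTensor C ∘ₗ double B D a m e) ⊲
      Ψ⁻(post N r₁, post N r₂, post N r₃ ◁ pre _ a)) := by
  have e₁ : Υ⁻(m₁ ▷ c₁, c₂, c₃) * Υ⁻(m₁, c₁, c₂ ◇ c₃) * Φ(c₁, c₂, c₃)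
      = Υ⁻(m₁, c₁, c₂) * Υ⁻(m₁, c₁ ◇ c₂, c₃) := by
    have h := congrArg (· * lift3U c₁ c₂ c₃ Q.Φ) (pentagon_inv (B.Φr_pentagon m₁ c₁ c₂ c₃)).symm
    simp only [inv_mul_cancel_right] at h
    exact congrArg Units.val h
  have e₂ : Φ⁻(post N r₁, post N r₂, post N r₃) *
      Ψ⁻(post N r₁, post N r₂ ◇ post N r₃, pre _ a) * Ψ⁻(post N r₂, post N r₃, pre _ a)
      = Ψ⁻(post N r₁ ◇ post N r₂, post N r₃, pre _ a) *
          Ψ⁻(post N r₁, post N r₂, post N r₃ ◁ pre _ a) :=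
    congrArg Units.val (pentagon_inv (B.Φl_pentagon (post N r₁) (post N r₂) (post N r₃) (pre _ a)))
  have h (b : Hᵐᵒᵖ →ₐ[k] Module.End k (((M ⊗[k] C) ⊗[k] C) ⊗[k] C)) :
      Intertwines ⊤ (compR _ e) (post _ b) (post N b) := .of_top fun _ _ => rfl
  have e₃ := ((h r₁).lift2 ((h r₂).lift2 (h r₃))).top Q.Φ⁻¹.val
    ((comulT D M).rTensor C ∘ₗ comulT D M)
  have e₄ := congrArg (· ∘ₗ e) (comulT_comp_comulT D (N := M))
  have e₅ : comulT D (M ⊗[k] C) ∘ₗ comulT D M ∘ₗ e = Φ(c₁, c₂, c₃) ∘ₗ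
      (((comulT D M).rTensor C ∘ₗ comulT D M ∘ₗ e) ⊲ Φ⁻(post N r₁, post N r₂, post N r₃)) :=
    e₄.trans (congrArg (Φ(c₁, c₂, c₃) ∘ₗ ·) e₃)
  have h' (b : Hᵐᵒᵖ →ₐ[k] Module.End k (((M ⊗[k] C) ⊗[k] C) ⊗[k] C)) [Comm b c₁]
      [Comm b c₂] [Comm b c₃] : Φ(c₁, c₂, c₃) ∈ commutant b b :=
    mem_commutant_of_commute fun x => (Comm.comm (u := b) (v := lift3 c₁ c₂ c₃) x Q.Φ.val).symm
  have e₆ := ((intertwines_compL_post (N := N) (h' r₁)).lift2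
    (((intertwines_compL_post (N := N) (h' r₂)).conv (intertwines_compL_post (N := N) (h' r₃))
      Q.Δ).lift2 (intertwines_compL_pre _ a))).top B.Φl⁻¹.val
  rw [double_double, rOp_rTensor_double, ← e₁, ← e₂, e₅, Module.End.mul_eq_comp _ Φ(c₁, c₂, c₃),
    LinearMap.comp_assoc]
  refine congrArg (_ ∘ₗ ·) ?_
  rw [act_mul, act_mul, act_mul]
  refine (congrArg (act · _) (e₆ _).symm).trans ?_
  exact (comp_act_post_post_pre (h' r₂) (h' r₃) _ _).symm

omit [Module H C] [IsScalarTower k H C] [Module Hᵐᵒᵖ C] [IsScalarTower k Hᵐᵒᵖ C]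
  [SMulCommClass H Hᵐᵒᵖ C] in
/-- A map `f` satisfying a compatibility can be cancelled, as soon as its hat is injective. -/
lemma eq_of_comp_eq {a : A →ₐ[k] Module.End k P} {b : Hᵐᵒᵖ →ₐ[k] Module.End k V} {f : P →ₗ[k] V}
    (hf : Function.Injective (hat B a b f)) {w : A →ₐ[k] HomOp k N P} {w' : A →ₐ[k] HomOp k N V}
    (hw : Intertwines ⊤ (compL N f) w w') {x y : N →ₗ[k] P} (hx : ∀ u, a u ∘ₗ x = x ⊲ w u)
    (hy : ∀ u, a u ∘ₗ y = y ⊲ w u) (h : f ∘ₗ x = f ∘ₗ y) : x = y := by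
  -- The hat is a combination of the maps f ∘ a u, so agreement of f ∘ x and f ∘ y is needed after
  -- every a u. It follows because x and y transform by the same rule, which f carries to its
  -- target.
  have e : hat B a b f ∘ₗ x = hat B a b f ∘ₗ y := hat_comp_eq fun u => by
    rw [hx, hy]
    exact (hw.top u x).trans ((congrArg (act · _) h).trans (hw.top u y).symm)
  exact LinearMap.ext fun n => hf (LinearMap.congr_fun e n)

/-- The two sides of the coassociativity axiom obey the same rule under A, as cancellation requires;
`Compat.actT_comp_double` is the other side. -/
lemma Compat.actT_comp_extend_comp (ht : Compat B a (actT B cₗ a) (onR N cᵣ) t) (u : A) :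
    actT B cₗ (actT B cₗ a) u ∘ₗ extend B cₗ a (onR N cᵣ) t ∘ₗ t
      = (extend B cₗ a (onR N cᵣ) t ∘ₗ t) ⊲
        (post _ (onL C (onR N cᵣ)) ◁ (post _ (onR (N ⊗[k] C) cᵣ) ◁ pre _ a)) u := by
  have e := (((intertwines_compR_post t (onL C (onR N cᵣ))).conv ht.intertwines_compR B.lam) u
    (extend B cₗ a (onR N cᵣ) t) extend_mem_onR).2
  rw [← LinearMap.comp_assoc, ht.compat_extend u]
  exact e

lemma Compat.actT_comp_double {a' : A →ₐ[k] Module.End k P} {r : N →ₗ[k] P ⊗[k] C}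
    (hr : Compat B a (actT B cₗ a') (onR P cᵣ) r) (u : A) :
    actT B cₗ (actT B cₗ a') u ∘ₗ double B D a a' r = double B D a a' r ⊲
      (post _ (onL C (onR P cᵣ)) ◁ (post _ (onR (P ⊗[k] C) cᵣ) ◁ pre _ a)) u := by
  have e₁ : actT B cₗ (actT B cₗ a') u * rOp B a'
      = rOp B a' * (onL C (onL C a') ▷ (onL C (onR P cₗ) ◇ onR (P ⊗[k] C) cₗ)) u := by
    refine Eq.trans ?_ (B.Φr_intertwine_inv (onL C (onL C a')) (onL C (onR P cₗ))
      (onR (P ⊗[k] C) cₗ) u)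
    refine congrArg (· * _) (DFunLike.congr_fun (conv_congr ?_ rfl) u)
    exact comp_conv _ _ _ _
  have h (b : Hᵐᵒᵖ →ₐ[k] Module.End k ((P ⊗[k] C) ⊗[k] C)) [Comm b (onL C (onL C a'))]
      [Comm b (onL C (onR P cₗ))] [Comm b (onR (P ⊗[k] C) cₗ)] :
      (onL C (onL C a') ▷ (onL C (onR P cₗ) ◇ onR (P ⊗[k] C) cₗ)) u ∈ commutant b b :=
    mem_commutant_of_commute fun x =>
      (Comm.comm (u := b) (v := onL C (onL C a') ▷ (onL C (onR P cₗ) ◇ onR (P ⊗[k] C) cₗ)) x u).symm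
  have e₂ := comp_act_post_post_pre (a := a) (h (onL C (onR P cᵣ))) (h (onR (P ⊗[k] C) cᵣ))
    (comulT D P ∘ₗ r) B.Φl⁻¹.val
  have e₃ : (onL C (onL C a') ▷ (onL C (onR P cₗ) ◇ onR (P ⊗[k] C) cₗ)) u ∘ₗ comulT D P ∘ₗ r
      = (comulT D P ∘ₗ r) ⊲ ((post _ (onL C (onR P cᵣ)) ◇ post _ (onR (P ⊗[k] C) cᵣ)) ◁ pre _ a) u := by
    rw [← LinearMap.comp_assoc, ← comulT_mem_actT D a' u, LinearMap.comp_assoc, hr u]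
    exact ((intertwines_comulT D).conv (intertwines_compL_pre _ a) B.lam).top u r
  have e₄ := ((intertwines_compL_post (N := N) (rOp_commute a' (onL C (onR P cᵣ)))).conv
    ((intertwines_compL_post (rOp_commute (B := B) a' (onR (P ⊗[k] C) cᵣ))).conv
      (intertwines_compL_pre _ a) B.lam) B.lam).top u
  rw [double, ← LinearMap.comp_assoc]
  refine (congrArg (· ∘ₗ _) e₁).trans ?_
  refine Eq.trans (congrArg (rOp B a' ∘ₗ ·) (e₂.trans ?_)) (e₄ _)
  rw [e₃, ← act_mul, ← act_mul]
  exact congrArg (act _) (B.Φl_intertwine_inv _ _ _ u)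

/-- Both sides of coassociativity agree after `extend (extend e)`, where only e and the mixed law
intervene; that map can then be cancelled. -/
lemma Compat.extend_comp_self [Comm (onR M cᵣ) (actT B cₗ m)]
    (hr : Compat B a (actT B cₗ m) (onR M cᵣ) e)
    (hinj : Function.Injective (hat B a (onR M cᵣ) e))
    (ht : Compat B a (actT B cₗ a) (onR N cᵣ) t)
    (he : extend B cₗ a (onR M cᵣ) e ∘ₗ t = double B D a m e) :
    extend B cₗ a (onR N cᵣ) t ∘ₗ t = double B D a a t := by
  have h₁ : extend B cₗ (actT B cₗ a) (onL C (onR M cᵣ)) (extend B cₗ a (onR M cᵣ) e) ∘ₗ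
        extend B cₗ a (onR N cᵣ) t ∘ₗ t
      = extend B cₗ (actT B cₗ a) (onL C (onR M cᵣ)) (extend B cₗ a (onR M cᵣ) e) ∘ₗ
        double B D a a t := by
    rw [extend_extend_comp_extend_comp D ht he, hr.extend_extend_comp_double D he, double_double_eq]
  have h₂ : Function.Injective (hat B (actT B cₗ (actT B cₗ a)) (onL C (onL C (onR M cᵣ)))
      (extend B cₗ (actT B cₗ a) (onL C (onR M cᵣ)) (extend B cₗ a (onR M cᵣ) e))) := by
    rw [hr.compat_extend.hat_extend, hr.hat_extend]
    exact lrOp_injective.comp (Module.Flat.rTensor_preserves_injective_linearMap _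
      (lrOp_injective.comp (Module.Flat.rTensor_preserves_injective_linearMap _ hinj)))
  have h₃ : extend B cₗ (actT B cₗ a) (onL C (onR M cᵣ)) (extend B cₗ a (onR M cᵣ) e) ∈
      commutant (onL C (onR N cᵣ)) (onL C (onR (M ⊗[k] C) cᵣ)) := extend_mem_onL extend_mem_onR
  exact eq_of_comp_eq h₂ ((intertwines_compL_post h₃).conv
    ((intertwines_compL_post (b' := onR ((M ⊗[k] C) ⊗[k] C) cᵣ) extend_mem_onR).conv
      (intertwines_compL_pre _ a) B.lam) B.lam) ht.actT_comp_extend_comp (ht.actT_comp_double D) h₁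

end

/-! ### Counits -/

section

lemma counit_apply {R : Type*} [Ring R] [Algebra k R] (h : H) : Q.counit R h = Q.ε h • (1 : R) := by
  rw [← Q.counit_mul, mul_one]

lemma intertwines_counit {G : (N →ₗ[k] P) →ₗ[k] (V →ₗ[k] M)} {u : H →ₐ[k] HomOp k N P}
    (h : ∀ x r, G (r ⊲ u x) = Q.ε x • G r) : Intertwines ⊤ G u (Q.counit _) :=
  .of_top fun x r => by rw [h, counit_apply, map_smul, act_one]

lemma mem_commutant_counit {f : N →ₗ[k] P} {u : H →ₐ[k] Module.End k N}
    (h : ∀ x, f ∘ₗ u x = Q.ε x • f) : f ∈ commutant u (Q.counit _) := fun x => by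
  rw [h, counit_apply]
  rfl

lemma counitT_natural (f : N →ₗ[k] P) : counitT D P ∘ₗ f.rTensor C = f ∘ₗ counitT D N :=
  TensorProduct.ext' fun n c => by simp

lemma counitT_mem_onL {S : Type*} [Ring S] [Algebra k S] (a : S →ₐ[k] Module.End k N) :
    counitT D N ∈ commutant (onL C a) a := fun x => counitT_natural D (a x)

lemma counitT_comp_lact (h : H) : counitT D N ∘ₗ onR N cₗ h = Q.ε h • counitT D N :=
  TensorProduct.ext' fun n c => by
    refine (counitT_tmul D n (h • c)).trans ?_
    rw [D.ε_left, mul_smul, LinearMap.smul_apply, counitT_tmul]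

lemma counitT_comp_ract (h : H) : counitT D N ∘ₗ onR N cᵣ (.op h) = Q.ε h • counitT D N :=
  TensorProduct.ext' fun n c => by
    refine (counitT_tmul D n (MulOpposite.op h • c)).trans ?_
    rw [D.ε_right, mul_comm, mul_smul, LinearMap.smul_apply, counitT_tmul]

lemma counitT_rTensor_comp_lact (h : H) :
    (counitT D N).rTensor C ∘ₗ onL C (onR N cₗ) h = Q.ε h • (counitT D N).rTensor C :=
  (LinearMap.rTensor_comp C _ _).symm.trans
    ((congrArg (LinearMap.rTensor C) (counitT_comp_lact D h)).trans (LinearMap.rTensor_smul _ _ _))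

lemma counitT_rTensor_comp_ract (h : H) :
    (counitT D N).rTensor C ∘ₗ onL C (onR N cᵣ) (.op h) = Q.ε h • (counitT D N).rTensor C :=
  (LinearMap.rTensor_comp C _ _).symm.trans
    ((congrArg (LinearMap.rTensor C) (counitT_comp_ract D h)).trans (LinearMap.rTensor_smul _ _ _))

lemma counitT_comp_comulT : counitT D (N ⊗[k] C) ∘ₗ comulT D N = LinearMap.id :=
  TensorProduct.ext' fun n c => by
    have e (t : C ⊗[k] C) : counitT D (N ⊗[k] C) ((TensorProduct.assoc k N C C).symm (n ⊗ₜ t))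
        = n ⊗ₜ TensorProduct.rid k C (D.ε.lTensor C t) := by
      induction t using induction2 with
      | add s t hs ht => simp only [tmul_add, map_add, hs, ht]
      | tmul c d => simp
    exact (e (D.Δ c)).trans (congrArg _ (D.counit_right c))

lemma counitT_rTensor_comp_comulT : (counitT D N).rTensor C ∘ₗ comulT D N = LinearMap.id :=
  TensorProduct.ext' fun n c => by
    have e (t : C ⊗[k] C) : (counitT D N).rTensor C ((TensorProduct.assoc k N C C).symm (n ⊗ₜ t))
        = n ⊗ₜ TensorProduct.lid k C (D.ε.rTensor C t) := by
      induction t using induction2 with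
      | add s t hs ht => simp only [tmul_add, map_add, hs, ht]
      | tmul c d => simp [smul_tmul]
    exact (e (D.Δ c)).trans (congrArg _ (D.counit_left c))

variable {a : A →ₐ[k] Module.End k N} {a' : A →ₐ[k] Module.End k P}

lemma counitT_mem_actT : counitT D N ∈ commutant (actT B cₗ a) a := by
  have e := comp_conv_mem (counitT_mem_onL D a) (mem_commutant_counit (counitT_comp_lact D)) B.rho
  rwa [B.conv_rho_counit] at e

lemma counitT_comp_extend {b : Hᵐᵒᵖ →ₐ[k] Module.End k P} {r : N →ₗ[k] P} :
    counitT D P ∘ₗ extend B cₗ a b r = r ∘ₗ counitT D N := by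
  have e₁ := ((intertwines_compL_post (N := N ⊗[k] C) (counitT_mem_onL D b)).lift2
    ((intertwines_compL_pre _ (onL C a)).lift2 (intertwines_compL_pre _ (onR N cₗ)))).top
    B.Φlr⁻¹.val (r.rTensor C)
  have h₁ : Intertwines ⊤ (compR P (counitT D N)) (post N b) (post _ b) := .of_top fun _ _ => rfl
  have h₂ : Intertwines ⊤ (compR P (counitT D N)) (Q.counit _) (pre P (onR N cₗ)) :=
    .of_top fun h r => by
      rw [counit_apply, map_smul, act_one, map_smul]
      exact ((congrArg (r ∘ₗ ·) (counitT_comp_lact D h)).trans (LinearMap.comp_smul _ _ _)).symm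
  have e₂ := (h₁.lift2 ((intertwines_compR_pre_top (counitT_mem_onL D a)).lift2 h₂)).top
    B.Φlr⁻¹.val r
  refine e₁.trans ((congrArg (act · _) (counitT_natural D r)).trans (e₂.symm.trans ?_))
  exact congrArg (fun x => (r ⊲ x) ∘ₗ counitT D N)
    (lift3_inv_eq_one _ _ _ (B.Φlr_counit_right (post N b) (pre P a)))

lemma counitT_rTensor_comp_extend {r : N →ₗ[k] P ⊗[k] C} :
    (counitT D P).rTensor C ∘ₗ extend B cₗ a (onR P cᵣ) r = (counitT D P ∘ₗ r).rTensor C := by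
  have h : Intertwines ⊤ (compL (N ⊗[k] C) ((counitT D P).rTensor C)) (post _ (onL C (onR P cᵣ)))
      (Q.counit _) := intertwines_counit fun h r => by
    exact (congrArg (· ∘ₗ r) (counitT_rTensor_comp_ract D h)).trans (LinearMap.smul_comp _ _ _)
  have e₁ := (h.lift2 ((intertwines_compL_pre _ (onL C a)).lift2
    (intertwines_compL_pre _ (onR N cₗ)))).top B.Φlr⁻¹.val (r.rTensor C)
  refine e₁.trans ((congrArg (act _)
    (lift3_inv_eq_one _ _ _ (B.Φlr_counit_left (pre _ (onL C a)) (pre _ (onR N cₗ))))).trans ?_)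
  exact (LinearMap.rTensor_comp C _ _).symm

lemma counitT_comp_double {r : N →ₗ[k] P ⊗[k] C} :
    counitT D (P ⊗[k] C) ∘ₗ double B D a a' r = r := by
  have e₁ : counitT D (P ⊗[k] C) ∘ₗ rOp B a' = counitT D (P ⊗[k] C) :=
    (comp_lift2 (counitT_mem_onL D (onL C a')) (comp_lift2 (counitT_mem_onL D (onR P cₗ))
      (mem_commutant_counit (counitT_comp_lact D))) _).trans
      (congrArg (· ∘ₗ _) (lift3_inv_eq_one _ _ _ (B.Φr_counit_right' (onL C a') (onR P cₗ))))
  have h : Intertwines ⊤ (compL N (counitT D (P ⊗[k] C))) (post _ (onR (P ⊗[k] C) cᵣ))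
      (Q.counit _) := intertwines_counit fun h r => by
    exact (congrArg (· ∘ₗ r) (counitT_comp_ract D h)).trans (LinearMap.smul_comp _ _ _)
  have e₂ := ((intertwines_compL_post (counitT_mem_onL D (onR P cᵣ))).lift2
    (h.lift2 (intertwines_compL_pre _ a))).top B.Φl⁻¹.val (comulT D P ∘ₗ r)
  rw [double, ← LinearMap.comp_assoc, e₁]
  refine e₂.trans ((congrArg (act _) (lift3_inv_eq_one _ _ _
    (B.Φl_counit_mid' (post N (onR P cᵣ)) (pre _ a)))).trans ?_)
  exact (LinearMap.comp_assoc _ _ _).symm.trans (congrArg (· ∘ₗ r) (counitT_comp_comulT D))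

lemma counitT_rTensor_comp_double {r : N →ₗ[k] P ⊗[k] C} :
    (counitT D P).rTensor C ∘ₗ double B D a a' r = r := by
  have e₁ : (counitT D P).rTensor C ∘ₗ rOp B a' = (counitT D P).rTensor C :=
    (comp_lift2 (rTensor_mem_onL (counitT_mem_onL D a')) (comp_lift2
      (mem_commutant_counit (counitT_rTensor_comp_lact D)) (rTensor_mem_onR _ cₗ)) _).trans
      (congrArg (· ∘ₗ _) (lift3_inv_eq_one _ _ _ (B.Φr_counit_mid' (onL C a') (onR P cₗ))))
  have h : Intertwines ⊤ (compL N ((counitT D P).rTensor C)) (post _ (onL C (onR P cᵣ)))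
      (Q.counit _) := intertwines_counit fun h r => by
    exact (congrArg (· ∘ₗ r) (counitT_rTensor_comp_ract D h)).trans (LinearMap.smul_comp _ _ _)
  have e₂ := (h.lift2 ((intertwines_compL_post (rTensor_mem_onR (counitT D P) cᵣ)).lift2
    (intertwines_compL_pre _ a))).top B.Φl⁻¹.val (comulT D P ∘ₗ r)
  rw [double, ← LinearMap.comp_assoc, e₁]
  refine e₂.trans ((congrArg (act _) (lift3_inv_eq_one _ _ _
    (B.Φl_counit_left' (post N (onR P cᵣ)) (pre _ a)))).trans ?_)
  exact (LinearMap.comp_assoc _ _ _).symm.trans (congrArg (· ∘ₗ r) (counitT_rTensor_comp_comulT D))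

lemma Compat.counitT_comp_mem {r : N →ₗ[k] P ⊗[k] C}
    (hr : Compat B a (actT B cₗ a') (onR P cᵣ) r) : counitT D P ∘ₗ r ∈ commutant a a' := fun u => by
  have h : Intertwines ⊤ (compL N (counitT D P)) (post _ (onR P cᵣ)) (Q.counit _) :=
    intertwines_counit fun h r =>
      (congrArg (· ∘ₗ r) (counitT_comp_ract D h)).trans (LinearMap.smul_comp _ _ _)
  have e := (h.conv (intertwines_compL_pre _ a) B.lam).top u r
  rw [B.conv_lam_counit] at e
  refine e.symm.trans ((congrArg (counitT D P ∘ₗ ·) (hr u)).symm.trans ?_)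
  exact (LinearMap.comp_assoc _ _ _).symm.trans ((congrArg (· ∘ₗ r) (counitT_mem_actT D u)).trans
    (LinearMap.comp_assoc _ _ _))

variable {m : A →ₐ[k] Module.End k M} {e : N →ₗ[k] M ⊗[k] C} {t : N →ₗ[k] N ⊗[k] C}

/-- Applying the counit to the last factor of the mixed law yields e ∘ (id ⊗ ε)t = e. Since (id ⊗
ε)t is A-linear, e can be cancelled. -/
lemma Compat.counitT_comp_self (hinj : Function.Injective (hat B a (onR M cᵣ) e))
    (ht : Compat B a (actT B cₗ a) (onR N cᵣ) t)
    (he : extend B cₗ a (onR M cᵣ) e ∘ₗ t = double B D a m e) :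
    counitT D N ∘ₗ t = LinearMap.id := by
  refine eq_of_comp_eq hinj (intertwines_compL_pre _ a) (fun u => (ht.counitT_comp_mem D u).symm)
    (fun _ => rfl) ?_
  rw [← LinearMap.comp_assoc, ← counitT_comp_extend D (a := a) (b := onR M cᵣ), LinearMap.comp_assoc,
    he, counitT_comp_double]
  rfl

/-- Here the counit is applied to the inner copy of C in the mixed law. The result expresses e by
the coaction t and the projection (id ⊗ ε)e. -/
lemma counitT_comp_rTensor_comp (he : extend B cₗ a (onR M cᵣ) e ∘ₗ t = double B D a m e) :
    (counitT D M ∘ₗ e).rTensor C ∘ₗ t = e := by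
  rw [← counitT_rTensor_comp_extend D (a := a), LinearMap.comp_assoc, he,
    counitT_rTensor_comp_double]

end

/-! ### The coaction on M ⊗ C and the mixed law -/

section

variable (m : A →ₐ[k] Module.End k M)

local notation "c₁" => onL C (onR M (lact k H C))
local notation "c₂" => onR (M ⊗[k] C) (lact k H C)
local notation "s₁" => twistR Q (onL C (onR M (ract k H C)))
local notation "s₂" => twistR Q (onR (M ⊗[k] C) (ract k H C))
local notation "aP" => actT B (lact k H C) m
local notation "b" => onR M (ract k H C)
local notation "μ" => conv (BicomoduleAlgebra.rho B) (onL C (onL C m)) (c₁ ◇ c₂)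

variable (B) in
/-- The map `p ↦ w³ · Δ(p) · S⁻¹(w² ⊗ w¹)` on `M ⊗ C`. -/
def spread (w : H ⊗[k] (H ⊗[k] A)) : M ⊗[k] C →ₗ[k] (M ⊗[k] C) ⊗[k] C :=
  lift3 s₂ s₁ μ w ∘ₗ comulT D M

variable (B) in
/-- The coaction on `M ⊗ C`. -/
def freeCoact : M ⊗[k] C →ₗ[k] (M ⊗[k] C) ⊗[k] C :=
  lift3 s₁ (onL C aP) c₂ B.Φlr⁻¹.val ∘ₗ rOp B m ∘ₗ spread B D m (zElt B)

variable (w : H ⊗[k] (H ⊗[k] A)) (t : H ⊗[k] A)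

/-- S⁻¹ reverses products but not coproducts, so the coproduct of S⁻¹(h), rewritten through the
twisted actions, is `coΔ` h with its tensor factors exchanged. Hence the first factor acts on the
last copy of C. -/
lemma comulT_comp_twistR (h : H) :
    comulT D M ∘ₗ twistR Q b h = lift2 s₂ s₁ (Q.coΔ h) ∘ₗ comulT D M := by
  have e := (intertwines_comulT D (N := M ⊗[k] C)).top (Q.Sinv h) LinearMap.id
  have e' (x : H ⊗[k] H) : comulT D M ⊲ lift2 (post _ (onL C b)) (post _ (onR (M ⊗[k] C) cᵣ)) x
      = lift2 s₂ s₁ (TensorProduct.map Q.S.toLinearMap Q.S.toLinearMap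
          (TensorProduct.comm k H H x)) ∘ₗ comulT D M := by
    induction x using induction2 with
    | add s t hs ht => simp only [map_add, LinearMap.add_comp, hs, ht]
    | tmul x y =>
      rw [lift2_tmul, TensorProduct.comm_tmul, TensorProduct.map_tmul, lift2_tmul]
      simp only [LinearEquiv.coe_coe, twistR_S]
      rfl
  exact e.trans (e' _)

lemma comulT_comp_lift2 : comulT D M ∘ₗ lift2 (twistR Q b) aP t = spread B D m (tId Q.coΔ A t) := by
  rw [spread]
  induction t using induction2 with
  | add s t hs ht => simp only [map_add, LinearMap.comp_add, LinearMap.add_comp, hs, ht]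
  | tmul h x =>
    rw [lift2_tId, lift2_tmul, lift2_tmul, Module.End.mul_eq_comp, ← LinearMap.comp_assoc,
      comulT_comp_twistR, LinearMap.comp_assoc, comulT_mem_actT]
    rfl

/-- Composition of operators becomes multiplication in H ⊗ H ⊗ A. This lemma and those after it turn
identities for z into identities for the coaction. -/
lemma spread_comp_lift2 :
    spread B D m w ∘ₗ lift2 (twistR Q b) aP t = spread B D m (w * tId Q.coΔ A t) := by
  rw [spread, LinearMap.comp_assoc, comulT_comp_lift2, spread, spread, map_mul]
  rfl

lemma lift3_comp_spread (x : H ⊗[k] (H ⊗[k] A)) :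
    lift3 s₂ s₁ μ x ∘ₗ spread B D m w = spread B D m (x * w) := by
  rw [spread, spread, map_mul]
  rfl

lemma rOp_comp_twistR (h h' : H) :
    (s₂ h * s₁ h') ∘ₗ rOp B m = rOp B m ∘ₗ (s₂ h * s₁ h') := by
  have h₁ : rOp (C := C) B m ∈ commutant s₁ s₁ := rOp_commute m s₁
  have h₂ : rOp (C := C) B m ∈ commutant s₂ s₂ := rOp_commute m s₂
  rw [Module.End.mul_eq_comp, LinearMap.comp_assoc, ← h₁, ← LinearMap.comp_assoc, ← h₂,
    LinearMap.comp_assoc]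

lemma actT_actT_comp_rOp (u : A) : actT B cₗ aP u ∘ₗ rOp B m = rOp B m ∘ₗ μ u := by
  refine Eq.trans ?_ (B.Φr_intertwine_inv (onL C (onL C m)) c₁ c₂ u)
  refine congrArg (· * rOp B m) (DFunLike.congr_fun (conv_congr ?_ rfl) u)
  exact comp_conv _ _ _ _

lemma lift2_comp_rOp_spread :
    lift2 s₁ (actT B cₗ aP) t ∘ₗ rOp B m ∘ₗ spread B D m w = rOp B m ∘ₗ spread B D m (1 ⊗ₜ t * w) := by
  induction t using induction2 with
  | add s t hs ht =>
    rw [map_add, LinearMap.add_comp, hs, ht, tmul_add, add_mul, spread, spread, spread, map_add,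
      LinearMap.add_comp, LinearMap.comp_add]
  | tmul h u =>
    have e := rOp_comp_twistR (C := C) (B := B) (M := M) m 1 h
    rw [map_one, one_mul] at e
    rw [lift2_tmul, Module.End.mul_eq_comp, LinearMap.comp_assoc,
      ← LinearMap.comp_assoc _ _ (actT B cₗ aP u), actT_actT_comp_rOp, LinearMap.comp_assoc,
      ← LinearMap.comp_assoc _ _ (s₁ h), e, ← lift3_comp_spread, lift2_tmul, lift2_tmul, map_one,
      one_mul]
    rfl

lemma rOp_spread_act : (rOp B m ∘ₗ spread B D m w) ⊲
      lift2 (post _ (onR (M ⊗[k] C) cᵣ)) (pre _ (twist B aP b)) t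
    = rOp B m ∘ₗ spread B D m (adjT B Q.coΔ w t) := by
  induction t using induction2 with
  | add s t hs ht =>
    rw [map_add, map_add, hs, ht, map_add, spread, spread, spread, map_add, LinearMap.add_comp,
      LinearMap.comp_add]
  | tmul h u =>
    have e := rOp_comp_twistR (C := C) (B := B) (M := M) m (Q.S h) 1
    rw [map_one, mul_one, twistR_S] at e
    rw [adjT_tmul, ← spread_comp_lift2, ← lift3_comp_spread, lift2_tmul, act_mul, act_post, act_pre,
      ← LinearMap.comp_assoc, e, lift2_tmul, map_one, mul_one, twistR_S]
    rfl

lemma spread_act (w' : H ⊗[k] (H ⊗[k] A)) : spread B D m w ⊲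
      lift3 (post _ (onL C b)) (post _ (onR (M ⊗[k] C) cᵣ)) (pre _ (twist B aP b)) w'
    = spread B D m (adj₂ B Q.coΔ w w') := by
  induction w' using induction3 with
  | add s t hs ht => rw [map_add, map_add, hs, ht, map_add, spread, spread, spread, map_add,
      LinearMap.add_comp]
  | tmul x y u =>
    rw [adj₂_tmul, ← spread_comp_lift2, ← lift3_comp_spread, lift2_tmul, lift2_tmul, act_mul,
      act_mul, act_post, act_post, act_pre, lift2_tmul, lift2_tmul, map_one, mul_one, twistR_S,
      twistR_S]
    rfl

lemma lrOp_comp_freeCoact :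
    lrOp B cₗ aP b ∘ₗ freeCoact B D m = rOp B m ∘ₗ spread B D m (zElt B) := by
  rw [freeCoact, lrOp, ← LinearMap.comp_assoc, ← Module.End.mul_eq_comp, lift3_mul_inv]
  rfl

/-- After the invertible operator `lrOp` the claim becomes the identity `tmul_mul_zElt`; its
intertwining property accounts for the change of action. -/
lemma compat_freeCoact :
    Compat B (twist B aP b) (actT B cₗ (twist B aP b)) (onR (M ⊗[k] C) cᵣ) (freeCoact B D m) :=
  fun u => by
  have e₁ := congrArg (· ∘ₗ freeCoact B D m)
    (B.Φlr_intertwine (twistR Q (onL C b)) (onL C aP) c₂ u)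
  have e₂ : actT B cₗ (twist B aP b) = (s₁ ◁ onL C aP) ▷ c₂ := by
    refine conv_congr ?_ rfl
    exact comp_conv _ _ _ _
  have h : lrOp B cₗ aP b ∈ commutant (onR (M ⊗[k] C) cᵣ) (onR (M ⊗[k] C) cᵣ) :=
    mem_commutant_of_commute fun x => (Comm.comm (u := onR (M ⊗[k] C) cᵣ)
      (v := lift3 (twistR Q (onL C b)) (onL C aP) c₂) x B.Φlr.val).symm
  have e₃ := ((intertwines_compL_post (N := M ⊗[k] C) h).conv
    (intertwines_compL_pre _ (twist B aP b)) B.lam).top u (freeCoact B D m)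
  have e₄ : lrOp B cₗ aP b ∘ₗ actT B cₗ (twist B aP b) u ∘ₗ freeCoact B D m
      = lrOp B cₗ aP b ∘ₗ (freeCoact B D m ⊲ (post _ (onR (M ⊗[k] C) cᵣ) ◁ pre _ (twist B aP b)) u) := by
    rw [e₂]
    refine Eq.trans e₁.symm (Eq.trans ?_ e₃.symm)
    refine Eq.trans ?_ (congrArg (act · _) (lrOp_comp_freeCoact D m).symm)
    rw [conv_apply _ (post _ _), rOp_spread_act, ← tmul_mul_zElt, ← lift2_comp_rOp_spread,
      ← lrOp_comp_freeCoact]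
    rfl
  exact LinearMap.ext fun x => lrOp_injective (LinearMap.congr_fun e₄ x)

/-- The formula for the coaction is made for this mixed law. The hat of `extend e` is `lrOp`, so
`extend e` is a q̃-operator after `lrOp`, and `lrOp` cancels the Φ_{λ,ρ}⁻¹ of the coaction. What
remains is `tmul_qElt_mul_zElt`. -/
lemma extend_comp_freeCoact :
    extend B cₗ (twist B aP b) b (qOp B aP b) ∘ₗ freeCoact B D m
      = double B D (twist B aP b) m (qOp B aP b) := by
  -- Recovering `extend e` from its hat, which reduces to `lrOp` because the hat of e is the
  -- identity.
  have e₁ := (compat_qOp B aP b).compat_extend (c := cₗ) |>.qOp_comp_hat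
  rw [(compat_qOp B aP b).hat_extend, hat_qOp, LinearMap.rTensor_id, LinearMap.comp_id] at e₁
  rw [← e₁, LinearMap.comp_assoc, lrOp_comp_freeCoact, qOp, lift2_comp_rOp_spread,
    tmul_qElt_mul_zElt, double, qOp, comulT_comp_lift2, spread_act]

end

/-! ### The universal property of M ⊗ C among Yetter-Drinfeld modules -/

section

variable {a : A →ₐ[k] Module.End k N} {a' : A →ₐ[k] Module.End k P}
  {b : Hᵐᵒᵖ →ₐ[k] Module.End k P}

lemma Compat.comp_left {t : N →ₗ[k] P ⊗[k] C} {m : A →ₐ[k] Module.End k M} {f : P →ₗ[k] M}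
    (ht : Compat B a (actT B cₗ a') (onR P cᵣ) t) (hf : f ∈ commutant a' m) :
    Compat B a (actT B cₗ m) (onR M cᵣ) (f.rTensor C ∘ₗ t) := fun u => by
  have h : f.rTensor C ∈ commutant (actT B cₗ a') (actT B cₗ m) :=
    comp_conv_mem (rTensor_mem_onL hf) (rTensor_mem_onR f _) _
  rw [← LinearMap.comp_assoc, ← h, LinearMap.comp_assoc, ht]
  exact ((intertwines_compL_post (rTensor_mem_onR f cᵣ)).conv (intertwines_compL_pre _ a)
    B.lam).top u t

omit [Module H C] [IsScalarTower k H C] [Module Hᵐᵒᵖ C] [IsScalarTower k Hᵐᵒᵖ C]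
  [SMulCommClass H Hᵐᵒᵖ C] in
lemma Compat.comp_right {r : N →ₗ[k] P} {a₀ : A →ₐ[k] Module.End k M} {g : M →ₗ[k] N}
    (hr : Compat B a a' b r) (hg : g ∈ commutant a₀ a) : Compat B a₀ a' b (r ∘ₗ g) := fun u => by
  have h : Intertwines ⊤ (compR P g) (post N b) (post M b) := .of_top fun _ _ => rfl
  rw [← LinearMap.comp_assoc, hr]
  exact (h.conv (intertwines_compR_pre_top hg) B.lam).top u r

lemma hat_comp_left {d : Hᵐᵒᵖ →ₐ[k] Module.End k V} {f : P →ₗ[k] V} (hf : f ∈ commutant b d)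
    (r : N →ₗ[k] P) : hat B a d (f ∘ₗ r) = f ∘ₗ hat B a b r :=
  (((intertwines_compL_post hf).lift2 (intertwines_compL_pre f a)).top (pElt B) r).symm

lemma hat_comp_right {a₀ : A →ₐ[k] Module.End k M} {g : M →ₗ[k] N} (hg : g ∈ commutant a₀ a)
    (r : N →ₗ[k] P) : hat B a₀ b (r ∘ₗ g) = hat B a b r ∘ₗ g := by
  have h : Intertwines ⊤ (compR P g) (post N b) (post M b) := .of_top fun _ _ => rfl
  exact ((h.lift2 (intertwines_compR_pre_top hg)).top (pElt B) r).symm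

section Free

variable (m : A →ₐ[k] Module.End k M) {t : N →ₗ[k] N ⊗[k] C} {f : N →ₗ[k] M}

variable (B) in
/-- The projection `M ⊗ C → M`. -/
def freeProj : M ⊗[k] C →ₗ[k] M :=
  counitT D M ∘ₗ qOp B (actT B cₗ m) (onR M cᵣ)

lemma freeProj_mem : freeProj B D m ∈ commutant (twist B (actT B cₗ m) (onR M cᵣ)) m :=
  (compat_qOp B _ _).counitT_comp_mem D

lemma freeProj_rTensor_comp :
    (freeProj B D m).rTensor C ∘ₗ freeCoact B D m = qOp B (actT B cₗ m) (onR M cᵣ) :=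
  counitT_comp_rTensor_comp D (extend_comp_freeCoact D m)

variable {m}

lemma Compat.hat_comp_mem (ht : Compat B a (actT B cₗ a) (onR N cᵣ) t) (hf : f ∈ commutant a m) :
    hat B a (onR M cᵣ) (f.rTensor C ∘ₗ t) ∈ commutant a (twist B (actT B cₗ m) (onR M cᵣ)) :=
  (ht.comp_left hf).hat_mem

/-- Both sides are compared after `extend e`. The mixed law turns the right-hand side into a
`double`, the coassociativity of t does the same for the left-hand side, and `extend e` cancels
because its hat is the injective `lrOp`. -/
lemma Compat.hat_comp_colinear (ht : Compat B a (actT B cₗ a) (onR N cᵣ) t)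
    (htt : extend B cₗ a (onR N cᵣ) t ∘ₗ t = double B D a a t) (hf : f ∈ commutant a m) :
    (hat B a (onR M cᵣ) (f.rTensor C ∘ₗ t)).rTensor C ∘ₗ t
      = freeCoact B D m ∘ₗ hat B a (onR M cᵣ) (f.rTensor C ∘ₗ t) := by
  have hφ := ht.hat_comp_mem hf
  have e₁ := (ht.comp_left hf).qOp_comp_hat
  obtain ⟨φ, hφ'⟩ : ∃ φ, φ = hat B a (onR M cᵣ) (f.rTensor C ∘ₗ t) := ⟨_, rfl⟩
  obtain ⟨e, he⟩ : ∃ e, e = qOp B (actT B cₗ m) (onR M cᵣ) := ⟨_, rfl⟩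
  rw [← hφ'] at hφ e₁ ⊢
  rw [← he] at e₁
  have e₂ : extend B cₗ (twist B (actT B cₗ m) (onR M cᵣ)) (onR M cᵣ) e ∘ₗ φ.rTensor C ∘ₗ t
      = extend B cₗ (twist B (actT B cₗ m) (onR M cᵣ)) (onR M cᵣ) e ∘ₗ freeCoact B D m ∘ₗ φ := by
    rw [← LinearMap.comp_assoc, ← LinearMap.comp_assoc, ← extend_comp_right hφ, he,
      extend_comp_freeCoact, ← double_comp_right D hφ, ← he, e₁, double_comp_left D hf, ← htt,
      extend_comp_left (rTensor_mem_onR f cᵣ), LinearMap.comp_assoc]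
  have e₃ : Function.Injective (hat B (actT B cₗ (twist B (actT B cₗ m) (onR M cᵣ)))
      (onL C (onR M cᵣ)) (extend B cₗ (twist B (actT B cₗ m) (onR M cᵣ)) (onR M cᵣ) e)) := by
    rw [he, (compat_qOp B _ _).hat_extend, hat_qOp, LinearMap.rTensor_id, LinearMap.comp_id]
    exact lrOp_injective
  exact eq_of_comp_eq e₃ ((intertwines_compL_post (b' := onR (M ⊗[k] C) cᵣ) extend_mem_onR).conv
    (intertwines_compL_pre _ a) B.lam) (ht.comp_left hφ) ((compat_freeCoact D m).comp_right hφ) e₂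

/-- With φ the hat, e ∘ φ = (f ⊗ id)t; applying ε leaves f by the counit axiom of N. -/
lemma freeProj_comp_hat (ht : Compat B a (actT B cₗ a) (onR N cᵣ) t)
    (hc : counitT D N ∘ₗ t = LinearMap.id) (hf : f ∈ commutant a m) :
    freeProj B D m ∘ₗ hat B a (onR M cᵣ) (f.rTensor C ∘ₗ t) = f := by
  rw [freeProj, LinearMap.comp_assoc, (ht.comp_left hf).qOp_comp_hat, ← LinearMap.comp_assoc,
    counitT_natural, LinearMap.comp_assoc, hc, LinearMap.comp_id]

/-- By colinearity (proj ∘ g ⊗ id)t = (proj ⊗ id)(coaction)g = e ∘ g, whose hat is g since g is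
A-linear. -/
lemma hat_freeProj_comp {g : N →ₗ[k] M ⊗[k] C}
    (hg : g ∈ commutant a (twist B (actT B cₗ m) (onR M cᵣ)))
    (hc : g.rTensor C ∘ₗ t = freeCoact B D m ∘ₗ g) :
    hat B a (onR M cᵣ) ((freeProj B D m ∘ₗ g).rTensor C ∘ₗ t) = g := by
  rw [LinearMap.rTensor_comp, LinearMap.comp_assoc, hc, ← LinearMap.comp_assoc,
    freeProj_rTensor_comp, hat_comp_right hg, hat_qOp, LinearMap.id_comp]

end Free

end

end Coassociativity

/-! ### The Yetter-Drinfeld axioms in operator form -/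

section YetterDrinfeldCriterion

set_option maxSynthPendingDepth 10

variable {k H : Type*} {A C : Type u} [Field k] [Ring H] [Algebra k H] [Ring A] [Algebra k A]
  {Q : QuasiHopfAlgebra k H} {B : BicomoduleAlgebra Q.toQuasiBialgebra A}
  [AddCommGroup C] [Module k C] [Module H C] [Module Hᵐᵒᵖ C]

local infixl:72 " ⊲ " => act
local notation "cₗ" => lact k H C
local notation "cᵣ" => ract k H C

attribute [local instance] SMulZeroClass.toSMul DistribSMul.toSMulZeroClass
  DistribMulAction.toDistribSMul Module.toDistribMulAction Module.End.instAlgebra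
  Module.End.instRing Module.End.instSemiring

variable [IsScalarTower k H C] [IsScalarTower k Hᵐᵒᵖ C] [SMulCommClass H Hᵐᵒᵖ C]
  (D : BimoduleCoalgebra Q.toQuasiBialgebra C)

section

variable {M : Type*} [AddCommGroup M] [Module k M] [Module A M] [IsScalarTower k A M]

local notation "a" => lact k A M

lemma lift2_onL_onR_apply (t : A ⊗[k] H) (x : M ⊗[k] C) :
    lift2 (onL C a) (onR M cₗ) t x = opT (lop M) (lop C) t x := by
  induction t using induction2 with
  | add s t hs ht => simp only [map_add, LinearMap.add_apply, hs, ht]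
  | tmul u h =>
    induction x using induction2 with
    | add s t hs ht => simp only [map_add, hs, ht]
    | tmul m c =>
      rw [lift2_tmul]
      rfl

lemma compat_iff {r : M →ₗ[k] M ⊗[k] C} :
    Compat B a (actT B cₗ a) (onR M cᵣ) r ↔ ∀ (u : A) m,
    opT (lop M) (lop C) (B.rho u) (r m)
    = bi (fun h x => (rop C h).lTensor M (r (x • m)))
      (fun _ => by
        constructor <;> intros <;> simp [LinearMap.lTensor_add, LinearMap.lTensor_smul])
      (fun _ => by constructor <;> intros <;> simp [add_smul]) (B.lam u) := by
  refine forall_congr' fun u => ?_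
  rw [LinearMap.ext_iff]
  refine forall_congr' fun m => ?_
  rw [← lift2_onL_onR_apply]
  refine Eq.congr rfl ?_
  rw [conv_apply]
  generalize B.lam u = t
  induction t using induction2 with
  | add s t hs ht => rw [map_add, map_add, LinearMap.add_apply, hs, ht, map_add]
  | tmul h x =>
    rw [lift2_tmul, bi_tmul]
    rfl

lemma assoc_rOp (x : (M ⊗[k] C) ⊗[k] C) : TensorProduct.assoc k M C C (rOp B a x)
    = opT (lop M) (opT (lop C) (lop C)) B.Φr⁻¹.val (TensorProduct.assoc k M C C x) := by
  rw [rOp]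
  generalize B.Φr⁻¹.val = t
  induction t using induction3 with
  | add s t hs ht => simp only [map_add, LinearMap.add_apply, hs, ht]
  | tmul u h h' =>
    induction x using induction2 with
    | add s t hs ht => simp only [map_add, hs, ht]
    | tmul x d =>
      induction x using induction2 with
      | add s t hs ht => simp only [map_add, add_tmul, hs, ht]
      | tmul m c =>
        rw [lift2_tmul, lift2_tmul]
        rfl

lemma assoc_extend_comp_apply (r : M →ₗ[k] M ⊗[k] C) (m : M) : TensorProduct.assoc k M C C ((extend B cₗ a (onR M cᵣ) r ∘ₗ r) m)
    = tri (fun θ₁ θ₂ θ₃ => TensorProduct.assoc k M C C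
      (TensorProduct.map ((rop C θ₁).lTensor M ∘ₗ r ∘ₗ lop M θ₂) (lop C θ₃) (r m)))
    (fun _ _ => by
      constructor <;> intros <;> simp [LinearMap.add_comp, LinearMap.smul_comp,
        LinearMap.lTensor_add, LinearMap.lTensor_smul, TensorProduct.map_add_left,
        TensorProduct.map_smul_left])
    (fun _ _ => by
      constructor <;> intros <;> simp [LinearMap.comp_add, LinearMap.comp_smul,
        TensorProduct.map_add_left, TensorProduct.map_smul_left])
    (fun _ _ => by
      constructor <;> intros <;> simp [TensorProduct.map_add_right,
        TensorProduct.map_smul_right])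
    B.Φlr⁻¹.val := by
  rw [extend]
  generalize B.Φlr⁻¹.val = t
  induction t using induction3 with
  | add s t hs ht =>
    refine Eq.trans ?_ ((congrArg₂ (· + ·) hs ht).trans (LinearMap.map_add _ s t).symm)
    exact (congrArg _ (LinearMap.congr_fun (congrArg (fun f => (act _ f) ∘ₗ r)
      (map_add (lift3 _ _ _) s t)) m)).trans
        ((congrArg _ (LinearMap.congr_fun (congrArg (· ∘ₗ r) (map_add (act _) _ _)) m)).trans
          (map_add (TensorProduct.assoc k M C C) _ _))
  | tmul h u h' =>
    rw [tri_tmul, lift2_tmul, lift2_tmul, LinearMap.comp_apply]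
    refine congrArg _ ?_
    generalize r m = x
    induction x using induction2 with
    | add s t hs ht => rw [map_add, map_add, hs, ht]
    | tmul m c => rfl

lemma assoc_double_apply (r : M →ₗ[k] M ⊗[k] C) (m : M) : TensorProduct.assoc k M C C (double B D a a r m)
    = opT (lop M) (opT (lop C) (lop C)) B.Φr⁻¹.val
    (tri (fun x₁ x₂ x₃ => (TensorProduct.map (rop C x₁) (rop C x₂)).lTensor M
        (D.Δ.lTensor M (r (x₃ • m))))
      (fun _ _ => by
        constructor <;> intros <;> simp [LinearMap.lTensor_add, LinearMap.lTensor_smul,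
          TensorProduct.map_add_left, TensorProduct.map_smul_left])
      (fun _ _ => by
        constructor <;> intros <;> simp [LinearMap.lTensor_add, LinearMap.lTensor_smul,
          TensorProduct.map_add_right, TensorProduct.map_smul_right])
      (fun _ _ => by constructor <;> intros <;> simp [add_smul])
      B.Φl⁻¹.val) := by
  rw [double, LinearMap.comp_apply, assoc_rOp]
  refine congrArg _ ?_
  generalize B.Φl⁻¹.val = t
  induction t using induction3 with
  | add s t hs ht =>
    refine Eq.trans ?_ ((congrArg₂ (· + ·) hs ht).trans (LinearMap.map_add _ s t).symm)
    exact (congrArg _ (LinearMap.congr_fun (congrArg (act _) (map_add (lift3 _ _ _) s t)) m)).trans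
        ((congrArg _ (LinearMap.congr_fun (map_add (act _) _ _) m)).trans
          (map_add (TensorProduct.assoc k M C C) _ _))
  | tmul h h' u =>
    rw [tri_tmul, lift2_tmul, lift2_tmul, act_mul, act_mul, act_pre, act_post, act_post,
      LinearMap.comp_apply, LinearMap.comp_apply, LinearMap.comp_apply, LinearMap.comp_apply, comulT,
      LinearMap.comp_apply]
    change TensorProduct.assoc k M C C (onR (M ⊗[k] C) cᵣ (.op h') (onL C (onR M cᵣ) (.op h)
      ((TensorProduct.assoc k M C C).symm (D.Δ.lTensor M (r (u • m)))))) = _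
    generalize D.Δ.lTensor M (r (u • m)) = x
    induction x using induction3 with
    | add s t hs ht => simp only [map_add, hs, ht]
    | tmul m c d => rfl

lemma isYetterDrinfeld_iff {r : M →ₗ[k] M ⊗[k] C} :
    IsYetterDrinfeld B D r ↔ counitT D M ∘ₗ r = LinearMap.id ∧
      extend B cₗ a (onR M cᵣ) r ∘ₗ r = double B D a a r ∧
      Compat B a (actT B cₗ a) (onR M cᵣ) r := by
  constructor
  · rintro ⟨h₁, h₂, h₃⟩
    refine ⟨LinearMap.ext h₁, LinearMap.ext fun m => ?_, compat_iff.mpr h₃⟩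
    exact (TensorProduct.assoc k M C C).injective
      ((assoc_extend_comp_apply r m).trans ((h₂ m).trans (assoc_double_apply D r m).symm))
  · rintro ⟨h₁, h₂, h₃⟩
    refine ⟨LinearMap.congr_fun h₁, fun m => ?_, compat_iff.mp h₃⟩
    exact (assoc_extend_comp_apply r m).symm.trans ((congrArg (TensorProduct.assoc k M C C)
      (LinearMap.congr_fun h₂ m)).trans (assoc_double_apply D r m))

end

section

variable (M : Type u) [AddCommGroup M] [Module k M] [Module A M] [IsScalarTower k A M]

local notation "a" => lact k A M

lemma inducedAction_eq :
    inducedAction (C := C) B M = twist B (actT B cₗ a) (onR M cᵣ) := by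
  refine AlgHom.ext fun u => ?_
  have e (t : H ⊗[k] (A ⊗[k] H)) :
      twistedOp Q C M t = lift3 (twistR Q (onR M cᵣ)) (onL C a) (onR M cₗ) t := by
    induction t using induction3 with
    | add s t hs ht => rw [map_add, map_add, hs, ht]
    | tmul h u h' =>
      rw [lift2_tmul, lift2_tmul, twistedOp, tri_tmul]
      refine TensorProduct.ext' fun m c => ?_
      exact congrArg (_ ⊗ₜ ·) (smul_comm h' (MulOpposite.op (Q.Sinv h)) c)
  exact (e _).trans (lift2_idT_conv _ _ _ B.rho (B.lam u))

/-- The operator of the explicit coaction is the value of one algebra map at a fivefold tensor, so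
the three factors of `wElt` give three operators to be composed. The left and right H-actions may be
exchanged because C is a bimodule. -/
lemma inducedCoaction_eq :
    (show M ⊗[k] C →ₗ[k] (M ⊗[k] C) ⊗[k] C from inducedCoaction B D M) = freeCoact B D a := by
  obtain ⟨κ, hκ⟩ : ∃ κ, κ = lift2 (twistR Q (onR (M ⊗[k] C) cᵣ)) (lift2 (twistR Q (onL C (onR M cᵣ)))
    (lift3 (onL C (onL C a)) (onL C (onR M cₗ)) (onR (M ⊗[k] C) cₗ))) := ⟨_, rfl⟩
  have e (w : H ⊗[k] (H ⊗[k] (A ⊗[k] (H ⊗[k] H)))) (x : M ⊗[k] (C ⊗[k] C)) :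
      (TensorProduct.assoc k M C C).symm (coactOp Q C M w x)
        = κ w ((TensorProduct.assoc k M C C).symm x) := by
    rw [hκ]
    induction w using induction3 with
    | add s t hs ht => simp only [map_add, LinearMap.add_apply, hs, ht]
    | tmul h₁ h₂ t =>
      rw [lift2_tmul, lift2_tmul, coactOp, tri_tmul]
      induction t using induction3 with
      | add s t hs ht =>
        simp only [map_add, LinearMap.add_apply, mul_add, LinearMap.add_comp, hs, ht]
      | tmul u h h' =>
        rw [lift2_tmul, lift2_tmul]
        induction x using induction3 with
        | add s t hs ht => simp only [map_add, hs, ht]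
        | tmul m c d =>
          change (u • m ⊗ₜ (h • MulOpposite.op (Q.Sinv h₂) • c)) ⊗ₜ
              (h' • MulOpposite.op (Q.Sinv h₁) • d)
            = (u • m ⊗ₜ (MulOpposite.op (Q.Sinv h₂) • h • c)) ⊗ₜ
              (MulOpposite.op (Q.Sinv h₁) • h' • d)
          rw [smul_comm h, smul_comm h']
  have e₁ : κ (wElt B) = lift3 (twistR Q (onL C (onR M cᵣ))) (onL C (actT B cₗ a))
      (onR (M ⊗[k] C) cₗ) B.Φlr⁻¹.val * rOp B a *
      lift3 (twistR Q (onR (M ⊗[k] C) cᵣ)) (twistR Q (onL C (onR M cᵣ))) (conv B.rho (onL C (onL C a))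
        (conv Q.Δ (onL C (onR M cₗ)) (onR (M ⊗[k] C) cₗ))) (zElt B) := by
    rw [wElt, map_mul, map_mul]
    refine congrArg₂ (· * ·) (congrArg₂ (· * ·) ?_ ?_) ?_
    · rw [hκ, lift2_tmul, map_one, one_mul, lift4_idT_tId]
      refine DFunLike.congr_fun (lift2_congr rfl (lift2_congr ?_ rfl)) _
      exact (comp_conv _ _ _ _).symm
    · rw [hκ, lift2_tmul, map_one, one_mul, lift2_tmul, map_one, one_mul]
      rfl
    · generalize zElt B = z
      induction z using induction3 with
      | add s t hs ht => rw [map_add, map_add, map_add, hs, ht]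
      | tmul h h' u =>
        rw [hκ, Algebra.TensorProduct.map_tmul, Algebra.TensorProduct.map_tmul, lift2_tmul, lift2_tmul,
          lift2_tmul, lift2_tmul]
        refine congrArg (fun x => twistR Q (onR (M ⊗[k] C) cᵣ) h *
          (twistR Q (onL C (onR M cᵣ)) h' * x)) ?_
        exact lift2_idT_conv _ _ _ Q.Δ (B.rho u)
  refine LinearMap.ext fun x => ?_
  refine (e _ _).trans ?_
  rw [e₁]
  rfl

/-- The deductions from the mixed law, applied to e = `qOp`, whose hat is the identity and hence
injective. -/
theorem isYetterDrinfeld_inducedCoaction : IsYetterDrinfeld B D (inducedCoaction B D M) := by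
  have e₁ := compat_freeCoact (B := B) D a
  have e₂ := extend_comp_freeCoact (B := B) D a
  have e₃ : Function.Injective (hat B (twist B (actT B cₗ a) (onR M cᵣ)) (onR M cᵣ)
      (qOp B (actT B cₗ a) (onR M cᵣ))) := by
    rw [hat_qOp]
    exact Function.injective_id
  have e₄ := Compat.counitT_comp_self D e₃ e₁ e₂
  have e₅ := (compat_qOp B (actT B cₗ a) (onR M cᵣ)).extend_comp_self D e₃ e₁ e₂
  rw [← inducedAction_eq, ← inducedCoaction_eq] at e₁ e₅
  rw [← inducedCoaction_eq] at e₄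
  exact (isYetterDrinfeld_iff D).mpr ⟨e₄, e₅, e₁⟩

end

end YetterDrinfeldCriterion

/-! ### The two adjunctions -/

section Adjunctions

variable {k H : Type*} {A C : Type u} [Field k] [Ring H] [Algebra k H] [Ring A] [Algebra k A]
  {Q : QuasiHopfAlgebra k H} {B : BicomoduleAlgebra Q.toQuasiBialgebra A}
  [AddCommGroup C] [Module k C] [Module H C] [IsScalarTower k H C]
  [Module Hᵐᵒᵖ C] [IsScalarTower k Hᵐᵒᵖ C] [SMulCommClass H Hᵐᵒᵖ C]
  {D : BimoduleCoalgebra Q.toQuasiBialgebra C}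
  (h : ∀ M : ModuleCat.{u} A, IsYetterDrinfeld B D (inducedCoaction B D M))

section Forgetful

lemma restrictScalars_mem_commutant {N M : Type*} [AddCommGroup N] [Module k N] [Module A N]
    [IsScalarTower k A N] [AddCommGroup M] [Module k M] [Module A M] [IsScalarTower k A M]
    (f : N →ₗ[A] M) : f.restrictScalars k ∈ commutant (lact k A N) (lact k A M) :=
  fun u => LinearMap.ext fun n => f.map_smul u n

variable {N N' : YDModule B D} {M M' : ModuleCat.{u} A}

/-- The linear map underlying the transpose of an `A`-linear map `f : N → M`. -/
def transposeLinear (f : N →ₗ[A] M) : N →ₗ[k] M ⊗[k] C :=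
  hat B (lact k A N) (onR M (ract k H C)) ((f.restrictScalars k).rTensor C ∘ₗ N.coact)

lemma YDModule.compat (N : YDModule B D) :
    Compat B (lact k A N) (actT B (lact k H C) (lact k A N)) (onR N (ract k H C)) N.coact :=
  ((isYetterDrinfeld_iff D).mp N.isYD).2.2

lemma transposeLinear_mem (f : N →ₗ[A] M) :
    transposeLinear f ∈ commutant (lact k A N) (inducedAction (C := C) B M) := by
  rw [inducedAction_eq]
  exact N.compat.hat_comp_mem (restrictScalars_mem_commutant f)

lemma transposeLinear_colinear (f : N →ₗ[A] M) :
    (transposeLinear f).rTensor C ∘ₗ N.coact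
      = (show M ⊗[k] C →ₗ[k] (M ⊗[k] C) ⊗[k] C from inducedCoaction B D M) ∘ₗ transposeLinear f := by
  rw [inducedCoaction_eq]
  exact N.compat.hat_comp_colinear D ((isYetterDrinfeld_iff D).mp N.isYD).2.1
    (restrictScalars_mem_commutant f)

/-- The Yetter-Drinfeld morphism `N → M ⊗ C` corresponding to an `A`-linear map `N → M`. -/
def transpose (f : N →ₗ[A] M) : N ⟶ (inductionFunctor B D h).obj M :=
  ⟨{ toFun := transposeLinear f
     map_add' := map_add (transposeLinear f)
     map_smul' := fun u n => LinearMap.congr_fun (transposeLinear_mem f u) n },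
    fun n => LinearMap.congr_fun (transposeLinear_colinear f) n⟩

lemma freeProj_mem_inducedAction :
    freeProj B D (lact k A M) ∈ commutant (inducedAction (C := C) B M) (lact k A M) := by
  rw [inducedAction_eq]
  exact freeProj_mem D _

variable (M) in
/-- The `A`-linear projection `M ⊗ C → M`. -/
def inducedProj : Induced B D M →ₗ[A] M where
  toFun := freeProj B D (lact k A M)
  map_add' := map_add (freeProj B D (lact k A M))
  map_smul' u x := LinearMap.congr_fun (freeProj_mem_inducedAction u) x

lemma inducedProj_comp_transpose (f : N →ₗ[A] M) : inducedProj M ∘ₗ (transpose h f).1 = f :=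
  LinearMap.ext fun n => LinearMap.congr_fun (freeProj_comp_hat D N.compat
    ((isYetterDrinfeld_iff D).mp N.isYD).1 (restrictScalars_mem_commutant f)) n

lemma transpose_inducedProj_comp (g : N ⟶ (inductionFunctor B D h).obj M) :
    transpose h ((inducedProj M : Induced B D M →ₗ[A] M) ∘ₗ g.1) = g := by
  have e₁ : (g.1.restrictScalars k : N →ₗ[k] M ⊗[k] C) ∈
      commutant (lact k A N) (inducedAction (C := C) B M) :=
    fun u => LinearMap.ext fun n => g.1.map_smul u n
  have e₂ : (g.1.restrictScalars k : N →ₗ[k] M ⊗[k] C).rTensor C ∘ₗ N.coact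
      = (show M ⊗[k] C →ₗ[k] (M ⊗[k] C) ⊗[k] C from inducedCoaction B D M) ∘ₗ
        (g.1.restrictScalars k : N →ₗ[k] M ⊗[k] C) := LinearMap.ext g.2
  rw [inducedAction_eq] at e₁
  rw [inducedCoaction_eq] at e₂
  exact Subtype.ext (LinearMap.ext fun n => LinearMap.congr_fun (hat_freeProj_comp D e₁ e₂) n)

lemma transpose_comp (f : N →ₗ[A] M) (g : M ⟶ M') :
    transpose h (g.hom ∘ₗ f) = transpose h f ≫ (inductionFunctor B D h).map g := by
  have e := hat_comp_left (B := B) (a := lact k A N) (rTensor_mem_onR (C := C) (g.hom.restrictScalars k)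
    (ract k H C)) ((f.restrictScalars k).rTensor C ∘ₗ N.coact)
  rw [← LinearMap.comp_assoc, ← LinearMap.rTensor_comp] at e
  exact Subtype.ext (LinearMap.ext fun n => LinearMap.congr_fun e n)

/-- The functor `• ⊗ C` is right adjoint to the forgetful functor. -/
def forgetfulAdjunction : YDModule.forgetful B D ⊣ inductionFunctor B D h :=
  Adjunction.mkOfHomEquiv
    { homEquiv := fun N M =>
        { toFun := fun f => transpose h (M := M) f.hom
          invFun := fun g => ModuleCat.ofHom
            ((inducedProj M : Induced B D M →ₗ[A] M) ∘ₗ g.1 : N →ₗ[A] M)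
          left_inv := fun _ => ModuleCat.hom_ext (inducedProj_comp_transpose h (M := M) _)
          right_inv := fun g => transpose_inducedProj_comp h g }
      homEquiv_naturality_left_symm := fun _ _ => rfl
      homEquiv_naturality_right := fun _ g => transpose_comp h _ g }

end Forgetful

section Hom

variable {N N' : YDModule B D} {M M' : ModuleCat.{u} A}

/-- The `A`-linear map `A → M`, `u ↦ u m`. -/
abbrev orbitMap (m : M) : ModuleCat.of A A ⟶ M :=
  ModuleCat.ofHom (LinearMap.toSpanSingleton A M m)

/-- The map `m ↦ (u ⊗ c ↦ g(u m ⊗ c))`. -/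
def curryHom (g : (inductionFunctor B D h).obj M ⟶ N) : M →ₗ[A] HomAC h N where
  toFun m := (inductionFunctor B D h).map (orbitMap m) ≫ g
  map_add' m m' := hom_ext_pureTensor fun u c => by
    change g.1 (pureTensor h M (u • (m + m')) c) = g.1 (pureTensor h M (u • m) c)
      + g.1 (pureTensor h M (u • m') c)
    rw [smul_add, ← map_add]
    exact congrArg g.1 (pureTensor_add h M _ _ c)
  map_smul' v m := hom_ext_pureTensor fun u c => by
    change g.1 (pureTensor h M (u • (v • m)) c) = g.1 (pureTensor h M ((u * v) • m) c)
    rw [mul_smul]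

lemma pureTensor_smul (r : k) (m : M) (c : C) : pureTensor h M (r • m) c = r • pureTensor h M m c :=
  (smul_tmul' r m c).symm

lemma pureTensor_smul_right (r : k) (m : M) (c : C) :
    pureTensor h M m (r • c) = r • pureTensor h M m c :=
  tmul_smul r m c

lemma pureTensor_add_right (m : M) (c c' : C) :
    pureTensor h M m (c + c') = pureTensor h M m c + pureTensor h M m c' :=
  tmul_add m c c'

variable {h} in
@[elab_as_elim]
lemma pureTensor_induction {p : (inductionFunctor B D h).obj M → Prop} (zero : p 0)
    (add : ∀ x y, p x → p y → p (x + y)) (pure : ∀ m c, p (pureTensor h M m c)) (x) : p x :=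
  TensorProduct.induction_on (motive := fun x : M ⊗[k] C => p x) x zero pure add

/-- The bilinear map `(m, c) ↦ η(m)(1 ⊗ c)`. -/
def uncurryLinear (η : M →ₗ[A] HomAC h N) : (inductionFunctor B D h).obj M →ₗ[k] N :=
  show M ⊗[k] C →ₗ[k] N from
  TensorProduct.lift <| LinearMap.mk₂ k
    (fun m c => (η m).1 (pureTensor h (ModuleCat.of A A) (1 : A) c))
    (fun m m' c => by rw [map_add]; rfl)
    (fun r m c => by
      -- The scalar acts on m through its image in A, so A-linearity of η applies. The factor it
      -- places in A is then a scalar and leaves the tensor.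
      rw [← algebraMap_smul A r m, map_smul, HomAC.smul_apply, one_mul]
      refine Eq.trans ?_ (((η m).1.restrictScalars k).map_smul r _)
      rw [← pureTensor_smul]
      exact congrArg (fun x => (η m).1 (pureTensor h (ModuleCat.of A A) x c))
        (mul_one (algebraMap k A r)).symm)
    (fun m c c' => by rw [← map_add, pureTensor_add_right])
    (fun r m c => by
      rw [pureTensor_smul_right]
      exact ((η m).1.restrictScalars k).map_smul r _)

/-- The uncurried map restricts along each orbit morphism to the Yetter-Drinfeld morphism η(m). As
every m ⊗ c lies in the image of such a morphism, linearity over A and colinearity are inherited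
from the η(m). -/
lemma uncurryLinear_comp_orbitMap (η : M →ₗ[A] HomAC h N) (m : M)
    (x : (inductionFunctor B D h).obj (ModuleCat.of A A)) :
    uncurryLinear h η (((inductionFunctor B D h).map (orbitMap m)).1 x) = (η m).1 x := by
  induction x using pureTensor_induction with
  | zero => rw [map_zero, map_zero, map_zero]
  | add x y hx hy => rw [map_add, map_add, map_add, hx, hy]
  | pure u c =>
    change (η ((u : A) • m)).1 (pureTensor h (ModuleCat.of A A) (1 : A) c) = _
    rw [map_smul, HomAC.smul_apply, one_mul]

lemma orbitMap_pureTensor (m : M) (c : C) : ((inductionFunctor B D h).map (orbitMap m)).1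
    (pureTensor h (ModuleCat.of A A) (1 : A) c) = pureTensor h M m c := by
  change (((1 : A) • m : M) ⊗ₜ[k] c : M ⊗[k] C) = m ⊗ₜ c
  rw [one_smul]

/-- The Yetter-Drinfeld morphism `m ⊗ c ↦ η(m)(1 ⊗ c)`. -/
def uncurryHom (η : M →ₗ[A] HomAC h N) : (inductionFunctor B D h).obj M ⟶ N :=
  ⟨{ toFun := uncurryLinear h η
     map_add' := map_add (uncurryLinear h η)
     map_smul' := fun u x => by
      induction x using pureTensor_induction with
      | zero => rw [smul_zero, map_zero, smul_zero]
      | add x y hx hy => rw [smul_add, map_add, map_add, hx, hy, smul_add]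
      | pure m c =>
        change uncurryLinear h η (u • pureTensor h M m c) = u • uncurryLinear h η (pureTensor h M m c)
        rw [← orbitMap_pureTensor, ← map_smul, uncurryLinear_comp_orbitMap,
          uncurryLinear_comp_orbitMap, map_smul] },
    fun x => by
      change (uncurryLinear h η).rTensor C (((inductionFunctor B D h).obj M).coact x)
        = N.coact (uncurryLinear h η x)
      induction x using pureTensor_induction with
      | zero => simp only [map_zero]
      | add x y hx hy => simp only [map_add, hx, hy]
      | pure m c =>
        -- Colinearity at m ⊗ c: replace it by the image of 1 ⊗ c and combine the colinearity of the
        -- orbit morphism with that of η(m).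
        have e : (uncurryLinear h η) ∘ₗ ((inductionFunctor B D h).map (orbitMap m)).1.restrictScalars k
          = (η m).1.restrictScalars k := LinearMap.ext (uncurryLinear_comp_orbitMap h η m)
        rw [← orbitMap_pureTensor, uncurryLinear_comp_orbitMap, ← (η m).2,
          ← ((inductionFunctor B D h).map (orbitMap m)).2, ← LinearMap.comp_apply,
          ← LinearMap.rTensor_comp, e]⟩

lemma uncurryHom_curryHom (g : (inductionFunctor B D h).obj M ⟶ N) :
    uncurryHom h (curryHom h g) = g :=
  hom_ext_pureTensor fun m c => congrArg g.1 (orbitMap_pureTensor h m c)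

lemma curryHom_uncurryHom (η : M →ₗ[A] HomAC h N) : curryHom h (uncurryHom h η) = η :=
  LinearMap.ext fun m => Subtype.ext (LinearMap.ext (uncurryLinear_comp_orbitMap h η m))

/-- The functor `• ⊗ C` is left adjoint to `Hom(A ⊗ C, •)`. -/
def homAdjunction : inductionFunctor B D h ⊣ homFunctor B D h :=
  Adjunction.mkOfHomEquiv
    { homEquiv := fun _ _ =>
        { toFun := fun g => ModuleCat.ofHom (curryHom h g)
          invFun := fun η => uncurryHom h η.hom
          left_inv := fun g => uncurryHom_curryHom h g
          right_inv := fun η => ModuleCat.hom_ext (curryHom_uncurryHom h η.hom) }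
      homEquiv_naturality_left_symm := fun _ _ => hom_ext_pureTensor fun _ _ => rfl
      homEquiv_naturality_right := fun _ _ => rfl }

end Hom

end Adjunctions

end QuasiYD

end

theorem corollary3p9 {k H : Type*} [Field k] [Ring H] [Algebra k H]
    (Q : QuasiYD.QuasiHopfAlgebra k H)
    {A C : Type u} [Ring A] [Algebra k A]
    (B : QuasiYD.BicomoduleAlgebra Q.toQuasiBialgebra A)
    [AddCommGroup C] [Module k C] [Module H C] [IsScalarTower k H C] [Module Hᵐᵒᵖ C]
    [IsScalarTower k Hᵐᵒᵖ C] [SMulCommClass H Hᵐᵒᵖ C]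
    (D : QuasiYD.BimoduleCoalgebra Q.toQuasiBialgebra C) :
    ∃ h : ∀ M : ModuleCat.{u} A,
        QuasiYD.IsYetterDrinfeld B D (QuasiYD.inducedCoaction B D M),
      QuasiYD.IsYetterDrinfeld B D (QuasiYD.inducedCoaction B D A) ∧
      Nonempty (QuasiYD.YDModule.forgetful B D ⊣ QuasiYD.inductionFunctor B D h) ∧
      Nonempty (QuasiYD.inductionFunctor B D h ⊣ QuasiYD.homFunctor B D h) := by
  have h (M : ModuleCat.{u} A) := QuasiYD.isYetterDrinfeld_inducedCoaction (B := B) D M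
  exact ⟨h, QuasiYD.isYetterDrinfeld_inducedCoaction D A, ⟨QuasiYD.forgetfulAdjunction h⟩,
    ⟨QuasiYD.homAdjunction h⟩⟩
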